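/- Let $1\le t\le r,s\le n$ with $t>r+s-n$, and let $v=v_{r,s,t,n}\in S_n$ be the bigrassmannian permutation characterized by: $r$ is the only descent of $v$, $s$ is the only descent of $v^{-1}$, and $v_t=s+1$. Put $$i=s-t+1,\qquad j=r-t+1,\qquad a=\min(n-r-i,\;r-j),\qquad b=\min(i,j).$$ Identify the integral cohomology ring $H^*(G/B,\mathbb Z)$ of the variety of complete flags in $\mathbb C^n$ with the coinvariant algebra $\mathbb Z[x_1,\dots,x_n]/(\mathbb Z[x_1,\dots,x_n]^{S_n}_+)$. For $u\in S_n$ let $\sigma_u$ be the Schubert class, i.e. the class of the Schubert polynomial $\mathfrak S_u=\partial_{u^{-1}w_0}(x_1^{n-1}x_2^{n-2}\cdots x_{n-1})$, and let $J_v$ be the $\mathbb Z$-span of the $\sigma_u$ with $u\ge v$ in the strong Bruhat order. Let $\Lambda$ be the ring of symmetric functions over $\mathbb Z$ and $I_{r,n-r}\subset\Lambda$ the ideal spanned by the Schur functions $s_\mu$ with $\mu\not\subseteq (n-r)^r$. Then $\mathfrak S_v=s_{i^j}(x_1,\dots,x_r)$, where $i^j$ is the partition with $j$ parts equal to $i$,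 and the map $f\mapsto f(x_1,\dots,x_r)$ from $\Lambda$ to the coinvariant algebra has kernel $I_{r,n-r}$, so that $\Lambda/I_{r,n-r}$, the integral cohomology ring of the Grassmannian of $r$-planes in $\mathbb C^n$, is identified with a subring of $H^*(G/B,\mathbb Z)$. Moreover, for each of the two sets $$\{\,s_\mu : i^j\subseteq\mu\subseteq((i+a)^b,\,i^{j-b})\,\}\qquad\text{and}\qquad\{\,s_\mu : i^j\subseteq\mu\subseteq(i^j,\,b^a)\,\}$$ the following holds: the set generates $J_v\cap\Lambda/I_{r,n-r}$ as an ideal of $\Lambda/I_{r,n-r}$; it generates $J_v$ as an ideal of $H^*(G/B,\mathbb Z)$; and it has exactly $\binom{a+b}{a}$ elements (as a set of classes in $\Lambda/I_{r,n-r}$). -/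

import Mathlib

open MvPolynomial Equiv

noncomputable section

namespace SchubertGens

/-! ### The ring of symmetric functions over the integers -/

/-- Setting the last of `N + 1` variables equal to zero. -/
def killLast (N : ℕ) : MvPolynomial (Fin (N + 1)) ℤ →ₐ[ℤ] MvPolynomial (Fin N) ℤ :=
  aeval (Fin.lastCases 0 X)

/-- The ring `Λ` of symmetric functions in `x₀, x₁, …` with integer coefficients: the inverse
limit, in the category of graded rings, of the rings of symmetric polynomials in `N` variables.
An element is a family of symmetric polynomials of bounded degree, one in each number of
variables, which is compatible with setting the last variable equal to zero. -/
def SymmFun : Subring (∀ N : ℕ, MvPolynomial (Fin N) ℤ) where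
  carrier := {f | (∀ N, (f N).IsSymmetric) ∧ (∀ N, killLast N (f (N + 1)) = f N) ∧
    ∃ d : ℕ, ∀ N, (f N).totalDegree ≤ d}
  mul_mem' := by
    rintro f g ⟨hf, hf', d, hd⟩ ⟨hg, hg', e, he⟩
    refine ⟨fun N => (hf N).mul (hg N), fun N => ?_, d + e, fun N => ?_⟩
    · simp [hf', hg']
    · exact (totalDegree_mul _ _).trans (add_le_add (hd N) (he N))
  one_mem' := ⟨fun N => IsSymmetric.one, fun N => by simp, 0, fun N => by simp⟩
  add_mem' := by
    rintro f g ⟨hf, hf', d, hd⟩ ⟨hg, hg', e, he⟩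
    refine ⟨fun N => (hf N).add (hg N), fun N => ?_, max d e, fun N => ?_⟩
    · simp [hf', hg']
    · exact (totalDegree_add _ _).trans (max_le_max (hd N) (he N))
  zero_mem' := ⟨fun N => IsSymmetric.zero, fun N => by simp, 0, fun N => by simp⟩
  neg_mem' := by
    rintro f ⟨hf, hf', d, hd⟩
    refine ⟨fun N => (hf N).neg, fun N => ?_, d, fun N => ?_⟩
    · simp [hf']
    · simpa using hd N

/-- The restriction `f ↦ f(x₀, …, x_{N-1}, 0, 0, …)` of a symmetric function to `N` variables. -/
def restrict (N : ℕ) : SymmFun →+* MvPolynomial (Fin N) ℤ :=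
  (Pi.evalRingHom (fun N : ℕ => MvPolynomial (Fin N) ℤ) N).comp SymmFun.subtype

theorem hsymm_option (σ : Type) [Fintype σ] [DecidableEq σ] (m : ℕ) :
    hsymm (Option σ) ℤ (m + 1) =
      X none * hsymm (Option σ) ℤ m + rename some (hsymm σ ℤ (m + 1)) := by
  unfold hsymm
  rw [← Equiv.sum_comp (symOptionSuccEquiv (α := σ) (n := m)).symm, Fintype.sum_sum_type]
  congr 1
  · rw [Finset.mul_sum]
    refine Finset.sum_congr rfl fun s _ => ?_
    change ((none ::ₘ s.1).map X).prod = _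
    rw [Multiset.map_cons, Multiset.prod_cons]
  · rw [map_sum]
    refine Finset.sum_congr rfl fun s _ => ?_
    change ((s.map (Function.Embedding.some)).1.map X).prod = _
    rw [map_multiset_prod]
    simp [Sym.map, Multiset.map_map]

theorem hsymm_fin_succ (N m : ℕ) :
    hsymm (Fin (N + 1)) ℤ (m + 1) =
      X (Fin.last N) * hsymm (Fin (N + 1)) ℤ m + rename Fin.castSucc (hsymm (Fin N) ℤ (m + 1)) := by
  have h := congrArg (rename (R := ℤ) (finSuccEquivLast (n := N)).symm) (hsymm_option (Fin N) m)
  rw [map_add, map_mul, rename_hsymm, rename_hsymm, rename_X, rename_rename] at h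
  rw [h]
  congr 2
  congr 1
  ext i
  simp

theorem killLast_rename (N : ℕ) (p : MvPolynomial (Fin N) ℤ) :
    killLast N (rename Fin.castSucc p) = p := by
  rw [killLast, aeval_rename]
  have : (Fin.lastCases 0 X : Fin (N + 1) → MvPolynomial (Fin N) ℤ) ∘ Fin.castSucc = X := by
    ext1 i
    simp
  rw [this, aeval_X_left_apply]

theorem killLast_hsymm (N m : ℕ) :
    killLast N (hsymm (Fin (N + 1)) ℤ m) = hsymm (Fin N) ℤ m := by
  cases m with
  | zero => simp
  | succ m =>
    rw [hsymm_fin_succ, map_add, map_mul, killLast_rename]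
    simp [killLast]

theorem totalDegree_hsymm_le (N m : ℕ) : (hsymm (Fin N) ℤ m).totalDegree ≤ m := by
  refine totalDegree_finsetSum_le fun s _ => ?_
  refine (totalDegree_multiset_prod _).trans ?_
  rw [Multiset.map_map]
  have : Multiset.map (totalDegree ∘ (X : Fin N → MvPolynomial (Fin N) ℤ)) s.1 =
      Multiset.map (fun _ => 1) s.1 := Multiset.map_congr rfl fun _ _ => by simp
  rw [this]
  simp

/-- The complete homogeneous symmetric function `h_m`. -/
def completeHomog (m : ℕ) : SymmFun :=
  ⟨fun N => hsymm (Fin N) ℤ m, fun _ => hsymm_isSymmetric _ _ m,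
    fun N => killLast_hsymm N m, m,
    fun N => totalDegree_hsymm_le N m⟩

/-- `h_z` for an integer index `z`, with `h_z = 0` for `z < 0`. -/
def completeHomogInt (z : ℤ) : SymmFun := if z < 0 then 0 else completeHomog z.toNat

/-- The Schur function `s_μ`, given by the Jacobi-Trudi determinant with `ℓ(μ)` rows
(partitions are Young diagrams in English notation: `μ.rowLen p` is the part `μ_{p+1}`). By
`restrict_schur_mul_vandermonde` below this is the usual Schur function: its restriction to
`N ≥ ℓ(μ)` variables is the quotient of alternants `det (x_q ^ (μ_p + N - p)) / det (x_q ^ (N - p))`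
(with `1 ≤ p, q ≤ N`). -/
def schur (μ : YoungDiagram) : SymmFun :=
  Matrix.det (Matrix.of fun p q : Fin (μ.colLen 0) =>
    completeHomogInt ((μ.rowLen p : ℤ) - (p : ℤ) + (q : ℤ)))

theorem hsymm_series (N : ℕ) :
    PowerSeries.mk (fun m => hsymm (Fin N) ℤ m) *
      ∏ i : Fin N, (1 - PowerSeries.C (X i : MvPolynomial (Fin N) ℤ) * PowerSeries.X) = 1 := by
  induction N with
  | zero =>
    ext m : 1
    cases m with
    | zero => simp
    | succ m => simp [PowerSeries.coeff_one, hsymm]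
  | succ N ih =>
    have step : PowerSeries.mk (fun m => hsymm (Fin (N + 1)) ℤ m) *
        (1 - PowerSeries.C (X (Fin.last N)) * PowerSeries.X) =
        PowerSeries.map (rename (R := ℤ) (Fin.castSucc (n := N))).toRingHom
          (PowerSeries.mk (fun m => hsymm (Fin N) ℤ m)) := by
      ext m : 1
      rw [mul_sub, mul_one, mul_left_comm]
      cases m with
      | zero => simp
      | succ m =>
        rw [map_sub, PowerSeries.coeff_C_mul, PowerSeries.coeff_succ_mul_X]
        simp [hsymm_fin_succ]
    have ih' := congrArg (PowerSeries.map (rename (R := ℤ) (Fin.castSucc (n := N))).toRingHom) ih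
    rw [map_mul, map_prod, map_one, ← step] at ih'
    rw [Fin.prod_univ_castSucc, mul_comm (∏ i : Fin N, _), ← mul_assoc]
    simpa using ih'

/-- The polynomial `∏_{i ≠ k} (1 - x_i T)`. -/
def erasedProd (N : ℕ) (k : Fin N) : Polynomial (MvPolynomial (Fin N) ℤ) :=
  ∏ i ∈ Finset.univ.erase k, (1 - Polynomial.C (X i) * Polynomial.X)

theorem erasedProd_coeff (N : ℕ) (k : Fin N) (d : ℕ) (hd : N ≤ d) :
    (erasedProd N k).coeff d = 0 := by
  apply Polynomial.coeff_eq_zero_of_natDegree_lt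
  refine lt_of_le_of_lt (Polynomial.natDegree_prod_le _ _) ?_
  have : ∑ i ∈ Finset.univ.erase k,
      (1 - Polynomial.C (X i : MvPolynomial (Fin N) ℤ) * Polynomial.X).natDegree
      ≤ ∑ i ∈ (Finset.univ : Finset (Fin N)).erase k, 1 := by
    refine Finset.sum_le_sum fun i _ => ?_
    refine (Polynomial.natDegree_sub_le _ _).trans ?_
    simp
  have hk := k.pos
  simp at this
  omega

theorem hsymm_mul_erasedProd (N : ℕ) (k : Fin N) :
    PowerSeries.mk (fun m => hsymm (Fin N) ℤ m) * (erasedProd N k : PowerSeries _) =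
      PowerSeries.mk fun m => X k ^ m := by
  have h := hsymm_series N
  rw [← Finset.prod_erase_mul _ _ (Finset.mem_univ k), ← mul_assoc] at h
  have h2 : PowerSeries.mk (fun m => (X k : MvPolynomial (Fin N) ℤ) ^ m) *
      (1 - PowerSeries.C (X k) * PowerSeries.X) = 1 := by
    ext m : 1
    rw [mul_sub, mul_one, mul_left_comm]
    cases m with
    | zero => simp
    | succ m =>
      rw [map_sub, PowerSeries.coeff_C_mul, PowerSeries.coeff_succ_mul_X]
      simp [PowerSeries.coeff_one, pow_succ']
  have hE : (erasedProd N k : PowerSeries (MvPolynomial (Fin N) ℤ)) =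
      ∏ i ∈ Finset.univ.erase k,
        (1 - PowerSeries.C (X i : MvPolynomial (Fin N) ℤ) * PowerSeries.X) := by
    rw [erasedProd, ← Polynomial.coeToPowerSeries.ringHom_apply, map_prod]
    simp
  rw [← hE] at h
  rw [← mul_one (PowerSeries.mk _ * _), ← h2, mul_comm (PowerSeries.mk fun m => X k ^ m),
    ← mul_assoc, h, one_mul]

/-- The polynomial `h_z(x₀, …, x_{N-1})`, zero for `z < 0`. -/
def hz (N : ℕ) (z : ℤ) : MvPolynomial (Fin N) ℤ := if z < 0 then 0 else hsymm (Fin N) ℤ z.toNat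

theorem restrict_completeHomogInt (N : ℕ) (z : ℤ) : restrict N (completeHomogInt z) = hz N z := by
  unfold completeHomogInt hz
  split_ifs
  · simp
  · rfl

theorem sum_hz (N : ℕ) (k : Fin N) (α : ℕ) :
    ∑ d ∈ Finset.range N, hz N ((α : ℤ) - d) * (erasedProd N k).coeff d = X k ^ α := by
  have h := congrArg (PowerSeries.coeff α) (hsymm_mul_erasedProd N k)
  rw [PowerSeries.coeff_mul, PowerSeries.coeff_mk,
    Finset.Nat.sum_antidiagonal_eq_sum_range_succ_mk, ← Finset.sum_range_reflect] at h
  rw [← h]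
  have e1 : ∑ d ∈ Finset.range N, hz N ((α : ℤ) - d) * (erasedProd N k).coeff d =
      ∑ d ∈ Finset.range (max N (α + 1)), hz N ((α : ℤ) - d) * (erasedProd N k).coeff d := by
    refine Finset.sum_subset (by simp) fun d _ hd => ?_
    rw [erasedProd_coeff N k d (by simpa using hd), mul_zero]
  have e2 : ∑ d ∈ Finset.range (α + 1), hz N ((α : ℤ) - d) * (erasedProd N k).coeff d =
      ∑ d ∈ Finset.range (max N (α + 1)), hz N ((α : ℤ) - d) * (erasedProd N k).coeff d := by
    refine Finset.sum_subset (by simp) fun d _ hd => ?_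
    have : (α : ℤ) - d < 0 := by
      simp at hd
      omega
    rw [hz, if_pos this, zero_mul]
  rw [e1, ← e2]
  refine Finset.sum_congr rfl fun d hd => ?_
  have hd' : d ≤ α := by simpa [Nat.lt_succ_iff] using hd
  have h1 : ¬ (α : ℤ) - d < 0 := by omega
  have h2 : ((α : ℤ) - d).toNat = α + 1 - 1 - d := by omega
  have h3 : α - (α + 1 - 1 - d) = d := by omega
  simp only [hz, if_neg h1, h2, h3, PowerSeries.coeff_mk, Polynomial.coeff_coe]

theorem jacobiTrudi_mul (N : ℕ) (l : ℕ → ℕ) :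
    (Matrix.of fun p q : Fin N => hz N ((l p : ℤ) - (p : ℤ) + (q : ℤ))) *
      (Matrix.of fun q k : Fin N => (erasedProd N k).coeff (N - 1 - q)) =
    Matrix.of fun p k : Fin N => X k ^ (l p + (N - 1 - p)) := by
  ext1 p k
  rw [Matrix.mul_apply, Matrix.of_apply, ← sum_hz, ← Fin.sum_univ_eq_sum_range
    (fun d => hz N (((l p + (N - 1 - p) : ℕ) : ℤ) - d) * (erasedProd N k).coeff d),
    ← Equiv.sum_comp Fin.revPerm]
  refine Finset.sum_congr rfl fun q _ => ?_
  have hp := p.2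
  have hq := q.2
  simp only [Matrix.of_apply, Fin.revPerm_apply, Fin.val_rev]
  congr 2 <;> omega

theorem det_jacobiTrudi_stable (N : ℕ) (l : ℕ → ℕ) (L M : ℕ) (hL : ∀ p, L ≤ p → l p = 0)
    (hM : L ≤ M) :
    Matrix.det (Matrix.of fun p q : Fin L => hz N ((l p : ℤ) - (p : ℤ) + (q : ℤ))) =
      Matrix.det (Matrix.of fun p q : Fin M => hz N ((l p : ℤ) - (p : ℤ) + (q : ℤ))) := by
  induction M, hM using Nat.le_induction with
  | base => rfl
  | succ M hM ih =>
    rw [ih, Matrix.det_succ_row _ (Fin.last M), Finset.sum_eq_single (Fin.last M)]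
    · have h1 : (-1 : MvPolynomial (Fin N) ℤ) ^ (M + M) = 1 := Even.neg_one_pow ⟨M, rfl⟩
      simp only [Matrix.of_apply, Fin.val_last, hL M hM, h1, one_mul, Fin.succAbove_last]
      have h2 : hz N ((0 : ℕ) - (M : ℤ) + M) = 1 := by simp [hz]
      rw [h2, one_mul]
      rfl
    · intro q _ hq
      have hq' : (q : ℕ) < M := by
        have := q.2
        have : (q : ℕ) ≠ M := fun h => hq (Fin.ext h)
        omega
      have : hz N ((0 : ℕ) - (M : ℤ) + (q : ℤ)) = 0 := by
        rw [hz, if_pos (by omega)]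
      simp only [Matrix.of_apply, Fin.val_last, hL M hM, this]
      ring
    · simp

/-- The Schur functions defined above are the quotients of alternants. -/
theorem restrict_schur_mul_vandermonde (μ : YoungDiagram) (N : ℕ) (hN : μ.colLen 0 ≤ N) :
    restrict N (schur μ) * Matrix.det (Matrix.of fun p q : Fin N =>
      (X q : MvPolynomial (Fin N) ℤ) ^ (N - 1 - (p : ℕ))) =
    Matrix.det (Matrix.of fun p q : Fin N =>
      (X q : MvPolynomial (Fin N) ℤ) ^ (μ.rowLen p + (N - 1 - (p : ℕ)))) := by
  have hrow : ∀ p, μ.colLen 0 ≤ p → μ.rowLen p = 0 := by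
    intro p hp
    by_contra h
    have h1 : (p, 0) ∈ μ := YoungDiagram.mem_iff_lt_rowLen.2 (Nat.pos_of_ne_zero h)
    have h2 := YoungDiagram.mem_iff_lt_colLen.1 h1
    omega
  have hs : restrict N (schur μ) =
      Matrix.det (Matrix.of fun p q : Fin N => hz N ((μ.rowLen p : ℤ) - (p : ℤ) + (q : ℤ))) := by
    rw [← det_jacobiTrudi_stable N μ.rowLen _ N hrow hN, schur, RingHom.map_det]
    congr 1
    ext1 p q
    simp [restrict_completeHomogInt]
  have h0 := congrArg Matrix.det (jacobiTrudi_mul N fun _ => 0)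
  have h1 := congrArg Matrix.det (jacobiTrudi_mul N μ.rowLen)
  rw [Matrix.det_mul] at h0 h1
  have hu : Matrix.det (Matrix.of fun p q : Fin N =>
      hz N (((0 : ℕ) : ℤ) - (p : ℤ) + (q : ℤ))) = 1 := by
    rw [Matrix.det_of_isUpperTriangular]
    · simp [hz]
    · intro p q hpq
      have : (q : ℕ) < p := hpq
      simp only [Matrix.of_apply]
      rw [hz, if_pos (by omega)]
  rw [hu, one_mul] at h0
  rw [hs, ← h1, h0]
  simp

/-! ### Partitions -/

/-- The rectangular partition `c^m`: `m` parts, all equal to `c`. -/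
def rect (m c : ℕ) : YoungDiagram where
  cells := Finset.range m ×ˢ Finset.range c
  isLowerSet := by
    rintro ⟨p, q⟩ ⟨p', q'⟩ ⟨h1, h2⟩ h
    simp only [Finset.coe_product, Finset.coe_range, Set.mem_prod, Set.mem_Iio] at h ⊢
    exact ⟨lt_of_le_of_lt h1 h.1, lt_of_le_of_lt h2 h.2⟩

/-- The ideal `I_{r,m}` of `Λ` spanned by the `s_μ` for the partitions `μ` which do not fit in the
rectangle `m^r` (`r` rows of length `m`). -/
def boxIdeal (r m : ℕ) : Ideal SymmFun :=
  Ideal.span (schur '' {μ | ¬ μ ≤ rect r m})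

/-! ### Divided differences and Schubert polynomials -/

section Schubert

variable {n : ℕ}

/-- The positions `k` and `k + 1` (counted from `0`) among `n`, for `k < n - 1`. -/
def leftPos (k : Fin (n - 1)) : Fin n := ⟨k, by have := k.2; omega⟩

/-- See `leftPos`. -/
def rightPos (k : Fin (n - 1)) : Fin n := ⟨k + 1, by have := k.2; omega⟩

/-- The adjacent transposition of `k` and `k + 1`. -/
def adjSwap (k : Fin (n - 1)) : Perm (Fin n) := swap (leftPos k) (rightPos k)

theorem leftPos_ne_rightPos (k : Fin (n - 1)) : leftPos k ≠ rightPos k := by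
  simp [leftPos, rightPos, Fin.ext_iff]

theorem exists_divDiff (k : Fin (n - 1)) (f : MvPolynomial (Fin n) ℤ) :
    ∃ g, (X (leftPos k) - X (rightPos k)) * g = f - rename (adjSwap k) f := by
  induction f using MvPolynomial.induction_on with
  | C c => exact ⟨0, by simp⟩
  | add p q hp hq =>
    obtain ⟨g, hg⟩ := hp
    obtain ⟨g', hg'⟩ := hq
    exact ⟨g + g', by rw [mul_add, hg, hg', map_add]; ring⟩
  | mul_X p i hp =>
    obtain ⟨g, hg⟩ := hp
    have hi : ∃ c : MvPolynomial (Fin n) ℤ,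
        (X (leftPos k) - X (rightPos k)) * c = X i - X (adjSwap k i) := by
      by_cases h1 : i = leftPos k
      · exact ⟨1, by simp [h1, adjSwap]⟩
      by_cases h2 : i = rightPos k
      · exact ⟨-1, by simp [h2, adjSwap]⟩
      exact ⟨0, by simp [adjSwap, swap_apply_of_ne_of_ne h1 h2]⟩
    obtain ⟨c, hc⟩ := hi
    refine ⟨g * X i + rename (adjSwap k) p * c, ?_⟩
    rw [mul_add, ← mul_assoc, hg, mul_left_comm, hc, map_mul, rename_X]
    ring

/-- The divided difference `∂_k f = (f - s_k f) / (x_k - x_{k+1})`. -/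
def divDiff (k : Fin (n - 1)) (f : MvPolynomial (Fin n) ℤ) : MvPolynomial (Fin n) ℤ :=
  (exists_divDiff k f).choose

theorem mul_divDiff (k : Fin (n - 1)) (f : MvPolynomial (Fin n) ℤ) :
    (X (leftPos k) - X (rightPos k)) * divDiff k f = f - rename (adjSwap k) f :=
  (exists_divDiff k f).choose_spec

/-- The product of the adjacent transpositions listed in `l`. -/
def wordProd (l : List (Fin (n - 1))) : Perm (Fin n) := (l.map adjSwap).prod

/-- `l` is a reduced decomposition of `u`: a shortest expression of `u` as a product of adjacent
transpositions. -/
def IsReducedWord (u : Perm (Fin n)) (l : List (Fin (n - 1))) : Prop :=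
  wordProd l = u ∧ ∀ l' : List (Fin (n - 1)), wordProd l' = u → l.length ≤ l'.length

theorem exists_word (u : Perm (Fin n)) : ∃ l : List (Fin (n - 1)), wordProd l = u := by
  cases n with
  | zero => exact ⟨[], Subsingleton.elim _ _⟩
  | succ n =>
    have hu : u ∈ Submonoid.closure
        (Set.range fun i : Fin n => swap i.castSucc i.succ) := by
      rw [Equiv.Perm.mclosure_swap_castSucc_succ]
      trivial
    induction hu using Submonoid.closure_induction with
    | mem x hx =>
      obtain ⟨i, rfl⟩ := hx
      refine ⟨[i], ?_⟩
      simp only [wordProd, List.map_cons, List.map_nil, List.prod_cons, List.prod_nil, mul_one]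
      rfl
    | one => exact ⟨[], rfl⟩
    | mul x y _ _ hx hy =>
      obtain ⟨l, rfl⟩ := hx
      obtain ⟨l', rfl⟩ := hy
      exact ⟨l ++ l', by simp [wordProd]⟩

theorem exists_isReducedWord (u : Perm (Fin n)) : ∃ l, IsReducedWord u l := by
  classical
  have h : ∃ m, ∃ l : List (Fin (n - 1)), wordProd l = u ∧ l.length = m := by
    obtain ⟨l, hl⟩ := exists_word u
    exact ⟨_, l, hl, rfl⟩
  obtain ⟨l, hl, hm⟩ := Nat.find_spec h
  exact ⟨l, hl, fun l' hl' => hm.trans_le (Nat.find_min' h ⟨l', hl', rfl⟩)⟩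

/-- The operator `∂_u = ∂_{k_1} ⋯ ∂_{k_ℓ}`, where `u = s_{k_1} ⋯ s_{k_ℓ}` is a reduced
decomposition (chosen arbitrarily). -/
def divDiffPerm (u : Perm (Fin n)) (f : MvPolynomial (Fin n) ℤ) : MvPolynomial (Fin n) ℤ :=
  (exists_isReducedWord u).choose.foldr divDiff f

/-- The Schubert polynomial `𝔖_w = ∂_{w⁻¹ w₀} (x₁^{n-1} x₂^{n-2} ⋯ x_n^0)`, where `w₀` is the
order-reversing permutation. -/
def schubert (w : Perm (Fin n)) : MvPolynomial (Fin n) ℤ :=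
  divDiffPerm (w⁻¹ * Fin.revPerm) (∏ p : Fin n, X p ^ (n - 1 - (p : ℕ)))

/-! ### Bruhat order, descents, bigrassmannian permutations -/

/-- The strong Bruhat order on the symmetric group: the reflexive-transitive closure of the
relation `u < u (p q)` for `p < q` and `u p < u q`, that is, of right multiplication by a
transposition that increases the length. -/
def BruhatLE (u w : Perm (Fin n)) : Prop :=
  Relation.ReflTransGen
    (fun x y : Perm (Fin n) => ∃ p q : Fin n, p < q ∧ x p < x q ∧ y = x * swap p q) u w

/-- The set of descents of `w`: all `k ∈ {1, …, n-1}` with `w_k > w_{k+1}`, in the one-line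
notation `w_1 ⋯ w_n` with positions counted from `1`. -/
def descents (w : Perm (Fin n)) : Set ℕ :=
  {k | ∃ p q : Fin n, (p : ℕ) + 1 = k ∧ (q : ℕ) = k ∧ w q < w p}

/-- `v` is the bigrassmannian permutation `v_{r,s,t,n}`: its only descent is `r`, the only descent
of its inverse is `s`, and `v_t = s + 1` (with positions and values counted from `1`). -/
def IsBigrassmannian (r s t : ℕ) (v : Perm (Fin n)) : Prop :=
  descents v = {r} ∧ descents v⁻¹ = {s} ∧ ∃ p : Fin n, (p : ℕ) + 1 = t ∧ (v p : ℕ) + 1 = s + 1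

end Schubert

/-! ### The cohomology rings -/

/-- The ideal generated by the symmetric polynomials without constant term. -/
def coinvIdeal (n : ℕ) : Ideal (MvPolynomial (Fin n) ℤ) :=
  Ideal.span {f | f.IsSymmetric ∧ constantCoeff f = 0}

/-- The integral coinvariant algebra, which is Borel's presentation of the integral cohomology
ring of the variety of complete flags in `ℂⁿ`. -/
abbrev Coinv (n : ℕ) : Type := MvPolynomial (Fin n) ℤ ⧸ coinvIdeal n

/-- The Schubert class `σ_w`. -/
def schubertClass {n : ℕ} (w : Perm (Fin n)) : Coinv n :=
  Ideal.Quotient.mk (coinvIdeal n) (schubert w)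

/-- `J_v`, the `ℤ`-span of the Schubert classes `σ_u` with `u ≥ v` in Bruhat order. -/
def schubertSpan {n : ℕ} (v : Perm (Fin n)) : Submodule ℤ (Coinv n) :=
  Submodule.span ℤ (schubertClass '' {u | BruhatLE v u})

/-- A symmetric function in `x₁, …, x_r`, viewed as a polynomial in `x₁, …, x_n`. -/
def firstVars {r n : ℕ} (h : r ≤ n) : SymmFun →+* MvPolynomial (Fin n) ℤ :=
  (rename (R := ℤ) (Fin.castLE h)).toRingHom.comp (restrict r)

/-- The ring homomorphism `f ↦ f(x₁, …, x_r)` from `Λ` to the coinvariant algebra. -/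
def toCoinv {r n : ℕ} (h : r ≤ n) : SymmFun →+* Coinv n :=
  (Ideal.Quotient.mk (coinvIdeal n)).comp (firstVars h)

/-- The set of all `s_μ` with `α ⊆ μ ⊆ β`. -/
def schurInterval (α β : YoungDiagram) : Set SymmFun := schur '' Set.Icc α β

/-- `G`, a set of symmetric functions, generates the part of `J_v` in the cohomology ring
`Λ / I_{r,n-r}` of the Grassmannian as an ideal of this ring (a class lies in `J_v` when its
image in the coinvariant algebra does). -/
def GeneratesInGrassmannian {r n : ℕ} (h : r ≤ n) (v : Perm (Fin n)) (G : Set SymmFun) : Prop :=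
  ∀ f : SymmFun, Ideal.Quotient.mk (boxIdeal r (n - r)) f ∈
    Ideal.span (Ideal.Quotient.mk (boxIdeal r (n - r)) '' G) ↔ toCoinv h f ∈ schubertSpan v

/-- `G`, a set of symmetric functions, generates `J_v` as an ideal of the cohomology ring of the
variety of complete flags. -/
def GeneratesInFlag {r n : ℕ} (h : r ≤ n) (v : Perm (Fin n)) (G : Set SymmFun) : Prop :=
  (Ideal.span (toCoinv h '' G)).restrictScalars ℤ = schubertSpan v

end SchubertGens

end

open SchubertGens

/-!
Everything is read off from divided differences. For a permutation `u` let `schubertCoeff u f` be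
the constant term of `∂_u f`. Divided differences satisfy the braid relations, so they may be
computed along any reduced word, and a word that is not reduced gives zero
(`divDiffWord_eq_or`). By the Leibniz rule, multiplication by a variable expresses
`schubertCoeff u` through `schubertCoeff (u * swap p q)` with `u * swap p q` below `u` in Bruhat
order (`X_mul_mem_avoiding`). These functionals are dual to the Schubert polynomials
(`schubertCoeff_schubert`), and the coinvariant ideal is their common kernel
(`mem_coinvIdeal_iff`); the latter rests on `mem_span_invariants`, which says that a group of
polynomials stable under the variables and the divided differences with indices in an interval is
generated by its invariants. Hence the class of `f` is `∑ schubertCoeff u f • σ_u`.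

Applied to a Jacobi-Trudi determinant in `x_1, …, x_r`, written as a determinant whose columns
have different numbers of variables, a divided difference changes one column only
(`natDivDiff_flaggedDet`). So a Schur polynomial with shape in the box `(n-r)^r` has exactly one
nonzero coefficient, at the Grassmannian permutation of that shape (`schubertCoeff_schur`). It
involves only monomials dividing the staircase monomial, and on such polynomials the functionals
are jointly injective (`eq_zero_of_staircaseBounded`), so it is equal to the Schubert polynomial
(`schubert_grassmannianPerm`). Since alternants show that `Λ` is spanned by Schur functions
(`exists_eq_sum_schur`), the kernel of `Λ → H^*(G/B)` is the box ideal (`ker_toCoinv`).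

For bigrassmannian `v` the relation `v ≤ u` is a single rank condition on `u`
(`IsBigrassmannian.bruhatLE_iff`). Consequently `J_v` is an ideal, consisting of the classes
whose coefficients vanish on a lower set that is stable under right multiplication by all
adjacent transpositions but the one at `r`. Therefore `mem_span_invariants`, applied on both
sides of `r`, shows that `J_v` is generated by Schubert classes of Grassmannian permutations with
descent at `r`, that is, by all `s_μ` with `i^j ⊆ μ` (`mk_mem_span_schur_of_avoiding`).

It remains to generate these `s_μ`, in `R = Λ / I_{r,n-r}`, by the ones in the two intervals. In
`R` the generating functions of the `h_d` and of the `± e_d` become polynomials `H` and `E` with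
`H * E = 1`, of degrees at most `n - r` and `r`. Schur functions become determinants
`det (h_{k_p + σ_q})` (`hankel`). By Laplace expansion and Pieri's rule, the ideal `M` of the
`s_μ` with `i^j ⊆ μ` is generated by those with at most `j` rows (`hankel_mem_rowsIdeal`), and
after transposition each of them is the determinant with rows `i, i-1, …, i-j+1` and columns a set
`S` of natural numbers. Adding a row `-x` and a column `x` changes this determinant only by an
element of `R_+ M`, because the new diagonal entry is `h_0 = 1` (`hankel_sub_mem`). Adding them
for all `x < L` which are not in `S` makes the columns consecutive: modulo `R_+ M`, the set `S` of
columns is exchanged for a set of rows which is given by its complement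
(`hankel_mem_of_complement`). The new determinant vanishes if it has two equal rows or if it has
more than `r` rows with large enough indices, and the old one if a row exceeds the degree of `H`.
What survives are, in the old form, the partitions of the interval below `i^j ∪ (i+a)^b` and, in
the new form, those of the interval below `i^j ∪ b^(j+a)`. Since `R_+` is nilpotent, Nakayama's
lemma removes the error term `R_+ M` (`rowsIdeal_le_span_wide`, `rowsIdeal_le_span_long`).

Finally, the Schur functions in the box are linearly independent in `R`, and both intervals are
isomorphic to the set of partitions in a rectangle with sides `a` and `b` (`ncard_Iic_rect`).
-/

noncomputable section

namespace SchubertGens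

section DividedDifferences

variable {n : ℕ}

/-! ### Divided differences -/

theorem X_sub_X_ne_zero {p q : Fin n} (h : p ≠ q) :
    (X p - X q : MvPolynomial (Fin n) ℤ) ≠ 0 :=
  sub_ne_zero.2 fun e => h (X_injective e)

theorem left_sub_right_ne_zero (k : Fin (n - 1)) :
    (X (leftPos k) - X (rightPos k) : MvPolynomial (Fin n) ℤ) ≠ 0 :=
  X_sub_X_ne_zero (leftPos_ne_rightPos k)

theorem divDiff_eq_of_mul {k : Fin (n - 1)} {f g : MvPolynomial (Fin n) ℤ}
    (h : (X (leftPos k) - X (rightPos k)) * g = f - rename (adjSwap k) f) : divDiff k f = g :=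
  mul_left_cancel₀ (left_sub_right_ne_zero k) ((mul_divDiff k f).trans h.symm)

@[simp] theorem adjSwap_leftPos (k : Fin (n - 1)) : adjSwap k (leftPos k) = rightPos k := by
  simp [adjSwap]

@[simp] theorem adjSwap_rightPos (k : Fin (n - 1)) : adjSwap k (rightPos k) = leftPos k := by
  simp [adjSwap]

theorem adjSwap_of_ne {k : Fin (n - 1)} {p : Fin n} (h1 : p ≠ leftPos k) (h2 : p ≠ rightPos k) :
    adjSwap k p = p := swap_apply_of_ne_of_ne h1 h2

@[simp] theorem adjSwap_mul_self (k : Fin (n - 1)) : adjSwap k * adjSwap k = 1 :=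
  swap_mul_self _ _

@[simp] theorem adjSwap_mul_self_mul (k : Fin (n - 1)) (u : Perm (Fin n)) :
    adjSwap k * (adjSwap k * u) = u := by
  rw [← mul_assoc, adjSwap_mul_self, one_mul]

@[simp] theorem adjSwap_inv (k : Fin (n - 1)) : (adjSwap k)⁻¹ = adjSwap k := swap_inv _ _

@[simp] theorem rename_adjSwap_adjSwap (k : Fin (n - 1)) (f : MvPolynomial (Fin n) ℤ) :
    rename (adjSwap k) (rename (adjSwap k) f) = f := by
  rw [rename_rename, ← Perm.coe_mul, adjSwap_mul_self]
  simp

theorem divDiff_add (k : Fin (n - 1)) (f g : MvPolynomial (Fin n) ℤ) :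
    divDiff k (f + g) = divDiff k f + divDiff k g := by
  apply divDiff_eq_of_mul
  rw [mul_add, mul_divDiff, mul_divDiff, map_add]
  ring

/-- The divided difference as an additive map. -/
def divDiffHom (k : Fin (n - 1)) : MvPolynomial (Fin n) ℤ →+ MvPolynomial (Fin n) ℤ :=
  AddMonoidHom.mk' (divDiff k) (divDiff_add k)

@[simp] theorem divDiff_zero (k : Fin (n - 1)) : divDiff k (0 : MvPolynomial (Fin n) ℤ) = 0 :=
  map_zero (divDiffHom k)

theorem divDiff_sum {ι : Type*} (k : Fin (n - 1)) (s : Finset ι)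
    (f : ι → MvPolynomial (Fin n) ℤ) : divDiff k (∑ x ∈ s, f x) = ∑ x ∈ s, divDiff k (f x) :=
  map_sum (divDiffHom k) f s

theorem divDiff_zsmul (k : Fin (n - 1)) (c : ℤ) (f : MvPolynomial (Fin n) ℤ) :
    divDiff k (c • f) = c • divDiff k f := map_zsmul (divDiffHom k) c f

theorem divDiff_mul (k : Fin (n - 1)) (f g : MvPolynomial (Fin n) ℤ) :
    divDiff k (f * g) = divDiff k f * g + rename (adjSwap k) f * divDiff k g := by
  apply divDiff_eq_of_mul
  rw [map_mul]
  linear_combination g * mul_divDiff k f + rename (adjSwap k) f * mul_divDiff k g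

theorem rename_eq_of_divDiff_eq_zero {k : Fin (n - 1)} {f : MvPolynomial (Fin n) ℤ}
    (h : divDiff k f = 0) : rename (adjSwap k) f = f := by
  have := mul_divDiff k f
  rw [h, mul_zero] at this
  exact (sub_eq_zero.1 this.symm).symm

theorem divDiff_eq_zero_of_rename_eq {k : Fin (n - 1)} {f : MvPolynomial (Fin n) ℤ}
    (h : rename (adjSwap k) f = f) : divDiff k f = 0 := by
  apply divDiff_eq_of_mul
  rw [h]
  ring

theorem divDiff_mul_of_invariant {k : Fin (n - 1)} {f : MvPolynomial (Fin n) ℤ}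
    (h : rename (adjSwap k) f = f) (g : MvPolynomial (Fin n) ℤ) :
    divDiff k (f * g) = f * divDiff k g := by
  rw [divDiff_mul, divDiff_eq_zero_of_rename_eq h, h, zero_mul, zero_add]

theorem rename_divDiff (k : Fin (n - 1)) (f : MvPolynomial (Fin n) ℤ) :
    rename (adjSwap k) (divDiff k f) = divDiff k f := by
  apply mul_left_cancel₀ (left_sub_right_ne_zero k)
  have h := congrArg (rename (R := ℤ) (adjSwap k)) (mul_divDiff k f)
  simp only [map_mul, map_sub, rename_X, adjSwap_leftPos, adjSwap_rightPos,
    rename_adjSwap_adjSwap] at h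
  linear_combination -h - mul_divDiff k f

@[simp] theorem divDiff_divDiff (k : Fin (n - 1)) (f : MvPolynomial (Fin n) ℤ) :
    divDiff k (divDiff k f) = 0 := divDiff_eq_zero_of_rename_eq (rename_divDiff k f)

theorem divDiff_X_left (k : Fin (n - 1)) : divDiff k (X (leftPos k)) = 1 := by
  apply divDiff_eq_of_mul
  simp

theorem divDiff_X_right (k : Fin (n - 1)) : divDiff k (X (rightPos k)) = -1 := by
  apply divDiff_eq_of_mul
  simp

theorem divDiff_X_of_ne {k : Fin (n - 1)} {p : Fin n} (h1 : p ≠ leftPos k)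
    (h2 : p ≠ rightPos k) : divDiff k (X p) = 0 := by
  apply divDiff_eq_zero_of_rename_eq
  simp [adjSwap_of_ne h1 h2]

theorem divDiff_X_mul (k : Fin (n - 1)) (p : Fin n) :
    ∃ c : ℤ, ∀ f : MvPolynomial (Fin n) ℤ,
      divDiff k (X p * f) = X (adjSwap k p) * divDiff k f + c • f := by
  by_cases h1 : p = leftPos k
  · exact ⟨1, fun f => by rw [divDiff_mul, h1, divDiff_X_left, rename_X]; simp [add_comm]⟩
  by_cases h2 : p = rightPos k
  · exact ⟨-1, fun f => by rw [divDiff_mul, h2, divDiff_X_right, rename_X]; simp [add_comm]⟩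
  · exact ⟨0, fun f => by rw [divDiff_mul, divDiff_X_of_ne h1 h2, rename_X]; simp⟩

theorem divDiff_comm {k l : Fin (n - 1)} (h : (k : ℕ) + 1 < l) (f : MvPolynomial (Fin n) ℤ) :
    divDiff k (divDiff l f) = divDiff l (divDiff k f) := by
  have e1 : adjSwap l (leftPos k) = leftPos k :=
    adjSwap_of_ne (by simp [leftPos, Fin.ext_iff]; omega)
      (by simp [leftPos, rightPos, Fin.ext_iff]; omega)
  have e2 : adjSwap l (rightPos k) = rightPos k :=
    adjSwap_of_ne (by simp [leftPos, rightPos, Fin.ext_iff]; omega)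
      (by simp [rightPos, Fin.ext_iff]; omega)
  have e3 : adjSwap k (leftPos l) = leftPos l :=
    adjSwap_of_ne (by simp [leftPos, Fin.ext_iff]; omega)
      (by simp [leftPos, rightPos, Fin.ext_iff]; omega)
  have e4 : adjSwap k (rightPos l) = rightPos l :=
    adjSwap_of_ne (by simp [leftPos, rightPos, Fin.ext_iff]; omega)
      (by simp [rightPos, Fin.ext_iff]; omega)
  have hc : adjSwap k * adjSwap l = adjSwap l * adjSwap k := by
    have := Equiv.mul_swap_eq_swap_mul (adjSwap k) (leftPos l) (rightPos l)
    rw [e3, e4] at this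
    exact this
  have hc' : rename (R := ℤ) (adjSwap k) (rename (adjSwap l) f) =
      rename (adjSwap l) (rename (adjSwap k) f) := by
    rw [rename_rename, rename_rename, ← Perm.coe_mul, ← Perm.coe_mul, hc]
  apply divDiff_eq_of_mul
  apply mul_left_cancel₀ (left_sub_right_ne_zero l)
  have h1 := congrArg (rename (R := ℤ) (adjSwap k)) (mul_divDiff l f)
  have h2 := congrArg (rename (R := ℤ) (adjSwap l)) (mul_divDiff k f)
  simp only [map_mul, map_sub, rename_X, e1, e2, e3, e4] at h1 h2
  rw [hc'] at h1
  linear_combination (X (leftPos k) - X (rightPos k)) * mul_divDiff l (divDiff k f) - h2 + h1 +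
    mul_divDiff k f - mul_divDiff l f

theorem braid_formula {k l : Fin (n - 1)} (x y z : MvPolynomial (Fin n) ℤ)
    (s t : MvPolynomial (Fin n) ℤ →ₐ[ℤ] MvPolynomial (Fin n) ℤ)
    (hx : s x = y) (hy : s y = x) (hz : s z = z) (tx : t x = x) (ty : t y = z)
    (hs : ∀ f, (x - y) * divDiff k f = f - s f) (ht : ∀ f, (y - z) * divDiff l f = f - t f)
    (hxy : x - y ≠ 0) (f : MvPolynomial (Fin n) ℤ) :
    (x - y) * (x - z) * (y - z) * divDiff k (divDiff l (divDiff k f)) =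
      f - s f - t f + t (s f) + s (t f) - s (t (s f)) := by
  have h1 := congrArg t (hs f)
  simp only [map_mul, map_sub, tx, ty] at h1
  have hA : (x - y) * (x - z) * (y - z) * divDiff l (divDiff k f) =
      (x - z) * (f - s f) - (x - y) * (t f - t (s f)) := by
    linear_combination (x - y) * (x - z) * ht (divDiff k f) + (x - z) * hs f - (x - y) * h1
  have hA' := congrArg s hA
  simp only [map_mul, map_sub, hx, hy, hz] at hA'
  have hss : s (s f) = f := by
    have e := congrArg s (hs f)
    simp only [map_mul, map_sub, hx, hy] at e
    have h2 := hs (divDiff k f)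
    have h3 : divDiff k (divDiff k f) = 0 := divDiff_divDiff k f
    rw [h3, mul_zero] at h2
    linear_combination e + hs f + (x - y) * h2
  rw [hss] at hA'
  apply mul_left_cancel₀ hxy
  linear_combination (x - y) * (x - z) * (y - z) * hs (divDiff l (divDiff k f)) + hA + hA'

theorem adjSwap_braid {k l : Fin (n - 1)} (h : (l : ℕ) = k + 1) :
    adjSwap k * (adjSwap l * adjSwap k) = adjSwap l * (adjSwap k * adjSwap l) := by
  have e : leftPos l = rightPos k := by simp [leftPos, rightPos, h]
  have e2 : rightPos l ≠ leftPos k := by simp [leftPos, rightPos, Fin.ext_iff]; omega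
  have e3 : rightPos l ≠ rightPos k := by simp [rightPos, Fin.ext_iff]; omega
  have e1 := leftPos_ne_rightPos k
  unfold adjSwap
  rw [e]
  ext1 p
  simp only [Perm.mul_apply]
  simp only [swap_apply_def]
  split_ifs <;> simp_all

theorem divDiff_braid {k l : Fin (n - 1)} (h : (l : ℕ) = k + 1) (f : MvPolynomial (Fin n) ℤ) :
    divDiff k (divDiff l (divDiff k f)) = divDiff l (divDiff k (divDiff l f)) := by
  have e : leftPos l = rightPos k := by simp [leftPos, rightPos, h]
  have e2 : leftPos k ≠ rightPos l := by simp [leftPos, rightPos, Fin.ext_iff]; omega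
  have e3 : rightPos k ≠ rightPos l := by simp [rightPos, Fin.ext_iff]; omega
  have e1 := leftPos_ne_rightPos k
  have a1 : adjSwap k (rightPos l) = rightPos l := adjSwap_of_ne e2.symm e3.symm
  have a2 : adjSwap l (leftPos k) = leftPos k := adjSwap_of_ne (by rw [e]; exact e1) e2
  have a3 : adjSwap l (rightPos k) = rightPos l := by rw [← e]; simp
  have a4 : adjSwap l (rightPos l) = rightPos k := by rw [← e]; simp
  have hb : rename (R := ℤ) (adjSwap k) (rename (adjSwap l) (rename (adjSwap k) f)) =
      rename (adjSwap l) (rename (adjSwap k) (rename (adjSwap l) f)) := by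
    simp only [rename_rename, ← Perm.coe_mul]
    rw [adjSwap_braid h]
  have h1 := braid_formula (k := k) (l := l) (X (leftPos k)) (X (rightPos k)) (X (rightPos l))
    (rename (adjSwap k)) (rename (adjSwap l)) (by simp) (by simp) (by simp [a1]) (by simp [a2])
    (by simp [a3]) (mul_divDiff k) (fun f => by rw [← e, mul_divDiff])
    (X_sub_X_ne_zero e1) f
  -- The other side is the same formula, read from right to left: `(z, y, x)` for `(x, y, z)`.
  have h2 := braid_formula (k := l) (l := k) (-X (rightPos l)) (-X (rightPos k)) (-X (leftPos k))
    (rename (adjSwap l)) (rename (adjSwap k)) (by simp [a4]) (by simp [a3]) (by simp [a2])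
    (by simp [a1]) (by simp)
    (fun f => by rw [← mul_divDiff l f, e]; ring) (fun f => by rw [← mul_divDiff k f]; ring)
    (by rw [neg_sub_neg]; exact X_sub_X_ne_zero e3) f
  have hne : ((X (leftPos k) - X (rightPos k)) * (X (leftPos k) - X (rightPos l)) *
      (X (rightPos k) - X (rightPos l)) : MvPolynomial (Fin n) ℤ) ≠ 0 :=
    mul_ne_zero (mul_ne_zero (X_sub_X_ne_zero e1) (X_sub_X_ne_zero e2)) (X_sub_X_ne_zero e3)
  apply mul_left_cancel₀ hne
  rw [h1]
  rw [hb]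
  linear_combination -h2

/-! ### Inversions and reduced words -/

/-- The set of inversions of a permutation. -/
def inversions (u : Perm (Fin n)) : Finset (Fin n × Fin n) :=
  Finset.univ.filter fun x => x.1 < x.2 ∧ u x.2 < u x.1

/-- The number of inversions of a permutation. -/
def invCount (u : Perm (Fin n)) : ℕ := (inversions u).card

theorem mem_inversions {u : Perm (Fin n)} {x : Fin n × Fin n} :
    x ∈ inversions u ↔ x.1 < x.2 ∧ u x.2 < u x.1 := by simp [inversions]

/-- Exchanging two values which appear in increasing order, at any distance, increases the number of
inversions. -/
theorem invCount_lt_mul_swap {u : Perm (Fin n)} {p q : Fin n} (hpq : p < q) (h : u p < u q) :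
    invCount u < invCount (u * swap p q) := by
  classical
  set τ := swap p q with hτ
  have hττ : ∀ x, τ (τ x) = x := fun x => by simp [hτ]
  have hp : τ p = q := by simp [hτ]
  have hq : τ q = p := by simp [hτ]
  have hne : ∀ x, x ≠ p → x ≠ q → τ x = x := fun x h1 h2 => swap_apply_of_ne_of_ne h1 h2
  -- An inversion is transported by `τ` if `τ` preserves the order of its positions; otherwise it
  -- stays an inversion. The pair `(p, q)` is a new one.
  let F : Fin n × Fin n → Fin n × Fin n := fun x => if τ x.1 < τ x.2 then (τ x.1, τ x.2) else x
  have hmaps : ∀ x ∈ inversions u, F x ∈ (inversions (u * τ)).erase (p, q) := by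
    rintro ⟨x, y⟩ hx
    obtain ⟨hxy, hu⟩ := mem_inversions.1 hx
    simp only at hxy hu
    by_cases hc : τ x < τ y
    · simp only [F, if_pos hc, Finset.mem_erase, mem_inversions, Perm.mul_apply, hττ]
      refine ⟨?_, hc, hu⟩
      intro e
      have e1 : τ x = p := congrArg Prod.fst e
      have e2 : τ y = q := congrArg Prod.snd e
      have e1' : x = q := by rw [← hττ x, e1, hp]
      have e2' : y = p := by rw [← hττ y, e2, hq]
      rw [e1', e2'] at hxy
      exact absurd hxy hpq.not_gt
    · simp only [F, if_neg hc, Finset.mem_erase, mem_inversions, Perm.mul_apply]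
      have hxyne : (x, y) ≠ (p, q) := by
        intro e
        have e1 : x = p := congrArg Prod.fst e
        have e2 : y = q := congrArg Prod.snd e
        rw [e1, e2] at hu
        exact absurd h hu.not_gt
      refine ⟨hxyne, hxy, ?_⟩
      by_cases hx1 : x = p
      · by_cases hy1 : y = q
        · exact absurd (by rw [hx1, hy1]) hxyne
        · rw [hne y (by rw [← hx1]; exact hxy.ne') hy1, hx1, hp]
          rw [hx1] at hu
          exact hu.trans h
      · by_cases hy1 : y = q
        · rw [hne x hx1 (by rw [← hy1]; exact hxy.ne), hy1, hq]
          rw [hy1] at hu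
          exact h.trans hu
        · exfalso
          by_cases hx2 : x = q
          · rw [hx2, hq] at hc
            rw [hx2] at hxy
            rw [hne y (hpq.trans hxy).ne' hy1] at hc
            exact hc (hpq.trans hxy)
          · by_cases hy2 : y = p
            · rw [hy2, hp, hne x hx1 hx2] at hc
              rw [hy2] at hxy
              exact hc (hxy.trans hpq)
            · rw [hne x hx1 hx2, hne y hy2 hy1] at hc
              exact hc hxy
  have hinj : Set.InjOn F (inversions u) := by
    rintro ⟨x, y⟩ hx ⟨x', y'⟩ hx' e
    have hxy := (mem_inversions.1 (Finset.mem_coe.1 hx)).1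
    have hxy' := (mem_inversions.1 (Finset.mem_coe.1 hx')).1
    simp only at hxy hxy'
    simp only [F] at e
    split_ifs at e with c1 c2 c2
    · have e1 := τ.injective (congrArg Prod.fst e)
      have e2 := τ.injective (congrArg Prod.snd e)
      rw [e1, e2]
    · rw [Prod.mk.injEq] at e
      simp only [← e.1, ← e.2, hττ] at c2
      exact absurd hxy c2
    · rw [Prod.mk.injEq] at e
      simp only [e.1, e.2, hττ] at c1
      exact absurd hxy' c1
    · exact e
  have hpqmem : (p, q) ∈ inversions (u * τ) := by
    rw [mem_inversions]
    simp only [Perm.mul_apply, hp, hq]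
    exact ⟨hpq, h⟩
  have h1 := Finset.card_le_card_of_injOn F hmaps hinj
  have h2 := Finset.card_erase_lt_of_mem hpqmem
  exact lt_of_le_of_lt h1 h2

theorem adjSwap_mul (k : Fin (n - 1)) (u : Perm (Fin n)) :
    adjSwap k * u = u * swap (u⁻¹ (leftPos k)) (u⁻¹ (rightPos k)) := by
  rw [Equiv.mul_swap_eq_swap_mul]
  simp [adjSwap]

theorem invCount_lt_adjSwap_mul {u : Perm (Fin n)} {k : Fin (n - 1)}
    (h : u⁻¹ (leftPos k) < u⁻¹ (rightPos k)) : invCount u < invCount (adjSwap k * u) := by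
  rw [adjSwap_mul]
  apply invCount_lt_mul_swap h
  simp [leftPos, rightPos, Fin.lt_def]

theorem invCount_adjSwap_mul_le (u : Perm (Fin n)) (k : Fin (n - 1)) :
    invCount (adjSwap k * u) ≤ invCount u + 1 := by
  classical
  have : inversions (adjSwap k * u) ⊆
      insert (u⁻¹ (leftPos k), u⁻¹ (rightPos k)) (inversions u) := by
    rintro ⟨x, y⟩ hx
    obtain ⟨hxy, hu⟩ := mem_inversions.1 hx
    simp only [Perm.mul_apply] at hxy hu
    rw [Finset.mem_insert, mem_inversions]
    by_cases h1 : u x = leftPos k ∧ u y = rightPos k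
    · left
      rw [← h1.1, ← h1.2]
      simp
    · right
      refine ⟨hxy, ?_⟩
      have hne : u x ≠ u y := fun e => hxy.ne (u.injective e)
      simp only [adjSwap, swap_apply_def] at hu
      simp only [leftPos, rightPos, Fin.ext_iff, Fin.lt_def] at hu h1 hne ⊢
      split_ifs at hu <;> (try simp only at hu) <;> omega
  exact (Finset.card_le_card this).trans (Finset.card_insert_le _ _)

theorem invCount_adjSwap_mul_of_lt {u : Perm (Fin n)} {k : Fin (n - 1)}
    (h : u⁻¹ (leftPos k) < u⁻¹ (rightPos k)) : invCount (adjSwap k * u) = invCount u + 1 :=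
  le_antisymm (invCount_adjSwap_mul_le u k) (invCount_lt_adjSwap_mul h)

theorem invCount_adjSwap_mul_of_gt {u : Perm (Fin n)} {k : Fin (n - 1)}
    (h : u⁻¹ (rightPos k) < u⁻¹ (leftPos k)) : invCount (adjSwap k * u) + 1 = invCount u := by
  have := invCount_adjSwap_mul_of_lt (u := adjSwap k * u) (k := k) (by simpa using h)
  rw [adjSwap_mul_self_mul] at this
  exact this.symm

theorem inv_left_ne_inv_right (u : Perm (Fin n)) (k : Fin (n - 1)) :
    u⁻¹ (leftPos k) ≠ u⁻¹ (rightPos k) := fun e => leftPos_ne_rightPos k (u⁻¹.injective e)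

@[simp] theorem wordProd_nil : wordProd ([] : List (Fin (n - 1))) = 1 := rfl

@[simp] theorem wordProd_cons (k : Fin (n - 1)) (l : List (Fin (n - 1))) :
    wordProd (k :: l) = adjSwap k * wordProd l := by simp [wordProd]

theorem wordProd_append (l l' : List (Fin (n - 1))) :
    wordProd (l ++ l') = wordProd l * wordProd l' := by simp [wordProd]

@[simp] theorem invCount_one : invCount (1 : Perm (Fin n)) = 0 := by
  rw [invCount, Finset.card_eq_zero, Finset.eq_empty_iff_forall_notMem]
  rintro ⟨x, y⟩ h
  obtain ⟨h1, h2⟩ := mem_inversions.1 h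
  exact absurd h1 h2.not_gt

theorem invCount_wordProd_le (l : List (Fin (n - 1))) : invCount (wordProd l) ≤ l.length := by
  induction l with
  | nil => simp
  | cons k l ih =>
    rw [wordProd_cons, List.length_cons]
    exact (invCount_adjSwap_mul_le _ _).trans (Nat.add_le_add_right ih 1)

theorem eq_one_of_left_lt_right {u : Perm (Fin n)}
    (h : ∀ k : Fin (n - 1), u (leftPos k) < u (rightPos k)) : u = 1 := by
  have hmono : StrictMono u := by
    cases n with
    | zero => exact fun x => x.elim0
    | succ n => exact Fin.strictMono_iff_lt_succ.2 fun k => h k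
  have : (StrictMono.orderIsoOfSurjective u hmono u.surjective) = OrderIso.refl _ :=
    Subsingleton.elim _ _
  ext1 p
  exact congrArg (fun e => e p) this

/-- Every permutation has a word whose length is its number of inversions; the word is found by
removing one inversion at a time. By `invCount_wordProd_le` no word is shorter. -/
theorem exists_word_length_eq (u : Perm (Fin n)) :
    ∃ l : List (Fin (n - 1)), wordProd l = u ∧ l.length = invCount u := by
  induction hN : invCount u generalizing u with
  | zero =>
    refine ⟨[], ?_, rfl⟩
    have : u⁻¹ = 1 := by
      apply eq_one_of_left_lt_right
      intro k
      by_contra hk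
      have := invCount_adjSwap_mul_of_gt
        (lt_of_le_of_ne (not_lt.1 hk) (inv_left_ne_inv_right u k).symm)
      omega
    rw [wordProd_nil, eq_comm, ← inv_eq_one, this]
  | succ N ih =>
    have : ∃ k : Fin (n - 1), u⁻¹ (rightPos k) < u⁻¹ (leftPos k) := by
      by_contra hk
      push Not at hk
      have : u⁻¹ = 1 :=
        eq_one_of_left_lt_right fun k => lt_of_le_of_ne (hk k) (inv_left_ne_inv_right u k)
      rw [inv_eq_one.1 this] at hN
      simp at hN
    obtain ⟨k, hk⟩ := this
    have h1 := invCount_adjSwap_mul_of_gt hk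
    obtain ⟨l, hl, hl'⟩ := ih (adjSwap k * u) (by omega)
    exact ⟨k :: l, by simp [hl], by simp [hl']⟩

theorem IsReducedWord.length_eq {u : Perm (Fin n)} {l : List (Fin (n - 1))}
    (h : IsReducedWord u l) : l.length = invCount u := by
  obtain ⟨l', hl', he⟩ := exists_word_length_eq u
  have h1 := h.2 l' hl'
  have h2 := invCount_wordProd_le l
  rw [h.1] at h2
  omega

/-! ### Divided differences along words -/

/-- The composite of the divided differences listed in a word. -/
def divDiffWord (l : List (Fin (n - 1))) (f : MvPolynomial (Fin n) ℤ) : MvPolynomial (Fin n) ℤ :=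
  l.foldr divDiff f

@[simp] theorem divDiffWord_nil (f : MvPolynomial (Fin n) ℤ) : divDiffWord [] f = f := rfl

@[simp] theorem divDiffWord_cons (k : Fin (n - 1)) (l : List (Fin (n - 1)))
    (f : MvPolynomial (Fin n) ℤ) : divDiffWord (k :: l) f = divDiff k (divDiffWord l f) := rfl

theorem divDiffWord_append (l l' : List (Fin (n - 1))) (f : MvPolynomial (Fin n) ℤ) :
    divDiffWord (l ++ l') f = divDiffWord l (divDiffWord l' f) := by simp [divDiffWord]

theorem divDiffWord_add (l : List (Fin (n - 1))) (f g : MvPolynomial (Fin n) ℤ) :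
    divDiffWord l (f + g) = divDiffWord l f + divDiffWord l g := by
  induction l with
  | nil => rfl
  | cons k l ih => rw [divDiffWord_cons, ih, divDiff_add]; rfl

/-- Divided differences along a word, as an additive map. -/
def divDiffWordHom (l : List (Fin (n - 1))) :
    MvPolynomial (Fin n) ℤ →+ MvPolynomial (Fin n) ℤ :=
  AddMonoidHom.mk' (divDiffWord l) (divDiffWord_add l)

/-- The word property of divided differences, by the argument of Matsumoto's theorem: any two
reduced words of a permutation are connected by braid relations. -/
theorem divDiffWord_eq_of_reduced (N : ℕ) (l l' : List (Fin (n - 1)))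
    (h : wordProd l = wordProd l') (hl : l.length = N) (hl' : l'.length = N)
    (hN : invCount (wordProd l) = N) : divDiffWord l = divDiffWord l' := by
  induction N using Nat.strong_induction_on generalizing l l' with
  | _ N ih =>
  cases l with
  | nil =>
    have : l' = [] := List.length_eq_zero_iff.1 (by rw [hl', ← hl]; rfl)
    rw [this]
  | cons a l1 =>
  cases l' with
  | nil =>
    simp only [List.length_nil, List.length_cons] at hl hl'
    omega
  | cons b l2 =>
    simp only [List.length_cons, wordProd_cons] at hl hl' h hN
    set u := adjSwap a * wordProd l1 with hu
    have e1 : wordProd l1 = adjSwap a * u := by simp [hu]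
    have e2 : wordProd l2 = adjSwap b * u := by simp [h]
    have c1 := invCount_wordProd_le l1
    have c2 := invCount_wordProd_le l2
    rw [e1] at c1
    rw [e2] at c2
    have descent : ∀ (w : Perm (Fin n)) (k : Fin (n - 1)), invCount (adjSwap k * w) < invCount w →
        w⁻¹ (rightPos k) < w⁻¹ (leftPos k) := by
      intro w k hk
      by_contra hc
      have := invCount_adjSwap_mul_of_lt
        (lt_of_le_of_ne (not_lt.1 hc) (inv_left_ne_inv_right w k))
      omega
    have da := descent u a (by omega)
    have db := descent u b (by omega)
    have ia := invCount_adjSwap_mul_of_gt da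
    have ib := invCount_adjSwap_mul_of_gt db
    have main : ∀ (a b : Fin (n - 1)) (l1 l2 : List (Fin (n - 1))), (a : ℕ) < b →
        wordProd l1 = adjSwap a * u → wordProd l2 = adjSwap b * u → l1.length + 1 = N →
        l2.length + 1 = N → u⁻¹ (rightPos a) < u⁻¹ (leftPos a) →
        u⁻¹ (rightPos b) < u⁻¹ (leftPos b) →
        divDiffWord (a :: l1) = divDiffWord (b :: l2) := by
      clear * - ih hN
      intro a b l1 l2 hab e1 e2 hl hl' da db
      have ia := invCount_adjSwap_mul_of_gt da
      have ib := invCount_adjSwap_mul_of_gt db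
      -- Both `a` and `b` are left descents of `u`, so `u` has a reduced word that starts with the
      -- two sides of the relation between them, a commutation or a braid.
      by_cases hab1 : (a : ℕ) + 1 < b
      · have a1 : adjSwap a (leftPos b) = leftPos b :=
          adjSwap_of_ne (by simp [leftPos, Fin.ext_iff]; omega)
            (by simp [leftPos, rightPos, Fin.ext_iff]; omega)
        have a2 : adjSwap a (rightPos b) = rightPos b :=
          adjSwap_of_ne (by simp [leftPos, rightPos, Fin.ext_iff]; omega)
            (by simp [rightPos, Fin.ext_iff]; omega)
        have hc : adjSwap a * adjSwap b = adjSwap b * adjSwap a := by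
          have := Equiv.mul_swap_eq_swap_mul (adjSwap a) (leftPos b) (rightPos b)
          rw [a1, a2] at this
          exact this
        have i2 := invCount_adjSwap_mul_of_gt (u := adjSwap a * u) (k := b) (by simpa [a1, a2])
        obtain ⟨m, hm, hm'⟩ := exists_word_length_eq (adjSwap b * (adjSwap a * u))
        have s1 := ih (N - 1) (by omega) l1 (b :: m) (by simp [e1, hm]) (by omega)
          (by simp; omega) (by rw [e1]; omega)
        have s2 := ih (N - 1) (by omega) l2 (a :: m)
          (by rw [e2, wordProd_cons, hm, ← mul_assoc _ _ u, ← hc, mul_assoc, adjSwap_mul_self_mul])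
          (by omega)
          (by simp; omega) (by rw [e2]; omega)
        funext f
        rw [divDiffWord_cons, divDiffWord_cons, s1, s2, divDiffWord_cons, divDiffWord_cons,
          divDiff_comm hab1]
      · have hb : (b : ℕ) = a + 1 := by omega
        have e : leftPos b = rightPos a := by simp [leftPos, rightPos, hb]
        have n2 : leftPos a ≠ rightPos b := by simp [leftPos, rightPos, Fin.ext_iff]; omega
        have n3 : rightPos a ≠ rightPos b := by simp [rightPos, Fin.ext_iff]; omega
        have n1 := leftPos_ne_rightPos a
        have a1 : adjSwap a (rightPos b) = rightPos b := adjSwap_of_ne n2.symm n3.symm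
        have a2 : adjSwap b (leftPos a) = leftPos a := adjSwap_of_ne (by rw [e]; exact n1) n2
        have a3 : adjSwap b (rightPos a) = rightPos b := by rw [← e]; simp
        have i2 := invCount_adjSwap_mul_of_gt (u := adjSwap a * u) (k := b)
          (by rw [e] at db ⊢; simpa [a1] using db.trans da)
        have i3 := invCount_adjSwap_mul_of_gt (u := adjSwap b * (adjSwap a * u)) (k := a)
          (by rw [e] at db; simpa [a2, a3, a1] using db)
        obtain ⟨m, hm, hm'⟩ := exists_word_length_eq (adjSwap a * (adjSwap b * (adjSwap a * u)))
        have hbr : adjSwap a * (adjSwap b * (adjSwap a * u)) =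
            adjSwap b * (adjSwap a * (adjSwap b * u)) := by
          have := congrArg (· * u) (adjSwap_braid hb)
          simpa only [mul_assoc] using this
        have s1 := ih (N - 1) (by omega) l1 (b :: a :: m) (by simp [e1, hm]) (by omega)
          (by simp; omega) (by rw [e1]; omega)
        have s2 := ih (N - 1) (by omega) l2 (a :: b :: m)
          (by simp [e2, hm, hbr]) (by omega) (by simp; omega) (by rw [e2]; omega)
        funext f
        rw [divDiffWord_cons, divDiffWord_cons, s1, s2, divDiffWord_cons, divDiffWord_cons,
          divDiffWord_cons, divDiffWord_cons, divDiff_braid hb]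
    rcases lt_trichotomy (a : ℕ) b with hab | hab | hab
    · exact main a b l1 l2 hab e1 e2 hl hl' da db
    · have hab : a = b := Fin.ext hab
      subst hab
      have := ih (N - 1) (by omega) l1 l2 (by rw [e1, e2]) (by omega) (by omega)
        (by rw [e1]; omega)
      funext f
      rw [divDiffWord_cons, divDiffWord_cons, this]
    · exact (main b a l2 l1 hab e2 e1 hl' hl db da).symm

/-- A word which is not reduced gives zero: its longest reduced suffix can be rewritten so that it
starts with the letter `a` preceding it, and `∂_a ∂_a = 0`. -/
theorem divDiffWord_eq_zero {l : List (Fin (n - 1))} (h : invCount (wordProd l) < l.length)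
    (f : MvPolynomial (Fin n) ℤ) : divDiffWord l f = 0 := by
  induction l with
  | nil => simp at h
  | cons a l ih =>
    rw [divDiffWord_cons]
    by_cases hl : invCount (wordProd l) < l.length
    · rw [ih hl, divDiff_zero]
    · have hl' : invCount (wordProd l) = l.length :=
        le_antisymm (invCount_wordProd_le l) (not_lt.1 hl)
      rw [wordProd_cons, List.length_cons] at h
      have hd : (wordProd l)⁻¹ (rightPos a) < (wordProd l)⁻¹ (leftPos a) := by
        by_contra hc
        have := invCount_adjSwap_mul_of_lt
          (lt_of_le_of_ne (not_lt.1 hc) (inv_left_ne_inv_right (wordProd l) a))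
        omega
      have := invCount_adjSwap_mul_of_gt hd
      obtain ⟨m, hm, hm'⟩ := exists_word_length_eq (adjSwap a * wordProd l)
      rw [divDiffWord_eq_of_reduced l.length l (a :: m) (by simp [hm]) rfl (by simp; omega) hl',
        divDiffWord_cons, divDiff_divDiff]

theorem divDiffPerm_eq {u : Perm (Fin n)} {l : List (Fin (n - 1))} (h : wordProd l = u)
    (hl : l.length = invCount u) : divDiffPerm u = divDiffWord l := by
  have hc := (exists_isReducedWord u).choose_spec
  have := divDiffWord_eq_of_reduced (invCount u) (exists_isReducedWord u).choose l
    (hc.1.trans h.symm) hc.length_eq hl (by rw [hc.1])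
  exact this

/-- A word either computes the divided difference of its product, or is not reduced and gives
zero. -/
theorem divDiffWord_eq_or (l : List (Fin (n - 1))) :
    (l.length = invCount (wordProd l) ∧ divDiffWord l = divDiffPerm (wordProd l)) ∨
      (invCount (wordProd l) < l.length ∧ ∀ f, divDiffWord l f = 0) := by
  rcases (invCount_wordProd_le l).eq_or_lt with h | h
  · exact Or.inl ⟨h.symm, (divDiffPerm_eq rfl h.symm).symm⟩
  · exact Or.inr ⟨h, divDiffWord_eq_zero h⟩

theorem divDiffWord_eq_divDiffPerm_of_ne_zero {l : List (Fin (n - 1))}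
    {f : MvPolynomial (Fin n) ℤ} (h : divDiffWord l f ≠ 0) :
    l.length = invCount (wordProd l) ∧ divDiffWord l = divDiffPerm (wordProd l) :=
  (divDiffWord_eq_or l).resolve_right fun hc => h (hc.2 f)

end DividedDifferences

section SchubertClasses

variable {n : ℕ}

/-! ### Multiplication by a variable -/

/-- Iterating the Leibniz rule: commuting a variable past the divided differences along a word
produces the words with one letter deleted. -/
theorem divDiffWord_X_mul (l : List (Fin (n - 1))) (p : Fin n) :
    ∃ c : ℕ → ℤ, ∀ f : MvPolynomial (Fin n) ℤ, divDiffWord l (X p * f) =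
      X (wordProd l p) * divDiffWord l f +
        ∑ x ∈ Finset.range l.length, c x • divDiffWord (l.eraseIdx x) f := by
  induction l with
  | nil => exact ⟨0, fun f => by simp⟩
  | cons k l ih =>
    obtain ⟨c, hc⟩ := ih
    obtain ⟨c0, hc0⟩ := divDiff_X_mul k (wordProd l p)
    refine ⟨fun x => Nat.casesOn x c0 c, fun f => ?_⟩
    rw [divDiffWord_cons, hc, divDiff_add, hc0, divDiff_sum, List.length_cons,
      Finset.sum_range_succ', add_assoc]
    congr 1
    rw [add_comm]
    congr 1
    refine Finset.sum_congr rfl fun x _ => ?_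
    rw [divDiff_zsmul]
    rfl

/-- Deleting a letter from a word multiplies its product by a transposition on the right. -/
theorem exists_wordProd_eraseIdx (l : List (Fin (n - 1))) (x : ℕ) (hx : x < l.length) :
    ∃ p q : Fin n, p < q ∧ wordProd (l.eraseIdx x) = wordProd l * swap p q := by
  induction l generalizing x with
  | nil => simp at hx
  | cons k l ih =>
    cases x with
    | zero =>
      have h := adjSwap_mul k (wordProd l)
      rcases lt_or_gt_of_ne (inv_left_ne_inv_right (wordProd l) k) with hlt | hlt
      · exact ⟨_, _, hlt, by simp [h, mul_assoc]⟩
      · exact ⟨_, _, hlt, by rw [swap_comm]; simp [h, mul_assoc]⟩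
    | succ x =>
      obtain ⟨p, q, hpq, h⟩ := ih x (by simpa using hx)
      exact ⟨p, q, hpq, by simp [h, mul_assoc]⟩

/-! ### The functionals dual to the Schubert polynomials -/

/-- The constant term of `∂_u f`: the coefficient of `σ_u` in the class of `f`. -/
def schubertCoeff (u : Perm (Fin n)) (f : MvPolynomial (Fin n) ℤ) : ℤ :=
  constantCoeff (divDiffPerm u f)

theorem exists_divDiffPerm_eq (u : Perm (Fin n)) : ∃ l : List (Fin (n - 1)), wordProd l = u ∧
    l.length = invCount u ∧ divDiffPerm u = divDiffWord l := by
  obtain ⟨l, h1, h2⟩ := exists_word_length_eq u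
  exact ⟨l, h1, h2, divDiffPerm_eq h1 h2⟩

/-- `schubertCoeff` as an additive map. -/
def schubertCoeffHom (u : Perm (Fin n)) : MvPolynomial (Fin n) ℤ →+ ℤ :=
  (constantCoeff : MvPolynomial (Fin n) ℤ →+* ℤ).toAddMonoidHom.comp
    (divDiffWordHom (exists_isReducedWord u).choose)

theorem schubertCoeffHom_apply (u : Perm (Fin n)) (f : MvPolynomial (Fin n) ℤ) :
    schubertCoeffHom u f = schubertCoeff u f := rfl

theorem constantCoeff_divDiffWord (l : List (Fin (n - 1))) (f : MvPolynomial (Fin n) ℤ)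
    (h : schubertCoeff (wordProd l) f = 0) : constantCoeff (divDiffWord l f) = 0 := by
  rcases divDiffWord_eq_or l with ⟨_, h2⟩ | ⟨_, h2⟩
  · rw [h2]
    exact h
  · rw [h2, map_zero]

/-- The polynomials in whose classes the Schubert classes `σ_u`, `u ∈ S`, do not occur. -/
def avoiding (S : Set (Perm (Fin n))) : AddSubgroup (MvPolynomial (Fin n) ℤ) where
  carrier := {f | ∀ u ∈ S, schubertCoeff u f = 0}
  zero_mem' u _ := map_zero (schubertCoeffHom u)
  add_mem' {f g} hf hg u hu := by
    rw [← schubertCoeffHom_apply, map_add]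
    simp [schubertCoeffHom_apply, hf u hu, hg u hu]
  neg_mem' {f} hf u hu := by
    rw [← schubertCoeffHom_apply, map_neg]
    simp [schubertCoeffHom_apply, hf u hu]

/-- If `S` is closed under going down in Bruhat order, `avoiding S` is closed under multiplication
by the variables. -/
theorem X_mul_mem_avoiding {S : Set (Perm (Fin n))}
    (hS : ∀ u ∈ S, ∀ p q, p < q → u q < u p → u * swap p q ∈ S) (x : Fin n)
    {f : MvPolynomial (Fin n) ℤ} (hf : f ∈ avoiding S) : X x * f ∈ avoiding S := by
  intro u hu
  obtain ⟨l, hl, hlen, he⟩ := exists_divDiffPerm_eq u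
  obtain ⟨c, hc⟩ := divDiffWord_X_mul l x
  rw [schubertCoeff, he, hc, map_add, map_mul, constantCoeff_X, zero_mul, zero_add, map_sum]
  refine Finset.sum_eq_zero fun y hy => ?_
  have hy := Finset.mem_range.1 hy
  obtain ⟨p, q, hpq, hw⟩ := exists_wordProd_eraseIdx l y hy
  rw [map_zsmul, smul_eq_zero]
  right
  rcases divDiffWord_eq_or (l.eraseIdx y) with ⟨h1, h2⟩ | ⟨_, h2⟩
  · rw [h2, hw, hl]
    refine hf _ (hS u hu p q hpq ?_)
    rw [List.length_eraseIdx_of_lt hy, hw, hl] at h1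
    by_contra hc
    have := invCount_lt_mul_swap hpq
      (lt_of_le_of_ne (not_lt.1 hc) fun e => hpq.ne (u.injective e))
    omega
  · rw [h2, map_zero]

/-- `∂_u ∂_k` is `∂_{u s_k}` or zero, so `avoiding S` is stable under `∂_k` if `S` is stable under
right multiplication by the adjacent transposition. -/
theorem divDiff_mem_avoiding {S : Set (Perm (Fin n))} {k : Fin (n - 1)}
    (hS : ∀ u ∈ S, u * adjSwap k ∈ S) {f : MvPolynomial (Fin n) ℤ} (hf : f ∈ avoiding S) :
    divDiff k f ∈ avoiding S := by
  intro u hu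
  obtain ⟨l, hl, hlen, he⟩ := exists_divDiffPerm_eq u
  have := constantCoeff_divDiffWord (l ++ [k]) f
    (hf _ (by rw [wordProd_append, hl, wordProd_cons, wordProd_nil, mul_one]; exact hS u hu))
  rw [divDiffWord_append] at this
  rw [schubertCoeff, he]
  exact this

theorem mul_mem_avoiding {S : Set (Perm (Fin n))}
    (hS : ∀ u ∈ S, ∀ p q, p < q → u q < u p → u * swap p q ∈ S)
    (g : MvPolynomial (Fin n) ℤ) {f : MvPolynomial (Fin n) ℤ} (hf : f ∈ avoiding S) :
    g * f ∈ avoiding S := by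
  induction g using MvPolynomial.induction_on with
  | C c =>
    rw [← smul_eq_C_mul]
    exact AddSubgroup.zsmul_mem _ hf c
  | add p q hp hq =>
    rw [add_mul]
    exact add_mem hp hq
  | mul_X p x hp =>
    rw [mul_comm p, mul_assoc]
    exact X_mul_mem_avoiding hS x hp

/-- If `u` has a descent at `k`, it has a reduced word ending in `k`, so `∂_u` factors through
`∂_k`. -/
theorem schubertCoeff_eq_zero_of_divDiff {u : Perm (Fin n)} {k : Fin (n - 1)}
    {f : MvPolynomial (Fin n) ℤ} (hk : divDiff k f = 0) (hu : u (rightPos k) < u (leftPos k)) :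
    schubertCoeff u f = 0 := by
  have hlt : invCount (u * adjSwap k) < invCount u := by
    have := invCount_lt_mul_swap (u := u * adjSwap k) (p := leftPos k) (q := rightPos k)
      (by simp [leftPos, rightPos, Fin.lt_def]) (by simpa using hu)
    change _ < invCount (u * adjSwap k * adjSwap k) at this
    rwa [mul_assoc, adjSwap_mul_self, mul_one] at this
  obtain ⟨l, hl, hlen⟩ := exists_word_length_eq (u * adjSwap k)
  have hp : wordProd (l ++ [k]) = u := by
    rw [wordProd_append, hl, wordProd_cons, wordProd_nil, mul_one, mul_assoc, adjSwap_mul_self,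
      mul_one]
  have hle := invCount_wordProd_le (l ++ [k])
  rw [hp] at hle
  have hlen' : (l ++ [k]).length = invCount u := by
    simp only [List.length_append, List.length_singleton] at hle ⊢
    omega
  have hzero : divDiffWord l 0 = 0 := map_zero (divDiffWordHom l)
  rw [schubertCoeff, divDiffPerm_eq hp hlen', divDiffWord_append, divDiffWord_cons,
    divDiffWord_nil, hk, hzero, map_zero]

/-! ### Generation by invariants -/

/-- The divided difference `∂_k` for a natural number index, zero if out of range. -/
def natDivDiff (k : ℕ) (f : MvPolynomial (Fin n) ℤ) : MvPolynomial (Fin n) ℤ :=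
  if h : k < n - 1 then divDiff ⟨k, h⟩ f else 0

theorem natDivDiff_of_lt {k : ℕ} (h : k < n - 1) (f : MvPolynomial (Fin n) ℤ) :
    natDivDiff k f = divDiff ⟨k, h⟩ f := dif_pos h

@[simp] theorem natDivDiff_zero (k : ℕ) : natDivDiff k (0 : MvPolynomial (Fin n) ℤ) = 0 := by
  unfold natDivDiff
  split_ifs <;> simp

theorem natDivDiff_add (k : ℕ) (f g : MvPolynomial (Fin n) ℤ) :
    natDivDiff k (f + g) = natDivDiff k f + natDivDiff k g := by
  unfold natDivDiff
  split_ifs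
  · exact divDiff_add _ _ _
  · simp

@[simp] theorem natDivDiff_natDivDiff (k : ℕ) (f : MvPolynomial (Fin n) ℤ) :
    natDivDiff k (natDivDiff k f) = 0 := by
  unfold natDivDiff
  split_ifs <;> simp

theorem natDivDiff_comm {k l : ℕ} (h : k + 1 < l) (f : MvPolynomial (Fin n) ℤ) :
    natDivDiff k (natDivDiff l f) = natDivDiff l (natDivDiff k f) := by
  by_cases hl : l < n - 1
  · rw [natDivDiff_of_lt hl, natDivDiff_of_lt (by omega : k < n - 1), natDivDiff_of_lt hl,
      natDivDiff_of_lt (by omega : k < n - 1), divDiff_comm h]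
  · simp [natDivDiff, hl]

theorem natDivDiff_braid {k : ℕ} (h : k + 1 < n - 1) (f : MvPolynomial (Fin n) ℤ) :
    natDivDiff (k + 1) (natDivDiff k (natDivDiff (k + 1) f)) =
      natDivDiff k (natDivDiff (k + 1) (natDivDiff k f)) := by
  simp only [natDivDiff_of_lt h, natDivDiff_of_lt (by omega : k < n - 1)]
  exact (divDiff_braid rfl f).symm

/-- The variable `x_k` for a natural number index, zero if out of range. -/
def natX (n k : ℕ) : MvPolynomial (Fin n) ℤ := if h : k < n then X ⟨k, h⟩ else 0

theorem natX_of_lt {k : ℕ} (h : k < n) : natX n k = X ⟨k, h⟩ := dif_pos h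

theorem natDivDiff_X_succ_mul {k : ℕ} (h : k < n - 1) (f : MvPolynomial (Fin n) ℤ) :
    natDivDiff k (natX n (k + 1) * f) = natX n k * natDivDiff k f - f := by
  rw [natDivDiff_of_lt h, natDivDiff_of_lt h, natX_of_lt (by omega), natX_of_lt (by omega)]
  have := divDiff_mul ⟨k, h⟩ (X (rightPos ⟨k, h⟩)) f
  rw [divDiff_X_right, rename_X, adjSwap_rightPos] at this
  change divDiff ⟨k, h⟩ (X (rightPos ⟨k, h⟩) * f) = X (leftPos ⟨k, h⟩) * divDiff ⟨k, h⟩ f - f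
  rw [this]
  ring

theorem natDivDiff_natX_mul {k p : ℕ} (h : k < n - 1) (h1 : p ≠ k) (h2 : p ≠ k + 1)
    (f : MvPolynomial (Fin n) ℤ) :
    natDivDiff k (natX n p * f) = natX n p * natDivDiff k f := by
  rw [natDivDiff_of_lt h, natDivDiff_of_lt h]
  unfold natX
  split_ifs with hp
  · refine divDiff_mul_of_invariant ?_ f
    rw [rename_X, adjSwap_of_ne]
    · exact fun e => h1 (congrArg Fin.val e)
    · exact fun e => h2 (congrArg Fin.val e)
  · simp

/-- The composite `∂_k ∂_{k+1} ⋯ ∂_{k+d-1}`. -/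
def divDiffRun : ℕ → ℕ → MvPolynomial (Fin n) ℤ → MvPolynomial (Fin n) ℤ
  | _, 0, f => f
  | k, d + 1, f => natDivDiff k (divDiffRun (k + 1) d f)

theorem natDivDiff_divDiffRun_comm {k l : ℕ} (d : ℕ) (h : k + 1 < l)
    (f : MvPolynomial (Fin n) ℤ) :
    natDivDiff k (divDiffRun l d f) = divDiffRun l d (natDivDiff k f) := by
  induction d generalizing l with
  | zero => rfl
  | succ d ih =>
    rw [divDiffRun, divDiffRun, natDivDiff_comm h, ih (by omega)]

theorem divDiffRun_zero (k d : ℕ) : divDiffRun k d (0 : MvPolynomial (Fin n) ℤ) = 0 := by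
  induction d generalizing k with
  | zero => rfl
  | succ d ih => rw [divDiffRun, ih, natDivDiff_zero]

/-- The variable `x_{k+1}` moves through the run `∂_{k+1} ⋯ ∂_{k+d}` and becomes `x_{k+d+1}`; the
correction terms of the Leibniz rule are killed by `∂_k`, by the invariance of `f`. -/
theorem natDivDiff_divDiffRun_X {k d : ℕ} (h : k + d < n - 1) (f : MvPolynomial (Fin n) ℤ)
    (hf : ∀ l, k ≤ l → l < k + d → natDivDiff l f = 0) :
    natDivDiff k (natX n (k + 1) * divDiffRun (k + 1) d f) =
      divDiffRun k (d + 1) (natX n (k + d + 1) * f) := by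
  induction d generalizing k with
  | zero => rfl
  | succ d ih =>
    have ih' := ih (k := k + 1) (by omega) fun l h1 h2 => hf l (by omega) (by omega)
    rw [natDivDiff_X_succ_mul (by omega)] at ih'
    have e : natX n (k + 1) * divDiffRun (k + 1) (d + 1) f =
        divDiffRun (k + 1) (d + 1) (natX n (k + 1 + d + 1) * f) + divDiffRun (k + 1 + 1) d f := by
      rw [← ih']
      simp [divDiffRun]
    rw [e, natDivDiff_add, natDivDiff_divDiffRun_comm d (by omega), hf k le_rfl (by omega),
      divDiffRun_zero, add_zero, show k + 1 + d + 1 = k + (d + 1) + 1 by ring]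
    rfl

/-- If `f` is killed by all but the last divided difference of an interval, then the composite run
is killed by all of them. -/
theorem natDivDiff_divDiffRun_eq_zero {k d l : ℕ} (h : k + d < n) (f : MvPolynomial (Fin n) ℤ)
    (hf : ∀ l, k ≤ l → l + 1 < k + d → natDivDiff l f = 0) (hl : k ≤ l) (hl' : l < k + d) :
    natDivDiff l (divDiffRun k d f) = 0 := by
  induction d generalizing k with
  | zero => omega
  | succ d ih =>
    rcases Nat.lt_or_ge k l with hkl | hkl
    · rcases Nat.lt_or_ge (k + 1) l with hkl2 | hkl2
      · rw [divDiffRun, ← natDivDiff_comm hkl2,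
          ih (by omega) (fun m h1 h2 => hf m (by omega) (by omega)) (by omega) (by omega),
          natDivDiff_zero]
      · obtain rfl : l = k + 1 := by omega
        obtain ⟨d, rfl⟩ : ∃ e, d = e + 1 := ⟨d - 1, by omega⟩
        rw [divDiffRun, divDiffRun, natDivDiff_braid (by omega),
          natDivDiff_divDiffRun_comm d (by omega), hf k le_rfl (by omega), divDiffRun_zero]
        simp
    · obtain rfl : l = k := by omega
      simp [divDiffRun]

/-- If an additive group of polynomials is stable under the divided differences and the variables
with indices in an interval, then it is contained in the ideal generated by those of its elements
that are invariant under the permutations of these variables. -/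
theorem mem_span_invariants (J : AddSubgroup (MvPolynomial (Fin n) ℤ)) (a b : ℕ) (hb : b < n)
    (hX : ∀ x, a ≤ x → x ≤ b → ∀ f ∈ J, natX n x * f ∈ J)
    (hD : ∀ k, a ≤ k → k < b → ∀ f ∈ J, natDivDiff k f ∈ J)
    {f : MvPolynomial (Fin n) ℤ} (hf : f ∈ J) :
    f ∈ Ideal.span {g | g ∈ J ∧ ∀ k, a ≤ k → k < b → natDivDiff k g = 0} := by
  induction b with
  | zero =>
    exact Ideal.subset_span ⟨hf, fun k _ hk => absurd hk (Nat.not_lt_zero k)⟩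
  | succ m ih =>
    rcases Nat.lt_or_ge m a with ham | ham
    · exact Ideal.subset_span ⟨hf, fun k h1 h2 => by omega⟩
    have h1 := ih (by omega) (fun x h1 h2 => hX x h1 (by omega))
      fun k h1 h2 => hD k h1 (by omega)
    refine (Ideal.span_le.2 ?_ : Ideal.span _ ≤ _) h1
    -- It suffices to treat `g` invariant under all but the last transposition. We show that `g` is
    -- in the ideal generated by the `∂_k ⋯ ∂_m F`, for smaller and smaller `k`, where `F` runs
    -- through the elements of `J` with the same invariance as `g`.
    rintro g ⟨hgJ, hg⟩
    have key : ∀ d, d ≤ m + 1 - a → g ∈ Ideal.span {h | ∃ F ∈ J,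
        (∀ k, a ≤ k → k < m → natDivDiff k F = 0) ∧ h = divDiffRun (m + 1 - d) d F} := by
      intro d
      induction d with
      | zero => exact fun _ => Ideal.subset_span ⟨g, hgJ, hg, rfl⟩
      | succ d ihd =>
        intro hd
        refine (Ideal.span_le.2 ?_ : Ideal.span _ ≤ _) (ihd (by omega))
        rintro _ ⟨F, hF, hF', rfl⟩
        obtain ⟨k, hk⟩ : ∃ k, k = m + 1 - (d + 1) := ⟨_, rfl⟩
        have hk' : m + 1 - d = k + 1 := by omega
        have e : divDiffRun (k + 1) d F = natX n k * divDiffRun k (d + 1) F -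
            divDiffRun k (d + 1) (natX n (k + d + 1) * F) := by
          rw [← natDivDiff_divDiffRun_X (by omega) F fun l h1 h2 => hF' l (by omega) (by omega),
            natDivDiff_X_succ_mul (by omega)]
          simp [divDiffRun]
        rw [hk', ← hk, e]
        refine sub_mem (Ideal.mul_mem_left _ _ (Ideal.subset_span ⟨F, hF, hF', rfl⟩))
          (Ideal.subset_span ⟨_, hX _ (by omega) (by omega) F hF, fun l h1 h2 => ?_, rfl⟩)
        rw [natDivDiff_natX_mul (by omega) (by omega) (by omega), hF' l h1 h2, mul_zero]
    refine Ideal.span_mono ?_ (key (m + 1 - a) le_rfl)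
    rintro _ ⟨F, hF, hF', rfl⟩
    have ha : m + 1 - (m + 1 - a) = a := by omega
    rw [ha]
    constructor
    · have : ∀ d k, a ≤ k → k + d ≤ m + 1 → divDiffRun k d F ∈ J := by
        intro d
        induction d with
        | zero => exact fun _ _ _ => hF
        | succ d ihd =>
          intro k h1 h2
          exact hD k h1 (by omega) _ (ihd (k + 1) (by omega) (by omega))
      exact this _ _ le_rfl (by omega)
    · intro k h1 h2
      exact natDivDiff_divDiffRun_eq_zero (by omega) F
        (fun l h1 h2 => hF' l h1 (by omega)) h1 (by omega)

end SchubertClasses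

section SchubertBasis

variable {n : ℕ}

/-! ### The coinvariant ideal -/

theorem constantCoeff_eq_zero_of_mem_coinvIdeal {f : MvPolynomial (Fin n) ℤ}
    (h : f ∈ coinvIdeal n) : constantCoeff f = 0 := by
  have : coinvIdeal n ≤ RingHom.ker (constantCoeff (R := ℤ) (σ := Fin n)) :=
    Ideal.span_le.2 fun g hg => hg.2
  exact this h

theorem divDiff_mem_coinvIdeal (k : Fin (n - 1)) {f : MvPolynomial (Fin n) ℤ}
    (h : f ∈ coinvIdeal n) : divDiff k f ∈ coinvIdeal n := by
  induction h using Submodule.span_induction with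
  | mem g hg =>
    rw [divDiff_eq_zero_of_rename_eq (hg.1 _)]
    exact zero_mem _
  | zero => simp
  | add f g _ _ hf hg =>
    rw [divDiff_add]
    exact add_mem hf hg
  | smul a f hf ih =>
    rw [smul_eq_mul, divDiff_mul]
    exact add_mem (Ideal.mul_mem_left _ _ hf) (Ideal.mul_mem_left _ _ ih)

theorem schubertCoeff_eq_zero_of_mem_coinvIdeal (u : Perm (Fin n)) {f : MvPolynomial (Fin n) ℤ}
    (h : f ∈ coinvIdeal n) : schubertCoeff u f = 0 := by
  apply constantCoeff_eq_zero_of_mem_coinvIdeal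
  unfold divDiffPerm
  induction (exists_isReducedWord u).choose with
  | nil => exact h
  | cons k l ih => exact divDiff_mem_coinvIdeal k ih

theorem isSymmetric_of_divDiff {f : MvPolynomial (Fin n) ℤ}
    (h : ∀ k : Fin (n - 1), divDiff k f = 0) : f.IsSymmetric := by
  intro u
  obtain ⟨l, rfl⟩ := exists_word u
  induction l with
  | nil => simp
  | cons k l ih =>
    rw [wordProd_cons, Perm.coe_mul, ← rename_rename, ih,
      rename_eq_of_divDiff_eq_zero (h k)]

@[simp] theorem schubertCoeff_one (f : MvPolynomial (Fin n) ℤ) :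
    schubertCoeff 1 f = constantCoeff f := by
  rw [schubertCoeff, divDiffPerm_eq (l := []) wordProd_nil (by simp)]
  rfl

theorem natX_mul_mem_avoiding {S : Set (Perm (Fin n))}
    (hS : ∀ u ∈ S, ∀ p q, p < q → u q < u p → u * swap p q ∈ S) (x : ℕ)
    {f : MvPolynomial (Fin n) ℤ} (hf : f ∈ avoiding S) : natX n x * f ∈ avoiding S :=
  mul_mem_avoiding hS _ hf

/-- The coinvariant ideal is the common kernel of the functionals `schubertCoeff u`. This common
kernel is stable under the variables and all divided differences, hence generated by its symmetric
elements, and these have constant term `schubertCoeff 1 f = 0`. -/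
theorem mem_coinvIdeal_iff {f : MvPolynomial (Fin n) ℤ} :
    f ∈ coinvIdeal n ↔ ∀ u, schubertCoeff u f = 0 := by
  refine ⟨fun h u => schubertCoeff_eq_zero_of_mem_coinvIdeal u h, fun h => ?_⟩
  cases n with
  | zero =>
    have h0 := h 1
    rw [schubertCoeff_one] at h0
    rw [MvPolynomial.eq_C_of_isEmpty f, ← constantCoeff_eq, h0, map_zero]
    exact zero_mem _
  | succ n =>
    have hf : f ∈ avoiding (Set.univ : Set (Perm (Fin (n + 1)))) := fun u _ => h u
    have := mem_span_invariants _ 0 n (Nat.lt_succ_self n)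
      (fun x _ _ g hg => natX_mul_mem_avoiding (fun _ _ _ _ _ _ => Set.mem_univ _) x hg)
      (fun k _ hk g hg => by
        rw [natDivDiff_of_lt (by omega)]
        exact divDiff_mem_avoiding (fun _ _ => Set.mem_univ _) hg) hf
    refine (Ideal.span_le.2 ?_ : Ideal.span _ ≤ _) this
    rintro g ⟨hg, hg'⟩
    refine Ideal.subset_span ⟨isSymmetric_of_divDiff fun k => ?_, ?_⟩
    · have := hg' k (Nat.zero_le _) k.2
      rwa [natDivDiff_of_lt (by omega)] at this
    · rw [← schubertCoeff_one]
      exact hg 1 (Set.mem_univ _)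

/-! ### The staircase monomial and the longest permutation -/

theorem divDiff_isHomogeneous (k : Fin (n - 1)) {f : MvPolynomial (Fin n) ℤ} {d : ℕ}
    (h : f.IsHomogeneous (d + 1)) : (divDiff k f).IsHomogeneous d := by
  have mon : ∀ (d : ℕ) (m : Fin n →₀ ℕ), m.degree = d + 1 →
      (divDiff k (monomial m (1 : ℤ))).IsHomogeneous d := by
    intro d
    induction d with
    | zero =>
      intro m hm
      obtain ⟨p, rfl⟩ : ∃ p, m = Finsupp.single p 1 := by
        obtain ⟨p, hp⟩ := Finsupp.ne_iff.1 (show m ≠ 0 by rintro rfl; simp at hm)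
        refine ⟨p, ?_⟩
        have hle : Finsupp.single p 1 ≤ m := by
          rw [Finsupp.single_le_iff]
          exact Nat.one_le_iff_ne_zero.2 hp
        have h1 := congrArg Finsupp.degree (tsub_add_cancel_of_le hle)
        rw [map_add, Finsupp.degree_single, hm] at h1
        have h2 : m - Finsupp.single p 1 = 0 := by
          rw [← Finsupp.degree_eq_zero_iff]
          omega
        rw [← tsub_add_cancel_of_le hle, h2, zero_add]
      obtain ⟨c, hc⟩ := divDiff_X_mul k p
      have h1 := hc 1
      rw [divDiff_eq_zero_of_rename_eq (f := 1) (by simp), mul_one, mul_zero, zero_add] at h1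
      change (divDiff k (X p)).IsHomogeneous 0
      rw [h1, smul_eq_C_mul, mul_one]
      exact isHomogeneous_C _ _
    | succ d ih =>
      intro m hm
      obtain ⟨p, hp⟩ := Finsupp.ne_iff.1 (show m ≠ 0 by rintro rfl; simp at hm)
      have hle : Finsupp.single p 1 ≤ m := by
        rw [Finsupp.single_le_iff]
        exact Nat.one_le_iff_ne_zero.2 hp
      have h1 := congrArg Finsupp.degree (tsub_add_cancel_of_le hle)
      rw [map_add, Finsupp.degree_single, hm] at h1
      obtain ⟨c, hc⟩ := divDiff_X_mul k p
      have h2 : monomial m (1 : ℤ) = X p * monomial (m - Finsupp.single p 1) 1 := by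
        rw [X, monomial_mul, one_mul, add_comm, tsub_add_cancel_of_le hle]
      rw [h2, hc, add_comm d 1]
      refine ((isHomogeneous_X _ _).mul (ih _ (by omega))).add ?_
      rw [smul_eq_C_mul]
      have := (isHomogeneous_C (Fin n) c).mul (isHomogeneous_monomial (R := ℤ) (n := 1 + d) 1
        (d := m - Finsupp.single p 1) (by omega))
      rwa [zero_add] at this
  rw [f.as_sum, divDiff_sum]
  refine IsHomogeneous.sum _ _ _ fun m hm => ?_
  have hd : m.degree = d + 1 := by
    have := h (mem_support_iff.1 hm)
    rwa [Finsupp.degree_eq_weight_one]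
  have : monomial m (coeff m f) = coeff m f • monomial m (1 : ℤ) := by simp [smul_monomial]
  rw [this, divDiff_zsmul, smul_eq_C_mul]
  have := (isHomogeneous_C (Fin n) (coeff m f)).mul (mon d m hd)
  rwa [zero_add] at this

theorem divDiffWord_isHomogeneous (l : List (Fin (n - 1))) {f : MvPolynomial (Fin n) ℤ} {d : ℕ}
    (h : f.IsHomogeneous (l.length + d)) : (divDiffWord l f).IsHomogeneous d := by
  induction l generalizing d with
  | nil => simpa using h
  | cons k l ih =>
    refine divDiff_isHomogeneous k (ih ?_)
    rw [List.length_cons] at h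
    convert h using 1
    ring

theorem divDiffWord_eq_zero_of_isHomogeneous (l : List (Fin (n - 1)))
    {f : MvPolynomial (Fin n) ℤ} {d : ℕ} (h : f.IsHomogeneous d) (hd : d < l.length) :
    divDiffWord l f = 0 := by
  induction l generalizing d with
  | nil => simp at hd
  | cons k l ih =>
    rw [divDiffWord_cons]
    rw [List.length_cons] at hd
    rcases Nat.lt_or_ge d l.length with h1 | h1
    · rw [ih h h1, divDiff_zero]
    · have : (divDiffWord l f).IsHomogeneous 0 :=
        divDiffWord_isHomogeneous l (by rwa [add_zero, ← (by omega : d = l.length)])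
      rw [← totalDegree_zero_iff_isHomogeneous, totalDegree_eq_zero_iff_eq_C] at this
      rw [this]
      exact divDiff_eq_zero_of_rename_eq (by simp)

/-- The monomial `x₁^{n-1} x₂^{n-2} ⋯ x_n^0`. -/
def staircase (n : ℕ) : MvPolynomial (Fin n) ℤ := ∏ p : Fin n, X p ^ (n - 1 - (p : ℕ))

theorem staircase_isHomogeneous : (staircase n).IsHomogeneous (∑ p : Fin n, (n - 1 - (p : ℕ))) :=
  IsHomogeneous.prod _ _ _ fun p _ => by
    have := (isHomogeneous_X ℤ p).pow (n - 1 - (p : ℕ))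
    rwa [one_mul] at this

theorem natDivDiff_mul_of_eq_zero {k : ℕ} {f : MvPolynomial (Fin n) ℤ} (h : natDivDiff k f = 0)
    (g : MvPolynomial (Fin n) ℤ) : natDivDiff k (f * g) = f * natDivDiff k g := by
  unfold natDivDiff at h ⊢
  split_ifs at h ⊢ with hk
  · exact divDiff_mul_of_invariant (rename_eq_of_divDiff_eq_zero h) g
  · simp

theorem natDivDiff_prod_natX {k m : ℕ} (hm : m ≤ n) (hk : k + 1 ≠ m) (hk' : k < n - 1) :
    natDivDiff k (∏ p ∈ Finset.range m, natX n p) = 0 := by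
  rw [natDivDiff_of_lt hk']
  apply divDiff_eq_zero_of_rename_eq
  rw [map_prod]
  have hswap : ∀ p < n, rename (R := ℤ) (adjSwap ⟨k, hk'⟩) (natX n p) =
      natX n (swap k (k + 1) p) := by
    intro p hp
    rw [natX_of_lt hp, rename_X]
    by_cases h1 : p = k
    · subst h1
      rw [swap_apply_left, natX_of_lt (by omega)]
      exact congrArg X (adjSwap_leftPos ⟨p, hk'⟩)
    by_cases h2 : p = k + 1
    · subst h2
      rw [swap_apply_right, natX_of_lt (by omega)]
      exact congrArg X (adjSwap_rightPos ⟨k, hk'⟩)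
    · rw [swap_apply_of_ne_of_ne h1 h2, natX_of_lt hp, adjSwap_of_ne]
      · exact fun e => h1 (congrArg Fin.val e)
      · exact fun e => h2 (congrArg Fin.val e)
  rw [Finset.prod_congr rfl fun p hp =>
    hswap p (lt_of_lt_of_le (Finset.mem_range.1 hp) hm)]
  refine Finset.prod_equiv (swap k (k + 1)) (fun p => ?_) fun p _ => rfl
  rw [Finset.mem_range, Finset.mem_range, swap_apply_def]
  split_ifs <;> omega

theorem natDivDiff_prod_natX_mul {k : ℕ} (hk : k < n - 1) {g : MvPolynomial (Fin n) ℤ}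
    (hg : natDivDiff k g = 0) :
    natDivDiff k ((∏ p ∈ Finset.range (k + 1), natX n p) * g) =
      (∏ p ∈ Finset.range k, natX n p) * g := by
  rw [mul_comm, natDivDiff_mul_of_eq_zero hg, Finset.prod_range_succ,
    natDivDiff_mul_of_eq_zero (natDivDiff_prod_natX (by omega) (by omega) hk), mul_left_comm,
    mul_comm _ g]
  have : natDivDiff k (natX n k) = 1 := by
    rw [natDivDiff_of_lt hk, natX_of_lt (by omega)]
    exact divDiff_X_left ⟨k, hk⟩
  rw [this, mul_one, mul_comm]

theorem divDiffRun_eq_divDiffWord (k d : ℕ) (h : k + d ≤ n - 1) :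
    ∃ l : List (Fin (n - 1)), ∀ f, divDiffWord l f = divDiffRun k d f := by
  induction d generalizing k with
  | zero => exact ⟨[], fun f => rfl⟩
  | succ d ih =>
    obtain ⟨l, hl⟩ := ih (k + 1) (by omega)
    exact ⟨⟨k, by omega⟩ :: l, fun f => by
      rw [divDiffWord_cons, hl, divDiffRun, natDivDiff_of_lt]⟩

/-- A word whose divided differences turn the staircase monomial in the first `m` variables
into `1`. -/
theorem exists_word_staircase (m : ℕ) (hm : m ≤ n) : ∃ l : List (Fin (n - 1)),
    ∀ g, (∀ k, k + 1 < m → natDivDiff k g = 0) →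
      divDiffWord l ((∏ p ∈ Finset.range m, natX n p ^ (m - 1 - p)) * g) = g := by
  induction m with
  | zero => exact ⟨[], fun g _ => by simp⟩
  | succ m ih =>
    obtain ⟨l, hl⟩ := ih (by omega)
    obtain ⟨l', hl'⟩ := divDiffRun_eq_divDiffWord (n := n) 0 m (by omega)
    refine ⟨l' ++ l, fun g hg => ?_⟩
    have e : (∏ p ∈ Finset.range (m + 1), natX n p ^ (m + 1 - 1 - p)) * g =
        (∏ p ∈ Finset.range m, natX n p ^ (m - 1 - p)) *
          ((∏ p ∈ Finset.range m, natX n p) * g) := by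
      rw [← mul_assoc, ← Finset.prod_mul_distrib, Finset.prod_range_succ]
      simp only [add_tsub_cancel_right, tsub_self, pow_zero, mul_one]
      congr 1
      refine Finset.prod_congr rfl fun p hp => ?_
      rw [← pow_succ]
      congr 1
      have := Finset.mem_range.1 hp
      omega
    rw [divDiffWord_append, e, hl _ fun k hk => ?_, hl']
    · have key : ∀ d, d ≤ m → divDiffRun (m - d) d ((∏ p ∈ Finset.range m, natX n p) * g) =
          (∏ p ∈ Finset.range (m - d), natX n p) * g := by
        intro d
        induction d with
        | zero => exact fun _ => rfl
        | succ d ihd =>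
          intro hd
          have e2 : m - (d + 1) + 1 = m - d := by omega
          rw [divDiffRun, e2, ihd (by omega), ← e2,
            natDivDiff_prod_natX_mul (by omega) (hg _ (by omega))]
      have := key m le_rfl
      simpa using this
    · rw [natDivDiff_mul_of_eq_zero (natDivDiff_prod_natX (by omega) (by omega) (by omega)),
        hg k (by omega), mul_zero]

theorem inversions_subset (u : Perm (Fin n)) :
    inversions u ⊆ Finset.univ.filter fun x : Fin n × Fin n => x.1 < x.2 := by
  intro x hx
  simpa using (mem_inversions.1 hx).1

theorem inversions_revPerm : inversions (Fin.revPerm : Perm (Fin n)) =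
    Finset.univ.filter fun x : Fin n × Fin n => x.1 < x.2 := by
  refine Finset.Subset.antisymm (inversions_subset _) fun x hx => ?_
  have : x.1 < x.2 := by simpa using hx
  exact mem_inversions.2 ⟨this, by simpa using this⟩

theorem invCount_le (u : Perm (Fin n)) : invCount u ≤ invCount (Fin.revPerm : Perm (Fin n)) := by
  rw [invCount, invCount, inversions_revPerm]
  exact Finset.card_le_card (inversions_subset u)

theorem eq_revPerm_of_invCount {u : Perm (Fin n)}
    (h : invCount u = invCount (Fin.revPerm : Perm (Fin n))) : u = Fin.revPerm := by
  have h1 : inversions u = inversions (Fin.revPerm : Perm (Fin n)) := by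
    apply Finset.eq_of_subset_of_card_le
    · rw [inversions_revPerm]
      exact inversions_subset u
    · exact h.ge
  have h2 : Fin.revPerm * u = 1 := by
    apply eq_one_of_left_lt_right
    intro k
    have : (leftPos k, rightPos k) ∈ inversions u := by
      rw [h1, inversions_revPerm, Finset.mem_filter]
      exact ⟨Finset.mem_univ _, Nat.lt_succ_self _⟩
    simpa using (mem_inversions.1 this).2
  ext1 p
  have h3 := congrArg (fun e : Perm (Fin n) => Fin.rev (e p)) h2
  simpa using h3

theorem invCount_revPerm : invCount (Fin.revPerm : Perm (Fin n)) =
    ∑ p : Fin n, (n - 1 - (p : ℕ)) := by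
  rw [invCount, inversions_revPerm, Finset.card_filter, ← Finset.univ_product_univ,
    Finset.sum_product]
  refine Finset.sum_congr rfl fun p _ => ?_
  rw [← Finset.card_filter, ← Fin.card_Ioi]
  congr 1
  ext q
  simp

theorem divDiffPerm_revPerm_staircase :
    divDiffPerm (Fin.revPerm : Perm (Fin n)) (staircase n) = 1 := by
  obtain ⟨l, hl⟩ := exists_word_staircase (n := n) n le_rfl
  have h1 := hl 1 fun k hk => by
    rw [natDivDiff_of_lt (by omega)]
    exact divDiff_eq_zero_of_rename_eq (by simp)
  have e : (∏ p ∈ Finset.range n, natX n p ^ (n - 1 - p)) = staircase n := by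
    rw [← Fin.prod_univ_eq_prod_range (fun p => natX n p ^ (n - 1 - p))]
    exact Finset.prod_congr rfl fun p _ => by rw [natX_of_lt p.2]
  rw [mul_one, e] at h1
  obtain ⟨h2, h3⟩ := divDiffWord_eq_divDiffPerm_of_ne_zero (l := l) (f := staircase n)
    (by rw [h1]; exact one_ne_zero)
  have h4 : l.length = ∑ p : Fin n, (n - 1 - (p : ℕ)) := by
    apply le_antisymm
    · by_contra hc
      have := divDiffWord_eq_zero_of_isHomogeneous l staircase_isHomogeneous (not_le.1 hc)
      rw [h1] at this
      exact one_ne_zero this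
    · rw [h2, ← invCount_revPerm]
      by_contra hc
      have h5 := divDiffWord_isHomogeneous l (f := staircase n)
        (d := ∑ p : Fin n, (n - 1 - (p : ℕ)) - l.length)
        (by
          rw [h2, Nat.add_sub_cancel' (by rw [← invCount_revPerm]; exact invCount_le _)]
          exact staircase_isHomogeneous)
      rw [h1] at h5
      have h6 := (isHomogeneous_one (Fin n) ℤ).inj_right h5 one_ne_zero
      rw [← invCount_revPerm] at h6
      omega
  have h5 : wordProd l = Fin.revPerm :=
    eq_revPerm_of_invCount (by rw [← h2, h4, invCount_revPerm])
  rw [← h5, ← h3, h1]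

theorem invCount_inv (u : Perm (Fin n)) : invCount u⁻¹ = invCount u := by
  have key : ∀ u : Perm (Fin n), invCount u⁻¹ ≤ invCount u := by
    intro u
    obtain ⟨l, hl, hl'⟩ := exists_word_length_eq u
    have h1 : wordProd l.reverse = u⁻¹ := by
      rw [← hl, wordProd, wordProd, List.prod_inv_reverse, List.map_reverse, List.map_map]
      congr 2
    have := invCount_wordProd_le l.reverse
    rwa [h1, List.length_reverse, hl'] at this
  exact le_antisymm (key u) (by simpa using key u⁻¹)

theorem invCount_mul_revPerm (u : Perm (Fin n)) :
    invCount u + invCount (u * Fin.revPerm) = invCount (Fin.revPerm : Perm (Fin n)) := by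
  rw [invCount, invCount, invCount, inversions_revPerm,
    ← Finset.card_filter_add_card_filter_not
      (s := Finset.univ.filter fun x : Fin n × Fin n => x.1 < x.2)
      (fun x => u x.2 < u x.1), Finset.filter_filter]
  congr 1
  refine Finset.card_bij' (fun x _ => (Fin.rev x.2, Fin.rev x.1))
    (fun x _ => (Fin.rev x.2, Fin.rev x.1)) ?_ ?_ ?_ ?_
  · rintro ⟨x, y⟩ h
    obtain ⟨h1, h2⟩ := mem_inversions.1 h
    simp only [Perm.mul_apply, Fin.revPerm_apply] at h1 h2
    simp [h1, h2.le]
  · rintro ⟨x, y⟩ h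
    simp only [Finset.mem_filter, Finset.mem_univ, true_and, not_lt] at h
    rw [mem_inversions]
    refine ⟨by simpa using h.1, ?_⟩
    simp only [Perm.mul_apply, Fin.revPerm_apply, Fin.rev_rev]
    exact lt_of_le_of_ne h.2 fun e => h.1.ne (u.injective e)
  · simp
  · simp

/-- The functionals `schubertCoeff` are dual to the Schubert polynomials. -/
theorem schubertCoeff_schubert (u w : Perm (Fin n)) :
    schubertCoeff u (schubert w) = if u = w then 1 else 0 := by
  obtain ⟨l, hl, hlen, he⟩ := exists_divDiffPerm_eq u
  obtain ⟨l', hl', hlen', he'⟩ := exists_divDiffPerm_eq (w⁻¹ * Fin.revPerm)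
  have hprod : wordProd (l ++ l') = u * (w⁻¹ * Fin.revPerm) := by rw [wordProd_append, hl, hl']
  have hS : schubertCoeff u (schubert w) = constantCoeff (divDiffWord (l ++ l') (staircase n)) := by
    rw [divDiffWord_append, ← he, ← he']
    rfl
  have hinv := invCount_mul_revPerm w⁻¹
  rw [invCount_inv] at hinv
  rw [hS]
  split_ifs with huw
  · subst huw
    rw [mul_inv_cancel_left] at hprod
    rw [← divDiffPerm_eq hprod (by rw [List.length_append, hlen, hlen', hinv]),
      divDiffPerm_revPerm_staircase, map_one]
  · have hne : wordProd (l ++ l') ≠ Fin.revPerm := by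
      rw [hprod, ← mul_assoc]
      intro e
      rw [mul_eq_right] at e
      exact huw (mul_inv_eq_one.1 e)
    rcases divDiffWord_eq_or (l ++ l') with ⟨h1, _⟩ | ⟨_, h2⟩
    · have hlt : (l ++ l').length < ∑ p : Fin n, (n - 1 - (p : ℕ)) := by
        rw [← invCount_revPerm, h1]
        exact lt_of_le_of_ne (invCount_le _) fun e => hne (eq_revPerm_of_invCount e)
      obtain ⟨d, hd⟩ := Nat.exists_eq_add_of_lt hlt
      have hhom := divDiffWord_isHomogeneous (l ++ l') (f := staircase n) (d := d + 1)
        (by rw [← add_assoc, ← hd]; exact staircase_isHomogeneous)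
      rw [constantCoeff_eq]
      exact hhom.coeff_eq_zero (by simp)
    · rw [h2, map_zero]

theorem sub_sum_schubert_mem (f : MvPolynomial (Fin n) ℤ) :
    f - ∑ u, schubertCoeff u f • schubert u ∈ coinvIdeal n := by
  rw [mem_coinvIdeal_iff]
  intro w
  rw [← schubertCoeffHom_apply, map_sub, map_sum]
  simp only [map_zsmul, schubertCoeffHom_apply, schubertCoeff_schubert]
  simp

theorem mk_eq_sum_schubertClass (f : MvPolynomial (Fin n) ℤ) :
    Ideal.Quotient.mk (coinvIdeal n) f = ∑ u, schubertCoeff u f • schubertClass u := by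
  have := Ideal.Quotient.eq.2 (sub_sum_schubert_mem f)
  rw [this, map_sum]
  simp [schubertClass]

theorem mk_eq_zero_iff (f : MvPolynomial (Fin n) ℤ) :
    Ideal.Quotient.mk (coinvIdeal n) f = 0 ↔ ∀ u, schubertCoeff u f = 0 := by
  rw [Ideal.Quotient.eq_zero_iff_mem, mem_coinvIdeal_iff]

/-! ### Polynomials bounded by the staircase -/

/-- The monomials in `f` divide the staircase monomial. -/
def StaircaseBounded (f : MvPolynomial (Fin n) ℤ) : Prop :=
  ∀ p : Fin n, f.degreeOf p ≤ n - 1 - p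

theorem degreeOf_X_sub_X_mul {p q : Fin n} (hpq : p ≠ q) {g : MvPolynomial (Fin n) ℤ}
    (hg : g ≠ 0) : degreeOf p ((X p - X q) * g) = degreeOf p g + 1 := by
  rw [degreeOf_mul_eq (X_sub_X_ne_zero hpq) hg, add_comm]
  congr 1
  apply le_antisymm
  · refine (degreeOf_sub_le _ _ _).trans ?_
    simp [degreeOf_X, hpq]
  · have := monomial_le_degreeOf p (f := (X p - X q : MvPolynomial (Fin n) ℤ))
      (m := Finsupp.single p 1) (by
        have h1 : Finsupp.single q 1 ≠ Finsupp.single p 1 := by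
          rw [Ne, Finsupp.single_left_inj one_ne_zero]
          exact hpq.symm
        rw [mem_support_iff, coeff_sub, coeff_X, coeff_X, if_pos rfl, if_neg h1]
        simp)
    simpa using this

theorem StaircaseBounded.divDiff {f : MvPolynomial (Fin n) ℤ} (hf : StaircaseBounded f)
    (k : Fin (n - 1)) : StaircaseBounded (divDiff k f) := by
  intro p
  by_cases hg : SchubertGens.divDiff k f = 0
  · simp [hg]
  have h1 := mul_divDiff k f
  have hren : ∀ p, degreeOf (adjSwap k p) (rename (adjSwap k) f) = degreeOf p f := fun p =>
    degreeOf_rename_of_injective (adjSwap k).injective p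
  have hl := hf (leftPos k)
  have hr := hf (rightPos k)
  have el : ((leftPos k : Fin n) : ℕ) = k := rfl
  have er : ((rightPos k : Fin n) : ℕ) = k + 1 := rfl
  by_cases hp1 : p = leftPos k
  · subst hp1
    have h2 := degreeOf_X_sub_X_mul (leftPos_ne_rightPos k) hg
    rw [h1] at h2
    have h3 := degreeOf_sub_le (leftPos k) f (rename (adjSwap k) f)
    have h4 := hren (rightPos k)
    rw [adjSwap_rightPos] at h4
    rw [h2, h4] at h3
    have := k.2
    have := le_max_iff.1 h3
    omega
  by_cases hp2 : p = rightPos k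
  · subst hp2
    have h2 := degreeOf_X_sub_X_mul (leftPos_ne_rightPos k).symm hg
    rw [← neg_sub (X (leftPos k)), neg_mul, degreeOf_neg, h1] at h2
    have h3 := degreeOf_sub_le (rightPos k) f (rename (adjSwap k) f)
    have h4 := hren (leftPos k)
    rw [adjSwap_leftPos] at h4
    rw [h2, h4] at h3
    have := k.2
    have := le_max_iff.1 h3
    omega
  · have h2 := degreeOf_mul_eq (n := p) (left_sub_right_ne_zero k) hg
    rw [h1] at h2
    have h3 := degreeOf_sub_le p f (rename (adjSwap k) f)
    have h4 := hren p
    rw [adjSwap_of_ne hp1 hp2] at h4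
    rw [h4, max_self] at h3
    have := hf p
    omega

theorem staircaseBounded_staircase : StaircaseBounded (staircase n) := by
  intro p
  have : staircase n =
      monomial (Finsupp.equivFunOnFinite.symm fun p : Fin n => n - 1 - (p : ℕ)) 1 := by
    rw [monomial_eq, staircase, map_one, one_mul, Finsupp.prod_fintype _ _ (by simp)]
    rfl
  rw [this, degreeOf_monomial_eq _ _ one_ne_zero]
  simp

theorem staircaseBounded_schubert (w : Perm (Fin n)) : StaircaseBounded (schubert w) := by
  change StaircaseBounded (divDiffPerm _ (staircase n))
  unfold divDiffPerm
  induction (exists_isReducedWord (w⁻¹ * Fin.revPerm)).choose with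
  | nil => exact staircaseBounded_staircase
  | cons k l ih => exact ih.divDiff k

/-- There are as many monomials dividing the staircase monomial as there are permutations, so the
dual functionals, which take all values on the polynomials bounded by the staircase, determine
these polynomials. -/
theorem eq_zero_of_staircaseBounded {f : MvPolynomial (Fin n) ℤ} (hf : StaircaseBounded f)
    (h : ∀ u, schubertCoeff u f = 0) : f = 0 := by
  let ι := ∀ p : Fin n, Fin (n - p)
  let e : ι → (Fin n →₀ ℕ) := fun m => Finsupp.equivFunOnFinite.symm fun p => (m p : ℕ)
  have he : Function.Injective e := by
    intro m m' hm
    have := Finsupp.equivFunOnFinite.symm.injective hm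
    funext p
    exact Fin.ext (congrFun this p)
  let ψ : (ι → ℤ) →ₗ[ℤ] MvPolynomial (Fin n) ℤ := Fintype.linearCombination ℤ fun m =>
    monomial (e m) (1 : ℤ)
  let Φ : MvPolynomial (Fin n) ℤ →ₗ[ℤ] (Perm (Fin n) → ℤ) :=
    LinearMap.pi fun u => (schubertCoeffHom u).toIntLinearMap
  have hrange : ∀ g : MvPolynomial (Fin n) ℤ, StaircaseBounded g → ∃ c, ψ c = g := by
    intro g hg
    refine ⟨fun m => coeff (e m) g, ?_⟩
    simp only [ψ, Fintype.linearCombination_apply, smul_monomial, smul_eq_mul, mul_one]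
    conv_rhs => rw [g.as_sum]
    symm
    rw [← Finset.sum_image (s := Finset.univ) (g := e) (f := fun m => monomial m (coeff m g))
      fun _ _ _ _ h => he h]
    refine Finset.sum_subset (fun m hm => ?_) fun m _ hm => ?_
    · rw [Finset.mem_image]
      have : ∀ p : Fin n, m p < n - p := by
        intro p
        have h1 := monomial_le_degreeOf p hm
        have h2 := hg p
        have := p.2
        omega
      exact ⟨fun p => ⟨m p, this p⟩, Finset.mem_univ _, by ext p; simp [e]⟩
    · rw [notMem_support_iff.1 hm, map_zero]
  have hsurj : Function.Surjective (Φ ∘ₗ ψ) := by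
    intro b
    have : ∃ c, Φ (ψ c) = b := by
      choose c hc using fun u : Perm (Fin n) => hrange (schubert u) (staircaseBounded_schubert u)
      refine ⟨∑ u, b u • c u, ?_⟩
      rw [map_sum, map_sum]
      simp only [map_smul, hc]
      funext w
      simp [Φ, schubertCoeffHom_apply, schubertCoeff_schubert]
    exact this
  have hcard : Fintype.card (Perm (Fin n)) = Fintype.card ι := by
    rw [Fintype.card_perm, Fintype.card_pi, Fintype.card_fin]
    simp only [Fintype.card_fin]
    rw [Fin.prod_univ_eq_prod_range (fun p => n - p), ← Finset.prod_range_add_one_eq_factorial,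
      ← Finset.prod_range_reflect]
    refine Finset.prod_congr rfl fun p hp => ?_
    have := Finset.mem_range.1 hp
    omega
  -- A surjective linear map between free modules of the same finite rank is injective.
  have hinj : Function.Injective (Φ ∘ₗ ψ) := by
    let E : (Perm (Fin n) → ℤ) ≃ₗ[ℤ] (ι → ℤ) :=
      LinearEquiv.funCongrLeft ℤ ℤ (Fintype.equivOfCardEq hcard.symm)
    have h1 : Function.Surjective (E.toLinearMap ∘ₗ (Φ ∘ₗ ψ)) := E.surjective.comp hsurj
    have h2 := OrzechProperty.injective_of_surjective_endomorphism _ h1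
    rw [LinearMap.coe_comp] at h2
    exact Function.Injective.of_comp h2
  obtain ⟨c, rfl⟩ := hrange f hf
  have : (Φ ∘ₗ ψ) c = (Φ ∘ₗ ψ) 0 := by
    rw [map_zero]
    funext u
    exact h u
  rw [hinj this, map_zero]

end SchubertBasis

section BruhatOrder

variable {n : ℕ}

/-! ### Bruhat order above a bigrassmannian permutation -/

/-- The number of positions `p < r` with `s ≤ u p` (positions and values counted from `0`). -/
def crossCount (r s : ℕ) (u : Perm (Fin n)) : ℕ :=
  (Finset.univ.filter fun x : Fin n => (x : ℕ) < r ∧ s ≤ (u x : ℕ)).card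

theorem crossCount_mul_swap (r s : ℕ) (u : Perm (Fin n)) {p q : Fin n} (hpq : p ≠ q) :
    ∃ K, crossCount r s u = K + (if (p : ℕ) < r ∧ s ≤ (u p : ℕ) then 1 else 0) +
        (if (q : ℕ) < r ∧ s ≤ (u q : ℕ) then 1 else 0) ∧
      crossCount r s (u * swap p q) = K + (if (p : ℕ) < r ∧ s ≤ (u q : ℕ) then 1 else 0) +
        (if (q : ℕ) < r ∧ s ≤ (u p : ℕ) then 1 else 0) := by
  have hq : q ∈ Finset.univ.erase p := by simp [hpq.symm]
  refine ⟨∑ x ∈ (Finset.univ.erase p).erase q, if (x : ℕ) < r ∧ s ≤ (u x : ℕ) then 1 else 0,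
    ?_, ?_⟩
  · rw [crossCount, Finset.card_filter, ← Finset.add_sum_erase _ _ (Finset.mem_univ p),
      ← Finset.add_sum_erase _ _ hq]
    ring
  · rw [crossCount, Finset.card_filter, ← Finset.add_sum_erase _ _ (Finset.mem_univ p),
      ← Finset.add_sum_erase _ _ hq]
    have : ∑ x ∈ (Finset.univ.erase p).erase q,
        (if (x : ℕ) < r ∧ s ≤ ((u * swap p q) x : ℕ) then 1 else 0) =
        ∑ x ∈ (Finset.univ.erase p).erase q, if (x : ℕ) < r ∧ s ≤ (u x : ℕ) then 1 else 0 := by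
      refine Finset.sum_congr rfl fun x hx => ?_
      simp only [Finset.mem_erase, Finset.mem_univ, and_true] at hx
      rw [Perm.mul_apply, swap_apply_of_ne_of_ne hx.2 hx.1]
    rw [this]
    simp only [Perm.mul_apply, swap_apply_left, swap_apply_right]
    ring

theorem crossCount_mul_swap_le (r s : ℕ) {u : Perm (Fin n)} {p q : Fin n} (hpq : p < q)
    (h : u q < u p) : crossCount r s (u * swap p q) ≤ crossCount r s u := by
  obtain ⟨K, h1, h2⟩ := crossCount_mul_swap r s u hpq.ne
  rw [h1, h2]
  rw [Fin.lt_def] at hpq h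
  split_ifs <;> omega

/-- The easy half of the tableau criterion: `crossCount r s` is monotone in Bruhat order. -/
theorem crossCount_le_of_bruhatLE (r s : ℕ) {u w : Perm (Fin n)} (h : BruhatLE u w) :
    crossCount r s u ≤ crossCount r s w := by
  induction h with
  | refl => exact le_rfl
  | tail _ h ih =>
    obtain ⟨p, q, hpq, hlt, rfl⟩ := h
    refine ih.trans ?_
    rename_i x _
    have := crossCount_mul_swap_le r s (u := x * swap p q) hpq (by simpa using hlt)
    rwa [mul_assoc, swap_mul_self, mul_one] at this

/-- The permutation `u` has no descent, except possibly at `r`. -/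
def IsGrassmannian (r : ℕ) (u : Perm (Fin n)) : Prop :=
  ∀ k : Fin (n - 1), (k : ℕ) + 1 ≠ r → u (leftPos k) < u (rightPos k)

theorem IsGrassmannian.lt {r : ℕ} {u : Perm (Fin n)} (hu : IsGrassmannian r u) {p q : Fin n}
    (hpq : p < q) (h : (q : ℕ) < r ∨ r ≤ p) : u p < u q := by
  have key : ∀ d : ℕ, ∀ q : Fin n, (q : ℕ) = p + d + 1 → ((q : ℕ) < r ∨ r ≤ p) → u p < u q := by
    intro d
    induction d with
    | zero =>
      intro q hq h
      have hk : (p : ℕ) < n - 1 := by omega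
      have := hu ⟨p, hk⟩ (by simp only; omega)
      have e : rightPos ⟨p, hk⟩ = q := Fin.ext hq.symm
      rwa [e] at this
    | succ d ih =>
      intro q hq h
      have hk : (p : ℕ) + d + 1 < n - 1 := by omega
      have h1 := hu ⟨p + d + 1, hk⟩ (by simp only; omega)
      have e : rightPos ⟨p + d + 1, hk⟩ = q := Fin.ext (by simp only [rightPos]; omega)
      rw [e] at h1
      exact (ih (leftPos ⟨p + d + 1, hk⟩) rfl (by simp only [leftPos]; omega)).trans h1
  rw [Fin.lt_def] at hpq
  exact key (q - p - 1) q (by omega) h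

/-- A permutation without descents except at `r` is determined by its first `r` values. -/
theorem IsGrassmannian.ext {r : ℕ} {u w : Perm (Fin n)} (hu : IsGrassmannian r u)
    (hw : IsGrassmannian r w) (h : ∀ p : Fin n, (p : ℕ) < r → u p = w p) : u = w := by
  have key : ∀ u w : Perm (Fin n), IsGrassmannian r u → IsGrassmannian r w →
      (∀ p : Fin n, (p : ℕ) < r → u p = w p) → ∀ p : Fin n, (∀ q < p, u q = w q) →
      ¬ u p < w p := by
    intro u w hu hw h p hp hlt
    obtain ⟨q, hq⟩ := w.surjective (u p)
    have hqr : r ≤ q := by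
      by_contra hc
      have h1 := h q (not_le.1 hc)
      rw [hq] at h1
      obtain rfl := u.injective h1
      exact hlt.ne hq.symm
    have hpr : r ≤ p := by
      by_contra hc
      rw [h p (not_le.1 hc)] at hlt
      exact lt_irrefl _ hlt
    rcases lt_trichotomy q p with hc | hc | hc
    · have h1 := hp q hc
      rw [hq] at h1
      exact hc.ne (u.injective h1)
    · rw [hc] at hq
      exact hlt.ne hq.symm
    · have h1 := hw.lt hc (Or.inr hpr)
      rw [hq] at h1
      exact absurd h1 hlt.not_gt
  ext1 p
  induction p using WellFoundedLT.induction with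
  | _ p ih =>
    rcases lt_trichotomy (u p) (w p) with hc | hc | hc
    · exact absurd hc (key u w hu hw h p ih)
    · exact hc
    · exact absurd hc
        (key w u hw hu (fun p hp => (h p hp).symm) p fun q hq => (ih q hq).symm)

theorem card_filter_Ico {a b : ℕ} (hb : b ≤ n) :
    (Finset.univ.filter fun x : Fin n => a ≤ (x : ℕ) ∧ (x : ℕ) < b).card = b - a := by
  rw [← Nat.card_Ico, ← Finset.card_map Fin.valEmbedding]
  congr 1
  ext y
  simp only [Finset.mem_map, Finset.mem_filter, Finset.mem_univ, true_and, Fin.valEmbedding_apply,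
    Finset.mem_Ico]
  constructor
  · rintro ⟨x, hx, rfl⟩
    exact hx
  · intro hy
    exact ⟨⟨y, by omega⟩, hy, rfl⟩

theorem card_filter_apply_Ico (u : Perm (Fin n)) {a b : ℕ} (hb : b ≤ n) :
    (Finset.univ.filter fun x : Fin n => a ≤ (u x : ℕ) ∧ (u x : ℕ) < b).card = b - a := by
  rw [← card_filter_Ico hb]
  exact Finset.card_equiv u (by simp)

theorem IsGrassmannian.filter_eq {r s : ℕ} {u : Perm (Fin n)} (hu : IsGrassmannian r u)
    (hr : r ≤ n) (hc : crossCount r s u ≤ r) :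
    (Finset.univ.filter fun x : Fin n => (x : ℕ) < r ∧ s ≤ (u x : ℕ)) =
      Finset.univ.filter fun x : Fin n => r - crossCount r s u ≤ (x : ℕ) ∧ (x : ℕ) < r := by
  apply Finset.eq_of_subset_of_card_le
  · intro x hx
    simp only [Finset.mem_filter, Finset.mem_univ, true_and] at hx ⊢
    refine ⟨?_, hx.1⟩
    have hsub : (Finset.univ.filter fun y : Fin n => (x : ℕ) ≤ y ∧ (y : ℕ) < r) ⊆
        Finset.univ.filter fun x : Fin n => (x : ℕ) < r ∧ s ≤ (u x : ℕ) := by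
      intro y hy
      simp only [Finset.mem_filter, Finset.mem_univ, true_and] at hy ⊢
      refine ⟨hy.2, ?_⟩
      rcases eq_or_lt_of_le hy.1 with h | h
      · rw [← Fin.ext h]
        exact hx.2
      · exact hx.2.trans (Fin.lt_def.1 (hu.lt (Fin.lt_def.2 h) (Or.inl hy.2))).le
    have := Finset.card_le_card hsub
    rw [card_filter_Ico hr] at this
    change _ ≤ crossCount r s u at this
    omega
  · rw [card_filter_Ico hr]
    change _ ≤ crossCount r s u
    omega

/-- The first `r` values of a bigrassmannian permutation. -/
theorem IsGrassmannian.apply_eq {r s : ℕ} {u : Perm (Fin n)} (hu : IsGrassmannian r u)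
    (hu' : IsGrassmannian s u⁻¹) (hr : r ≤ n) (hc : crossCount r s u ≤ r)
    {p : Fin n} (hp : (p : ℕ) < r) : (u p : ℕ) =
      if (p : ℕ) < r - crossCount r s u then (p : ℕ)
      else s + (p - (r - crossCount r s u)) := by
  have hA := hu.filter_eq hr hc
  have hmem : ∀ x : Fin n, (x : ℕ) < r → (s ≤ (u x : ℕ) ↔ r - crossCount r s u ≤ (x : ℕ)) := by
    intro x hx
    have := Finset.ext_iff.1 hA x
    simpa [hx] using this
  -- Values below `s`, and likewise values from `s` on, appear in increasing order.
  have hval : ∀ x y : Fin n, ((u y : ℕ) < s ∨ s ≤ (u x : ℕ)) → u x < u y → x < y := by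
    intro x y h hxy
    have := hu'.lt hxy h
    simpa using this
  by_cases hps : (u p : ℕ) < s
  · rw [if_pos (by have := hmem p hp; omega)]
    have h1 := card_filter_apply_Ico u (a := 0) (u p).2.le
    have h2 := card_filter_Ico (n := n) (a := 0) p.2.le
    rw [tsub_zero] at h1 h2
    rw [← h1]
    conv_rhs => rw [← h2]
    congr 1
    ext x
    simp only [Finset.mem_filter, Finset.mem_univ, true_and, zero_le, ← Fin.lt_def]
    exact ⟨hval x p (Or.inl hps), fun h => hu.lt h (Or.inl hp)⟩
  · have hps := not_lt.1 hps
    have hpc := (hmem p hp).1 hps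
    rw [if_neg (by omega)]
    have h1 := card_filter_apply_Ico u (a := s) (u p).2.le
    have h2 := card_filter_Ico (n := n) (a := r - crossCount r s u) p.2.le
    have h3 : (Finset.univ.filter fun x : Fin n => s ≤ (u x : ℕ) ∧ (u x : ℕ) < u p) =
        Finset.univ.filter fun x : Fin n => r - crossCount r s u ≤ (x : ℕ) ∧ (x : ℕ) < p := by
      ext x
      simp only [Finset.mem_filter, Finset.mem_univ, true_and, ← Fin.lt_def]
      constructor
      · rintro ⟨h4, h5⟩
        have h6 := hval x p (Or.inr h4) h5
        have h7 := Fin.lt_def.1 h6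
        exact ⟨(hmem x (by omega)).1 h4, h6⟩
      · rintro ⟨h4, h5⟩
        have h7 := Fin.lt_def.1 h5
        exact ⟨(hmem x (by omega)).2 h4, hu.lt h5 (Or.inl hp)⟩
    rw [h3] at h1
    omega

theorem BruhatLE.of_mul_swap {v u : Perm (Fin n)} {p q : Fin n} (hpq : p < q) (h : u q < u p)
    (hv : BruhatLE v (u * swap p q)) : BruhatLE v u := by
  refine hv.tail ⟨p, q, hpq, by simpa using h, ?_⟩
  rw [mul_assoc, swap_mul_self, mul_one]

/-- If the rank condition is not void, some value `< s` still stands at a position `≥ r`, since the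
first `r` positions have too little room for all `s` of them. -/
theorem exists_of_lt_crossCount {r s : ℕ} {u : Perm (Fin n)} (hr : r ≤ n) (hs : s ≤ n)
    (h0 : 0 < crossCount r s u) (h : r < crossCount r s u + s) :
    ∃ p q : Fin n, (p : ℕ) < r ∧ r ≤ q ∧ s ≤ (u p : ℕ) ∧ (u q : ℕ) < s := by
  obtain ⟨p, hp⟩ := Finset.card_pos.1 h0
  simp only [Finset.mem_filter, Finset.mem_univ, true_and] at hp
  by_contra hc
  have hq : ∀ q : Fin n, (u q : ℕ) < s → (q : ℕ) < r := by
    intro q hqs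
    by_contra hqr
    exact hc ⟨p, q, hp.1, not_lt.1 hqr, hp.2, hqs⟩
  have h1 := card_filter_Ico (n := n) (a := 0) hr
  have h2 := card_filter_apply_Ico u (a := 0) hs
  rw [← Finset.card_filter_add_card_filter_not (fun x : Fin n => s ≤ (u x : ℕ)),
    Finset.filter_filter, Finset.filter_filter] at h1
  simp only [zero_le, true_and, tsub_zero] at h1 h2
  have h3 : (Finset.univ.filter fun x : Fin n => (x : ℕ) < r ∧ ¬ s ≤ (u x : ℕ)) =
      Finset.univ.filter fun x : Fin n => (u x : ℕ) < s := by
    ext x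
    simp only [Finset.mem_filter, Finset.mem_univ, true_and, not_le]
    exact ⟨fun h => h.2, fun h => ⟨hq x h, h⟩⟩
  rw [h3, h2] at h1
  change crossCount r s u + s = r at h1
  omega

/-- The permutations above a bigrassmannian permutation are given by one rank condition: if some
other permutation satisfies it, one can undo an inversion and keep the condition. -/
theorem bruhatLE_of_le_crossCount {r s : ℕ} {v : Perm (Fin n)} (hr : r ≤ n) (hs : s ≤ n)
    (hv : IsGrassmannian r v) (hv' : IsGrassmannian s v⁻¹) (h0 : 0 < crossCount r s v)
    (hvr : crossCount r s v ≤ r) (hrs : r < crossCount r s v + s)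
    {u : Perm (Fin n)} (hu : crossCount r s v ≤ crossCount r s u) : BruhatLE v u := by
  induction hN : invCount u using Nat.strong_induction_on generalizing u with
  | _ N ih =>
  subst hN
  have step : ∀ p q : Fin n, p < q → u q < u p → crossCount r s v ≤ crossCount r s (u * swap p q) →
      BruhatLE v u := by
    intro p q hpq h hle
    refine BruhatLE.of_mul_swap hpq h (ih _ ?_ hle rfl)
    have := invCount_lt_mul_swap (u := u * swap p q) hpq (by simpa using h)
    rwa [mul_assoc, swap_mul_self, mul_one] at this
  -- There is room to lower the count by one: interchange a large value standing before position `r`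
  -- with a small one standing after it.
  by_cases hlt : crossCount r s v < crossCount r s u
  · obtain ⟨p, q, hp, hq, hup, huq⟩ :=
      exists_of_lt_crossCount (u := u) hr hs (by omega) (by omega)
    have hpq : p < q := Fin.lt_def.2 (by omega)
    refine step p q hpq (Fin.lt_def.2 (by omega)) ?_
    obtain ⟨K, h1, h2⟩ := crossCount_mul_swap r s u hpq.ne
    rw [h2]
    rw [h1] at hlt
    split_ifs at hlt ⊢ <;> omega
  have heq : crossCount r s u = crossCount r s v := le_antisymm (not_lt.1 hlt) hu
  -- Undoing a descent of `u` away from `r`, or of `u⁻¹` away from `s`, does not change the count.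
  by_cases hG : IsGrassmannian r u
  swap
  · simp only [IsGrassmannian, not_forall, not_lt] at hG
    obtain ⟨k, hk, hle⟩ := hG
    have hlr : leftPos k < rightPos k := Fin.lt_def.2 (Nat.lt_succ_self _)
    have hlt := lt_of_le_of_ne hle fun e => hlr.ne' (u.injective e)
    refine step _ _ hlr hlt ?_
    obtain ⟨K, h1, h2⟩ := crossCount_mul_swap r s u hlr.ne
    rw [h2]
    rw [h1] at hu
    have el : ((leftPos k : Fin n) : ℕ) = k := rfl
    have er : ((rightPos k : Fin n) : ℕ) = k + 1 := rfl
    rw [el, er] at hu ⊢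
    clear h1 h2
    split_ifs at hu ⊢ <;> omega
  by_cases hG' : IsGrassmannian s u⁻¹
  swap
  · simp only [IsGrassmannian, not_forall, not_lt] at hG'
    obtain ⟨k, hk, hle⟩ := hG'
    have hlt := lt_of_le_of_ne hle (inv_left_ne_inv_right u k).symm
    have hlr : leftPos k < rightPos k := Fin.lt_def.2 (Nat.lt_succ_self _)
    refine step _ _ hlt (by simpa using hlr) ?_
    obtain ⟨K, h1, h2⟩ := crossCount_mul_swap r s u hlt.ne
    rw [h2]
    rw [h1] at hu
    have el : ((u (u⁻¹ (leftPos k)) : Fin n) : ℕ) = k := by simp [leftPos]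
    have er : ((u (u⁻¹ (rightPos k)) : Fin n) : ℕ) = k + 1 := by simp [rightPos]
    rw [el, er] at hu ⊢
    clear h1 h2
    split_ifs at hu ⊢ <;> omega
  -- Otherwise `u` is itself bigrassmannian, and the count determines it.
  have : v = u := by
    refine hv.ext hG fun p hp => Fin.ext ?_
    rw [hv.apply_eq hv' hr hvr hp, hG.apply_eq hG' hr (by omega) hp, heq]
  rw [this]
  exact Relation.ReflTransGen.refl

theorem isGrassmannian_of_descents {r : ℕ} {u : Perm (Fin n)} (h : descents u = {r}) :
    IsGrassmannian r u := by
  intro k hk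
  by_contra hc
  have hlr : leftPos k < rightPos k := Fin.lt_def.2 (Nat.lt_succ_self _)
  have hlt := lt_of_le_of_ne (not_lt.1 hc) fun e => hlr.ne' (u.injective e)
  have : (k : ℕ) + 1 ∈ descents u := ⟨leftPos k, rightPos k, rfl, rfl, hlt⟩
  rw [h] at this
  exact hk this

theorem IsBigrassmannian.crossCount_eq {r s t : ℕ} {v : Perm (Fin n)}
    (hv : IsBigrassmannian r s t v) (htr : t ≤ r) (hr : r ≤ n) :
    crossCount r s v = r - t + 1 := by
  obtain ⟨h1, -, p, hp, hvp⟩ := hv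
  have hG := isGrassmannian_of_descents h1
  have : r - t + 1 = r - p := by omega
  rw [this, ← card_filter_Ico hr, crossCount]
  congr 1
  ext x
  simp only [Finset.mem_filter, Finset.mem_univ, true_and]
  constructor
  · rintro ⟨h2, h3⟩
    refine ⟨?_, h2⟩
    by_contra hc
    have := Fin.lt_def.1 (hG.lt (Fin.lt_def.2 (not_le.1 hc)) (Or.inl (by omega)))
    omega
  · rintro ⟨h2, h3⟩
    refine ⟨h3, ?_⟩
    rcases eq_or_lt_of_le h2 with h4 | h4
    · rw [← Fin.ext h4]
      omega
    · have := Fin.lt_def.1 (hG.lt (Fin.lt_def.2 h4) (Or.inl h3))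
      omega

/-- The principal upper set of a bigrassmannian permutation is cut out by one rank condition. -/
theorem IsBigrassmannian.bruhatLE_iff {r s t : ℕ} {v : Perm (Fin n)}
    (hv : IsBigrassmannian r s t v) (ht : 1 ≤ t) (htr : t ≤ r) (hts : t ≤ s) (hr : r ≤ n)
    (hs : s ≤ n) {u : Perm (Fin n)} : BruhatLE v u ↔ r - t + 1 ≤ crossCount r s u := by
  have hc := hv.crossCount_eq htr hr
  constructor
  · intro h
    rw [← hc]
    exact crossCount_le_of_bruhatLE r s h
  · intro h
    exact bruhatLE_of_le_crossCount hr hs (isGrassmannian_of_descents hv.1)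
      (isGrassmannian_of_descents hv.2.1) (by omega) (by omega) (by omega) (by omega)

end BruhatOrder

/-! ### Young diagrams and their rows -/

section Diagrams

theorem le_iff_rowLen_le {μ ν : YoungDiagram} : μ ≤ ν ↔ ∀ p, μ.rowLen p ≤ ν.rowLen p := by
  constructor
  · intro h p
    by_contra hc
    have h1 : (p, ν.rowLen p) ∈ μ := YoungDiagram.mem_iff_lt_rowLen.2 (not_le.1 hc)
    have h2 : (p, ν.rowLen p) ∈ ν := h h1
    exact lt_irrefl _ (YoungDiagram.mem_iff_lt_rowLen.1 h2)
  · rintro h ⟨p, q⟩ hpq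
    have h1 : (p, q) ∈ μ := hpq
    exact YoungDiagram.mem_iff_lt_rowLen.2 ((YoungDiagram.mem_iff_lt_rowLen.1 h1).trans_le (h p))

theorem rowLen_eq_of_mem {μ : YoungDiagram} {p c : ℕ} (h : ∀ q, (p, q) ∈ μ ↔ q < c) :
    μ.rowLen p = c := by
  apply le_antisymm
  · by_contra hc
    exact lt_irrefl _ ((h c).1 (YoungDiagram.mem_iff_lt_rowLen.2 (not_le.1 hc)))
  · by_contra hc
    exact lt_irrefl _ (YoungDiagram.mem_iff_lt_rowLen.1 ((h _).2 (not_le.1 hc)))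

theorem diagram_ext {μ ν : YoungDiagram} (h : ∀ p, μ.rowLen p = ν.rowLen p) : μ = ν :=
  le_antisymm (le_iff_rowLen_le.2 fun p => (h p).le) (le_iff_rowLen_le.2 fun p => (h p).ge)

theorem mem_rect {m c p q : ℕ} : (p, q) ∈ rect m c ↔ p < m ∧ q < c := by
  rw [← YoungDiagram.mem_cells]
  simp [rect]

theorem rowLen_rect (m c p : ℕ) : (rect m c).rowLen p = if p < m then c else 0 := by
  apply rowLen_eq_of_mem
  intro q
  rw [mem_rect]
  split_ifs <;> simp [*]

theorem rowLen_sup (μ ν : YoungDiagram) (p : ℕ) :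
    (μ ⊔ ν).rowLen p = max (μ.rowLen p) (ν.rowLen p) := by
  apply rowLen_eq_of_mem
  intro q
  rw [YoungDiagram.mem_sup, YoungDiagram.mem_iff_lt_rowLen, YoungDiagram.mem_iff_lt_rowLen,
    lt_max_iff]

theorem colLen_le_iff {μ : YoungDiagram} {r : ℕ} : μ.colLen 0 ≤ r ↔ μ.rowLen r = 0 := by
  constructor
  · intro h
    by_contra hc
    have h1 : (r, 0) ∈ μ := YoungDiagram.mem_iff_lt_rowLen.2 (Nat.pos_of_ne_zero hc)
    have := YoungDiagram.mem_iff_lt_colLen.1 h1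
    omega
  · intro h
    by_contra hc
    have h1 : (r, 0) ∈ μ := YoungDiagram.mem_iff_lt_colLen.2 (not_le.1 hc)
    have := YoungDiagram.mem_iff_lt_rowLen.1 h1
    omega

theorem rowLen_eq_zero {μ : YoungDiagram} {r p : ℕ} (h : μ.colLen 0 ≤ r) (hp : r ≤ p) :
    μ.rowLen p = 0 := colLen_le_iff.1 (h.trans hp)

theorem le_rect_iff {μ : YoungDiagram} {r m : ℕ} :
    μ ≤ rect r m ↔ μ.colLen 0 ≤ r ∧ μ.rowLen 0 ≤ m := by
  rw [le_iff_rowLen_le, colLen_le_iff]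
  constructor
  · intro h
    have h1 := h r
    have h2 := h 0
    rw [rowLen_rect] at h1 h2
    rw [if_neg (lt_irrefl _)] at h1
    refine ⟨by omega, ?_⟩
    split_ifs at h2 <;> omega
  · rintro ⟨h1, h2⟩ p
    rw [rowLen_rect]
    have := μ.rowLen_anti 0 p (Nat.zero_le _)
    split_ifs with hp
    · omega
    · have := μ.rowLen_anti r p (not_lt.1 hp)
      omega

/-- The Young diagram with row lengths `f 0 ≥ f 1 ≥ ⋯ ≥ f (L - 1)`. -/
def diagramOf (L : ℕ) (f : ℕ → ℕ) (hf : Antitone f) : YoungDiagram where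
  cells := (Finset.range L ×ˢ Finset.range (f 0)).filter fun x => x.2 < f x.1
  isLowerSet := by
    rintro ⟨p, q⟩ ⟨p', q'⟩ ⟨h1, h2⟩ h
    simp only [Finset.coe_filter, Finset.mem_product, Finset.mem_range, Set.mem_ofPred_eq] at h ⊢
    simp only at h1 h2
    have := hf h1
    have := hf (Nat.zero_le p')
    omega

theorem rowLen_diagramOf (L : ℕ) (f : ℕ → ℕ) (hf : Antitone f) (p : ℕ) :
    (diagramOf L f hf).rowLen p = if p < L then f p else 0 := by
  apply rowLen_eq_of_mem
  intro q
  rw [← YoungDiagram.mem_cells]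
  have := hf (Nat.zero_le p)
  simp only [diagramOf, Finset.mem_filter, Finset.mem_product, Finset.mem_range]
  split_ifs <;> omega

theorem finite_Iic_diagram (ν : YoungDiagram) : (Set.Iic ν).Finite := by
  refine Set.Finite.of_injOn (f := YoungDiagram.cells) (t := ↑ν.cells.powerset) ?_ ?_
    (Finset.finite_toSet _)
  · intro μ hμ
    rw [Finset.mem_coe, Finset.mem_powerset]
    exact hμ
  · intro μ _ ν _ h
    exact YoungDiagram.ext h

/-- The partitions contained in the rectangle `m^r`. -/
def boxDiagrams (r m : ℕ) : Finset YoungDiagram := (finite_Iic_diagram (rect r m)).toFinset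

theorem mem_boxDiagrams {r m : ℕ} {μ : YoungDiagram} : μ ∈ boxDiagrams r m ↔ μ ≤ rect r m := by
  simp [boxDiagrams]

end Diagrams

section Flagged

variable {n : ℕ}

/-! ### Flagged Jacobi-Trudi determinants -/

/-- The complete homogeneous polynomial `h_m(x_0, …, x_{K-1})`. -/
def homogFirst (n : ℕ) : ℕ → ℕ → MvPolynomial (Fin n) ℤ
  | _, 0 => 1
  | 0, _ + 1 => 0
  | K + 1, m + 1 => homogFirst n K (m + 1) + natX n K * homogFirst n (K + 1) m

@[simp] theorem homogFirst_zero (K : ℕ) : homogFirst n K 0 = 1 := by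
  cases K <;> simp [homogFirst]

@[simp] theorem homogFirst_zero_succ (m : ℕ) : homogFirst n 0 (m + 1) = 0 := by
  simp [homogFirst]

theorem homogFirst_succ_succ (K m : ℕ) : homogFirst n (K + 1) (m + 1) =
    homogFirst n K (m + 1) + natX n K * homogFirst n (K + 1) m := by
  rw [homogFirst]

theorem homogFirst_eq_rename {K : ℕ} (hK : K ≤ n) (m : ℕ) :
    homogFirst n K m = rename (Fin.castLE hK) (hsymm (Fin K) ℤ m) := by
  induction K generalizing m with
  | zero =>
    cases m with
    | zero => simp
    | succ m => simp [hsymm]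
  | succ K ihK =>
    induction m with
    | zero => simp
    | succ m ihm =>
      rw [homogFirst_succ_succ, ihm, ihK (by omega), hsymm_fin_succ, map_add, map_mul, rename_X,
        natX_of_lt (by omega), rename_rename, add_comm]
      rfl

theorem natDivDiff_natX_self_mul {k : ℕ} (hk : k < n - 1) (f : MvPolynomial (Fin n) ℤ) :
    natDivDiff k (natX n k * f) = f + natX n (k + 1) * natDivDiff k f := by
  rw [natDivDiff_of_lt hk, natDivDiff_of_lt hk, natX_of_lt (by omega), natX_of_lt (by omega)]
  have := divDiff_mul ⟨k, hk⟩ (X (leftPos ⟨k, hk⟩)) f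
  rw [divDiff_X_left, rename_X, adjSwap_leftPos, one_mul] at this
  exact this

theorem natDivDiff_one (k : ℕ) : natDivDiff k (1 : MvPolynomial (Fin n) ℤ) = 0 := by
  unfold natDivDiff
  split_ifs
  · exact divDiff_eq_zero_of_rename_eq (by simp)
  · rfl

theorem natDivDiff_homogFirst_of_le {k K : ℕ} (hk : k < n - 1) (hK : K ≤ k) (m : ℕ) :
    natDivDiff k (homogFirst n K m) = 0 := by
  induction K generalizing m with
  | zero => cases m <;> simp [natDivDiff_one]
  | succ K ihK =>
    induction m with
    | zero => simp [natDivDiff_one]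
    | succ m ihm =>
      rw [homogFirst_succ_succ, natDivDiff_add, natDivDiff_natX_mul hk (by omega) (by omega), ihm,
        ihK (by omega)]
      simp

theorem natDivDiff_homogFirst_aux {k : ℕ} (hk : k < n - 1) (m : ℕ) :
    natDivDiff k (homogFirst n (k + 1) (m + 1)) = homogFirst n (k + 2) m ∧
      natDivDiff k (homogFirst n (k + 2) m) = 0 := by
  induction m with
  | zero =>
    rw [homogFirst_succ_succ, natDivDiff_add, natDivDiff_homogFirst_of_le hk le_rfl,
      natDivDiff_natX_self_mul hk]
    simp [natDivDiff_one]
  | succ m ih =>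
    constructor
    · rw [homogFirst_succ_succ, natDivDiff_add, natDivDiff_homogFirst_of_le hk le_rfl,
        natDivDiff_natX_self_mul hk, ih.1, zero_add, ← homogFirst_succ_succ]
    · rw [homogFirst_succ_succ, natDivDiff_add, ih.1, natDivDiff_X_succ_mul hk, ih.2]
      simp

theorem natDivDiff_homogFirst_of_ge {k K : ℕ} (hk : k < n - 1) (hK : k + 2 ≤ K) (m : ℕ) :
    natDivDiff k (homogFirst n K m) = 0 := by
  induction K, hK using Nat.le_induction generalizing m with
  | base => exact (natDivDiff_homogFirst_aux hk m).2
  | succ K hK ihK =>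
    induction m with
    | zero => simp [natDivDiff_one]
    | succ m ihm =>
      rw [homogFirst_succ_succ, natDivDiff_add, natDivDiff_natX_mul hk (by omega) (by omega), ihm,
        ihK]
      simp

/-- `h_z(x_0, …, x_{K-1})` for an integer index `z`, zero for `z < 0`. -/
def homogInt (n K : ℕ) (z : ℤ) : MvPolynomial (Fin n) ℤ :=
  if z < 0 then 0 else homogFirst n K z.toNat

theorem homogInt_succ (K : ℕ) (z : ℤ) :
    homogInt n (K + 1) z = homogInt n K z + natX n K * homogInt n (K + 1) (z - 1) := by
  unfold homogInt
  rcases lt_trichotomy z 0 with h | h | h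
  · rw [if_pos h, if_pos h, if_pos (by omega)]
    simp
  · subst h
    simp
  · obtain ⟨m, rfl⟩ : ∃ m : ℕ, z = m + 1 := ⟨(z - 1).toNat, by omega⟩
    rw [if_neg (by omega), if_neg (by omega), if_neg (by omega)]
    have e1 : ((m : ℤ) + 1).toNat = m + 1 := by omega
    have e2 : ((m : ℤ) + 1 - 1).toNat = m := by omega
    rw [e1, e2, homogFirst_succ_succ]

theorem natDivDiff_homogInt {k : ℕ} (hk : k < n - 1) (z : ℤ) :
    natDivDiff k (homogInt n (k + 1) z) = homogInt n (k + 2) (z - 1) := by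
  unfold homogInt
  rcases lt_trichotomy z 0 with h | h | h
  · rw [if_pos h, if_pos (by omega), natDivDiff_zero]
  · subst h
    simp [natDivDiff_one]
  · obtain ⟨m, rfl⟩ : ∃ m : ℕ, z = m + 1 := ⟨(z - 1).toNat, by omega⟩
    rw [if_neg (by omega), if_neg (by omega)]
    have e1 : ((m : ℤ) + 1).toNat = m + 1 := by omega
    have e2 : ((m : ℤ) + 1 - 1).toNat = m := by omega
    rw [e1, e2, (natDivDiff_homogFirst_aux hk m).1]

theorem natDivDiff_homogInt_of_ne {k K : ℕ} (hk : k < n - 1) (hK : K ≠ k + 1) (z : ℤ) :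
    natDivDiff k (homogInt n K z) = 0 := by
  unfold homogInt
  split_ifs
  · simp
  · rcases Nat.lt_or_ge k K with h | h
    · exact natDivDiff_homogFirst_of_ge hk (by omega) _
    · exact natDivDiff_homogFirst_of_le hk h _

theorem constantCoeff_homogFirst (K m : ℕ) :
    constantCoeff (homogFirst n K m) = if m = 0 then 1 else 0 := by
  induction K generalizing m with
  | zero => cases m <;> simp
  | succ K ihK =>
    cases m with
    | zero => simp
    | succ m =>
      have : constantCoeff (natX n K) = 0 := by
        unfold natX
        split_ifs <;> simp
      rw [homogFirst_succ_succ, map_add, map_mul, this, ihK]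
      simp

theorem constantCoeff_homogInt (K : ℕ) (z : ℤ) :
    constantCoeff (homogInt n K z) = if z = 0 then 1 else 0 := by
  unfold homogInt
  split_ifs with h1 h2 h2
  · omega
  · simp
  · subst h2
    simp
  · rw [constantCoeff_homogFirst, if_neg (by omega)]

/-- A determinant of complete homogeneous polynomials in which the number of variables `F q`
depends on the column. -/
def flaggedDet (n r : ℕ) (F : ℕ → ℕ) (c d : ℕ → ℤ) : MvPolynomial (Fin n) ℤ :=
  Matrix.det (Matrix.of fun p q : Fin r => homogInt n (F q) (c p + d q))

/-- If only column `q₀` fails to be symmetric in `x_k, x_{k+1}`, the divided difference acts on this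
column alone: it lowers the indices by one and adds a variable. -/
theorem natDivDiff_flaggedDet {r k q₀ : ℕ} (hk : k < n - 1) (hq₀ : q₀ < r) (F : ℕ → ℕ)
    (c d : ℕ → ℤ) (hF : F q₀ = k + 1) (hF' : ∀ q < r, q ≠ q₀ → F q ≠ k + 1) :
    natDivDiff k (flaggedDet n r F c d) =
      flaggedDet n r (Function.update F q₀ (k + 2)) c (Function.update d q₀ (d q₀ - 1)) := by
  set M : Matrix (Fin r) (Fin r) (MvPolynomial (Fin n) ℤ) :=
    Matrix.of fun p q : Fin r => homogInt n (F q) (c p + d q) with hM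
  set x : MvPolynomial (Fin n) ℤ := X (leftPos ⟨k, hk⟩) - X (rightPos ⟨k, hk⟩) with hx
  set j : Fin r := ⟨q₀, hq₀⟩ with hj
  let v : Fin r → MvPolynomial (Fin n) ℤ := fun p => homogInt n (k + 2) (c p + d q₀ - 1)
  let w : Fin r → MvPolynomial (Fin n) ℤ := fun p =>
    rename (adjSwap ⟨k, hk⟩) (homogInt n (k + 1) (c p + d q₀))
  have hnew : flaggedDet n r (Function.update F q₀ (k + 2)) c (Function.update d q₀ (d q₀ - 1)) =
      (M.updateCol j v).det := by
    unfold flaggedDet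
    congr 1
    ext1 p q
    rw [Matrix.updateCol_apply]
    by_cases hq : q = j
    · subst hq
      simp [v, hj, ← add_sub_assoc]
    · have : (q : ℕ) ≠ q₀ := fun e => hq (Fin.ext e)
      simp [hq, this, hM]
  have hswap : rename (adjSwap ⟨k, hk⟩) M.det = (M.updateCol j w).det := by
    rw [AlgHom.map_det]
    congr 1
    ext1 p q
    rw [Matrix.updateCol_apply]
    by_cases hq : q = j
    · subst hq
      simp [w, hM, hj, hF]
    · have hne : (q : ℕ) ≠ q₀ := fun e => hq (Fin.ext e)
      rw [if_neg hq, AlgHom.mapMatrix_apply, Matrix.map_apply, hM, Matrix.of_apply]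
      apply rename_eq_of_divDiff_eq_zero
      rw [← natDivDiff_of_lt hk]
      exact natDivDiff_homogInt_of_ne hk (hF' q q.2 hne) _
  have hvw : M.updateCol j (x • v + w) = M := by
    have : (x • v + w) = fun p => M p j := by
      funext p
      have h1 := mul_divDiff ⟨k, hk⟩ (homogInt n (k + 1) (c p + d q₀))
      rw [← natDivDiff_of_lt hk, natDivDiff_homogInt hk] at h1
      simp only [Pi.add_apply, Pi.smul_apply, smul_eq_mul, v, w, hx, h1, hM, hj, Matrix.of_apply,
        hF]
      ring
    rw [this]
    exact Matrix.updateCol_eq_self M j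
  rw [natDivDiff_of_lt hk, hnew]
  apply divDiff_eq_of_mul
  change x * _ = M.det - rename (adjSwap ⟨k, hk⟩) M.det
  rw [hswap, ← Matrix.det_updateCol_smul]
  have := Matrix.det_updateCol_add M j (x • v) w
  rw [hvw] at this
  rw [this]
  ring

/-- Column operations by `h_m(x_0, …, x_K) = h_m(x_0, …, x_{K-1}) + x_K h_{m-1}(x_0, …, x_K)` reduce
the number of variables in column `q` of a Jacobi-Trudi determinant from `r` to `r - q`. -/
theorem flaggedDet_columns (r : ℕ) (c : ℕ → ℤ) :
    flaggedDet n r (fun _ => r) c (fun q => q) =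
      flaggedDet n r (fun q => r - q) c (fun q => q) := by
  cases r with
  | zero => rfl
  | succ r =>
    have step : ∀ s ≤ r, flaggedDet n (r + 1) (fun q => r + 1 - min q s) c (fun q => q) =
        flaggedDet n (r + 1) (fun _ => r + 1) c (fun q => q) := by
      intro s
      induction s with
      | zero => simp
      | succ s ih =>
        intro hs
        rw [← ih (by omega)]
        symm
        refine Matrix.det_eq_of_forall_col_eq_smul_add_pred
          (fun q : Fin r => if s ≤ q then natX n (r - s) else 0) (fun p => ?_) fun p q => ?_
        · simp
        · simp only [Matrix.of_apply, Fin.val_succ, Fin.val_castSucc]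
          split_ifs with hq
          · have e1 : r + 1 - min ((q : ℕ) + 1) s = r - s + 1 := by omega
            have e2 : r + 1 - min ((q : ℕ) + 1) (s + 1) = r - s := by omega
            have e3 : r + 1 - min (q : ℕ) s = r - s + 1 := by omega
            rw [e1, e2, e3, homogInt_succ]
            congr 3
            push_cast
            ring
          · have e1 : r + 1 - min ((q : ℕ) + 1) s = r + 1 - min ((q : ℕ) + 1) (s + 1) := by omega
            rw [e1, zero_mul, add_zero]
    rw [← step r le_rfl]
    unfold flaggedDet
    congr 1
    ext1 p q
    have := q.2
    simp only [Matrix.of_apply]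
    congr 1
    omega

theorem divDiffWord_flaggedDet_cons {r k q₀ : ℕ} (hk : k < n - 1) (hq₀ : q₀ < r) (ν : ℕ → ℕ)
    (hkν : r - q₀ + ν q₀ = k + 1) (hν : ∀ q < r, q ≠ q₀ → r - q + ν q ≠ k + 1) (c : ℕ → ℤ) :
    divDiff ⟨k, hk⟩ (flaggedDet n r (fun q => r - q + ν q) c (fun q => q - ν q)) =
      flaggedDet n r (fun q => r - q + Function.update ν q₀ (ν q₀ + 1) q) c
        (fun q => q - (Function.update ν q₀ (ν q₀ + 1) q : ℕ)) := by
  rw [← natDivDiff_of_lt hk, natDivDiff_flaggedDet hk hq₀ _ _ _ hkν hν]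
  congr 1
  · funext q
    by_cases hq : q = q₀
    · subst hq
      simp only [Function.update_self]
      omega
    · simp [hq]
  · funext q
    by_cases hq : q = q₀
    · subst hq
      simp only [Function.update_self]
      push_cast
      ring
    · simp [hq]

/-- The word of the Grassmannian permutation of shape `lam`: it moves the variables of the flagged
determinant column by column, the first column by `lam 0`, the second one by `lam 1` and so on. -/
theorem exists_word_flaggedDet {r : ℕ} (hr : r ≤ n) (lam : ℕ → ℕ) (hlam : Antitone lam)
    (hb : lam 0 ≤ n - r) : ∃ l : List (Fin (n - 1)),
      (∀ c, divDiffWord l (flaggedDet n r (fun q => r - q) c (fun q => q)) =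
        flaggedDet n r (fun q => r - q + lam q) c (fun q => q - lam q)) ∧
      ∀ q (hq : q < r), (wordProd l ⟨r - 1 - q, by omega⟩ : ℕ) = r - 1 - q + lam q := by
  let ν : ℕ → ℕ → ℕ → ℕ := fun Q t q => if q < Q then lam q else if q = Q then t else 0
  let Reached : (ℕ → ℕ) → Prop := fun ν => ∃ l : List (Fin (n - 1)),
      (∀ c, divDiffWord l (flaggedDet n r (fun q => r - q) c (fun q => q)) =
        flaggedDet n r (fun q => r - q + ν q) c (fun q => q - ν q)) ∧
      ∀ q (hq : q < r), (wordProd l ⟨r - 1 - q, by omega⟩ : ℕ) = r - 1 - q + ν q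
  have step : ∀ Q t, Q < r → t + 1 ≤ lam Q → Reached (ν Q t) → Reached (ν Q (t + 1)) := by
    rintro Q t hQ ht ⟨l, hl1, hl2⟩
    have hlamQ := hlam (Nat.zero_le Q)
    have hk : r - 1 - Q + t < n - 1 := by omega
    have hself : ν Q t Q = t := by simp [ν]
    have hupd : Function.update (ν Q t) Q (ν Q t Q + 1) = ν Q (t + 1) := by
      funext q
      by_cases h : q = Q
      · subst h
        simp [ν]
      · simp [ν, h]
    -- The other columns have other numbers of variables before and after the step.
    have hother : ∀ q < r, q ≠ Q → r - 1 - q + ν Q t q ≠ r - 1 - Q + t ∧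
        r - 1 - q + ν Q t q ≠ r - 1 - Q + t + 1 := by
      intro q hq hne
      simp only [ν]
      split_ifs with h1
      · have := hlam h1.le
        omega
      · omega
    refine ⟨⟨r - 1 - Q + t, hk⟩ :: l, fun c => ?_, fun q hq => ?_⟩
    · rw [divDiffWord_cons, hl1, divDiffWord_flaggedDet_cons hk hQ (ν Q t) (by omega)
        (fun q hq hne => by have := hother q hq hne; omega) c, hupd]
    · rw [wordProd_cons, Perm.mul_apply]
      have h2 := hl2 q hq
      by_cases h : q = Q
      · subst h
        have e : wordProd l ⟨r - 1 - q, by omega⟩ = leftPos ⟨r - 1 - q + t, hk⟩ :=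
          Fin.ext (by rw [h2, hself]; rfl)
        rw [e, adjSwap_leftPos]
        simp only [rightPos, ν, lt_irrefl, if_false, if_true]
        omega
      · have h3 := hother q hq h
        rw [adjSwap_of_ne, h2]
        · congr 1
          simp [ν, h]
        · intro e
          have := congrArg Fin.val e
          rw [h2] at this
          exact h3.1 this
        · intro e
          have := congrArg Fin.val e
          rw [h2] at this
          exact h3.2 this
  have main : ∀ Q ≤ r, Reached (ν Q 0) := by
    intro Q
    induction Q with
    | zero =>
      intro _
      exact ⟨[], fun c => by simp [ν], fun q hq => by simp [ν]⟩
    | succ Q ih =>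
      intro hQ
      have h1 : ∀ t ≤ lam Q, Reached (ν Q t) := by
        intro t
        induction t with
        | zero => exact fun _ => ih (by omega)
        | succ t iht => exact fun ht => step Q t hQ ht (iht (by omega))
      have : ν (Q + 1) 0 = ν Q (lam Q) := by
        funext q
        simp only [ν]
        by_cases h : q = Q
        · subst h
          simp
        · split_ifs <;> first | rfl | omega
      rw [this]
      exact h1 _ le_rfl
  obtain ⟨l, hl1, hl2⟩ := main r le_rfl
  have hν : ∀ q < r, ν r 0 q = lam q := fun q hq => by simp [ν, hq]
  refine ⟨l, fun c => ?_, fun q hq => ?_⟩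
  · rw [hl1]
    unfold flaggedDet
    congr 1
    ext1 p q
    simp only [Matrix.of_apply, hν q q.2]
  · rw [hl2 q hq, hν q hq]

theorem det_eq_of_strictAnti {r : ℕ} {a b : Fin r → ℤ} (ha : StrictAnti a) (hb : StrictAnti b) :
    Matrix.det (Matrix.of fun p q : Fin r => if a p = b q then (1 : ℤ) else 0) =
      if a = b then 1 else 0 := by
  split_ifs with hab
  · subst hab
    rw [← Matrix.det_one (n := Fin r)]
    congr 1
    ext1 p q
    rw [Matrix.of_apply, Matrix.one_apply]
    simp [ha.injective.eq_iff]
  · rw [Matrix.det_apply']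
    refine Finset.sum_eq_zero fun σ _ => mul_eq_zero_of_right _ ?_
    by_contra hne
    rw [← Ne, Finset.prod_ne_zero_iff] at hne
    have h1 : ∀ q, a (σ q) = b q := by
      intro q
      by_contra hc
      exact hne q (Finset.mem_univ q) (by simp [hc])
    have h2 : StrictMono σ := fun p q hpq => by
      have := hb hpq
      rw [← h1, ← h1] at this
      exact ha.lt_iff_gt.1 this
    have h3 : StrictMono.orderIsoOfSurjective σ h2 σ.surjective = OrderIso.refl _ :=
      Subsingleton.elim _ _
    refine hab (funext fun q => ?_)
    rw [← h1]
    exact congrArg a (congrArg (fun e => e q) h3).symm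

/-- The constant terms of the entries form a matrix with entries `0` and `1`, at most one `1` in
each row and column. As both index sequences are strictly monotone, its determinant is nonzero only
for the identity matrix. -/
theorem constantCoeff_flaggedDet {r : ℕ} (F : ℕ → ℕ) {μ lam : ℕ → ℕ} (hμ : Antitone μ)
    (hlam : Antitone lam) :
    constantCoeff (flaggedDet n r F (fun p => (μ p : ℤ) - p) (fun q => (q : ℤ) - lam q)) =
      if ∀ p < r, μ p = lam p then 1 else 0 := by
  have hanti : ∀ f : ℕ → ℕ, Antitone f → StrictAnti fun p : Fin r => (f p : ℤ) - (p : ℕ) := by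
    intro f hf p q hpq
    have h1 : (p : ℕ) < q := hpq
    have h2 := hf h1.le
    simp only
    omega
  have h := det_eq_of_strictAnti (hanti μ hμ) (hanti lam hlam)
  have h1 : ((fun p : Fin r => (μ p : ℤ) - (p : ℕ)) = fun p : Fin r => (lam p : ℤ) - (p : ℕ)) ↔
      ∀ p < r, μ p = lam p := by
    rw [funext_iff]
    constructor
    · intro h p hp
      have := h ⟨p, hp⟩
      simp only at this
      omega
    · intro h p
      rw [h p p.2]
  simp only [h1] at h
  rw [← h, flaggedDet, RingHom.map_det]
  congr 1
  ext1 p q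
  simp only [RingHom.mapMatrix_apply, Matrix.map_apply, Matrix.of_apply, constantCoeff_homogInt]
  congr 1
  apply propext
  constructor <;> intro h <;> omega

/-! ### Schur polynomials and Grassmannian permutations -/

theorem firstVars_schur {r : ℕ} (hr : r ≤ n) {μ : YoungDiagram} (hμ : μ.colLen 0 ≤ r) :
    firstVars hr (schur μ) =
      flaggedDet n r (fun _ => r) (fun p => (μ.rowLen p : ℤ) - p) (fun q => q) := by
  have h1 : restrict r (schur μ) =
      Matrix.det (Matrix.of fun p q : Fin r => hz r ((μ.rowLen p : ℤ) - (p : ℤ) + (q : ℤ))) := by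
    rw [← det_jacobiTrudi_stable r μ.rowLen _ r (fun p hp => rowLen_eq_zero le_rfl hp) hμ, schur,
      RingHom.map_det]
    congr 1
    ext1 p q
    simp [restrict_completeHomogInt]
  rw [firstVars, RingHom.comp_apply, h1, RingHom.map_det, flaggedDet]
  congr 1
  ext1 p q
  simp only [RingHom.mapMatrix_apply, Matrix.map_apply, Matrix.of_apply]
  unfold hz homogInt
  split_ifs
  · simp
  · exact (homogFirst_eq_rename hr _).symm

theorem natDivDiff_flaggedDet_of_ne {r k : ℕ} (hk : k < n - 1) (hkr : r ≠ k + 1) (c d : ℕ → ℤ) :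
    natDivDiff k (flaggedDet n r (fun _ => r) c d) = 0 := by
  rw [natDivDiff_of_lt hk]
  apply divDiff_eq_zero_of_rename_eq
  rw [flaggedDet, AlgHom.map_det]
  congr 1
  ext1 p q
  rw [AlgHom.mapMatrix_apply, Matrix.map_apply, Matrix.of_apply]
  apply rename_eq_of_divDiff_eq_zero
  rw [← natDivDiff_of_lt hk]
  exact natDivDiff_homogInt_of_ne hk hkr _

theorem divDiff_firstVars_schur {r : ℕ} (hr : r ≤ n) {μ : YoungDiagram} (hμ : μ.colLen 0 ≤ r)
    (k : Fin (n - 1)) (hk : (k : ℕ) + 1 ≠ r) : divDiff k (firstVars hr (schur μ)) = 0 := by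
  have := natDivDiff_flaggedDet_of_ne (n := n) k.2 hk.symm (fun p => (μ.rowLen p : ℤ) - p)
    (fun q => q)
  rwa [natDivDiff_of_lt k.2, ← firstVars_schur hr hμ] at this

/-- A polynomial killed by all `∂_k` except the one at `r` involves only Schubert classes of
Grassmannian permutations with descent at `r`. -/
theorem schubertCoeff_eq_zero_of_not_isGrassmannian {r : ℕ} {f : MvPolynomial (Fin n) ℤ}
    (hf : ∀ k : Fin (n - 1), (k : ℕ) + 1 ≠ r → divDiff k f = 0) {u : Perm (Fin n)}
    (hu : ¬ IsGrassmannian r u) : schubertCoeff u f = 0 := by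
  simp only [IsGrassmannian, not_forall, not_lt] at hu
  obtain ⟨k, hk, hle⟩ := hu
  exact schubertCoeff_eq_zero_of_divDiff (hf k hk)
    (lt_of_le_of_ne hle fun e => leftPos_ne_rightPos k (u.injective e).symm)

open Classical in
/-- The Grassmannian permutation of a shape in the box, together with its functional: among the
Schur polynomials with at most `r` rows it singles out the one of this shape. -/
theorem exists_grassmannianPerm {r : ℕ} (hr : r ≤ n) {lam : YoungDiagram}
    (hlam : lam ≤ rect r (n - r)) : ∃ x : Perm (Fin n), IsGrassmannian r x ∧
      (∀ q (hq : q < r), (x ⟨r - 1 - q, by omega⟩ : ℕ) = r - 1 - q + lam.rowLen q) ∧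
      ∀ μ : YoungDiagram, μ.colLen 0 ≤ r →
        schubertCoeff x (firstVars hr (schur μ)) = if μ = lam then 1 else 0 := by
  obtain ⟨h1, h2⟩ := le_rect_iff.1 hlam
  have hanti : ∀ μ : YoungDiagram, Antitone μ.rowLen := fun μ p q hpq => μ.rowLen_anti p q hpq
  obtain ⟨l, hl1, hl2⟩ := exists_word_flaggedDet hr lam.rowLen (hanti lam) h2
  have hcoeff : ∀ μ : YoungDiagram, μ.colLen 0 ≤ r →
      constantCoeff (divDiffWord l (firstVars hr (schur μ))) = if μ = lam then 1 else 0 := by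
    intro μ hμ
    rw [firstVars_schur hr hμ, flaggedDet_columns, hl1,
      constantCoeff_flaggedDet _ (hanti μ) (hanti lam)]
    refine if_congr ?_ rfl rfl
    constructor
    · intro h
      refine diagram_ext fun p => ?_
      rcases Nat.lt_or_ge p r with hp | hp
      · exact h p hp
      · rw [rowLen_eq_zero hμ hp, rowLen_eq_zero h1 hp]
    · rintro rfl p _
      rfl
  have hself := hcoeff lam h1
  rw [if_pos rfl] at hself
  obtain ⟨-, h3⟩ := divDiffWord_eq_divDiffPerm_of_ne_zero (l := l)
    (f := firstVars hr (schur lam)) (by intro e; rw [e, map_zero] at hself; exact zero_ne_one hself)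
  have hcoeff' : ∀ μ : YoungDiagram, μ.colLen 0 ≤ r →
      schubertCoeff (wordProd l) (firstVars hr (schur μ)) = if μ = lam then 1 else 0 := by
    intro μ hμ
    rw [← hcoeff μ hμ, h3]
    rfl
  refine ⟨wordProd l, ?_, hl2, hcoeff'⟩
  by_contra hc
  have := schubertCoeff_eq_zero_of_not_isGrassmannian
    (fun k hk => divDiff_firstVars_schur hr h1 k hk) hc
  rw [hcoeff' lam h1, if_pos rfl] at this
  exact one_ne_zero this

/-- The Grassmannian permutation with descent at `r` and shape `lam`, for a partition `lam` in the
rectangle `(n - r)^r`. -/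
def grassmannianPerm {r : ℕ} (hr : r ≤ n) (lam : YoungDiagram) (h : lam ≤ rect r (n - r)) :
    Perm (Fin n) := (exists_grassmannianPerm hr h).choose

theorem isGrassmannian_grassmannianPerm {r : ℕ} (hr : r ≤ n) {lam : YoungDiagram}
    (h : lam ≤ rect r (n - r)) : IsGrassmannian r (grassmannianPerm hr lam h) :=
  (exists_grassmannianPerm hr h).choose_spec.1

theorem grassmannianPerm_apply {r : ℕ} (hr : r ≤ n) {lam : YoungDiagram}
    (h : lam ≤ rect r (n - r)) {q : ℕ} (hq : q < r) :
    (grassmannianPerm hr lam h ⟨r - 1 - q, by omega⟩ : ℕ) = r - 1 - q + lam.rowLen q :=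
  (exists_grassmannianPerm hr h).choose_spec.2.1 q hq

open Classical in
theorem schubertCoeff_grassmannianPerm {r : ℕ} (hr : r ≤ n) {lam μ : YoungDiagram}
    (h : lam ≤ rect r (n - r)) (hμ : μ.colLen 0 ≤ r) :
    schubertCoeff (grassmannianPerm hr lam h) (firstVars hr (schur μ)) =
      if μ = lam then 1 else 0 :=
  (exists_grassmannianPerm hr h).choose_spec.2.2 μ hμ

/-- Every permutation without descents except at `r` comes from a shape in the box, with parts `u_p
- p` for `p < r`, in reverse order. -/
theorem IsGrassmannian.exists_eq {r : ℕ} (hr : r ≤ n) {u : Perm (Fin n)}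
    (hu : IsGrassmannian r u) : ∃ (lam : YoungDiagram) (h : lam ≤ rect r (n - r)),
      u = grassmannianPerm hr lam h := by
  have hstep : ∀ p (hp : p + 1 < r), (u ⟨p, by omega⟩ : ℕ) < u ⟨p + 1, by omega⟩ := by
    intro p hp
    exact Fin.lt_def.1 (hu.lt (Fin.lt_def.2 (Nat.lt_succ_self p)) (Or.inl hp))
  have hge : ∀ p (hp : p < r), p ≤ u ⟨p, by omega⟩ := by
    intro p
    induction p with
    | zero => exact fun _ => Nat.zero_le _
    | succ p ih =>
      intro hp
      have := hstep p hp
      have := ih (by omega)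
      omega
  let f : ℕ → ℕ := fun q => if hq : q < r then (u ⟨r - 1 - q, by omega⟩ : ℕ) - (r - 1 - q) else 0
  have hf : Antitone f := by
    refine antitone_nat_of_succ_le fun q => ?_
    simp only [f]
    by_cases hq : q + 1 < r
    · rw [dif_pos hq, dif_pos (by omega)]
      have h1 := hstep (r - 1 - (q + 1)) (by omega)
      have h2 := hge (r - 1 - (q + 1)) (by omega)
      have e : r - 1 - (q + 1) + 1 = r - 1 - q := by omega
      simp only [e] at h1
      omega
    · rw [dif_neg hq]
      exact Nat.zero_le _
  have hlam : diagramOf r f hf ≤ rect r (n - r) := by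
    rw [le_rect_iff, colLen_le_iff, rowLen_diagramOf, rowLen_diagramOf, if_neg (lt_irrefl r)]
    refine ⟨rfl, ?_⟩
    split_ifs with h0
    · simp only [f]
      rw [dif_pos h0]
      have := (u ⟨r - 1 - 0, by omega⟩).2
      omega
    · exact Nat.zero_le _
  refine ⟨_, hlam, hu.ext (isGrassmannian_grassmannianPerm hr hlam) fun p hp => Fin.ext ?_⟩
  have h1 := grassmannianPerm_apply hr hlam (q := r - 1 - p) (by omega)
  have e : r - 1 - (r - 1 - p) = p := by omega
  have h2 := hge p hp
  simp only [e] at h1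
  rw [h1, rowLen_diagramOf, if_pos (by omega)]
  simp only [f]
  rw [dif_pos (by omega)]
  simp only [e]
  change p ≤ (u p : ℕ) at h2
  change (u p : ℕ) = p + ((u p : ℕ) - p)
  omega

theorem grassmannianPerm_injective {r : ℕ} (hr : r ≤ n) {lam μ : YoungDiagram}
    (h : lam ≤ rect r (n - r)) (h' : μ ≤ rect r (n - r))
    (e : grassmannianPerm hr lam h = grassmannianPerm hr μ h') : lam = μ := by
  classical
  have h1 := schubertCoeff_grassmannianPerm hr h (le_rect_iff.1 h).1
  rw [e, schubertCoeff_grassmannianPerm hr h' (le_rect_iff.1 h).1, if_pos rfl] at h1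
  by_contra hne
  rw [if_neg hne] at h1
  exact zero_ne_one h1

/-- Schur polynomials represent the Schubert classes of Grassmannian permutations. -/
theorem schubertCoeff_schur {r : ℕ} (hr : r ≤ n) {μ : YoungDiagram} (hμ : μ ≤ rect r (n - r))
    (u : Perm (Fin n)) : schubertCoeff u (firstVars hr (schur μ)) =
      if u = grassmannianPerm hr μ hμ then 1 else 0 := by
  classical
  by_cases hu : IsGrassmannian r u
  · obtain ⟨lam, hlam, rfl⟩ := hu.exists_eq hr
    rw [schubertCoeff_grassmannianPerm hr hlam (le_rect_iff.1 hμ).1]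
    refine if_congr ?_ rfl rfl
    constructor
    · rintro rfl
      rfl
    · exact fun e => (grassmannianPerm_injective hr hlam hμ e).symm
  · rw [if_neg fun e => hu (by rw [e]; exact isGrassmannian_grassmannianPerm hr hμ)]
    exact schubertCoeff_eq_zero_of_not_isGrassmannian
      (fun k hk => divDiff_firstVars_schur hr (le_rect_iff.1 hμ).1 k hk) hu

end Flagged

section FlagIdeal

variable {n : ℕ}

/-! ### Schubert polynomials of Grassmannian permutations -/

theorem degreeOf_homogFirst_le (p : Fin n) (K m : ℕ) :
    degreeOf p (homogFirst n K m) ≤ if (p : ℕ) < K then m else 0 := by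
  induction K generalizing m with
  | zero => cases m <;> simp
  | succ K ihK =>
    induction m with
    | zero => simp
    | succ m ihm =>
      rw [homogFirst_succ_succ]
      refine (degreeOf_add_le _ _ _).trans (max_le ((ihK _).trans ?_) ?_)
      · split_ifs <;> omega
      · have hX : degreeOf p (natX n K) ≤ if (p : ℕ) = K then 1 else 0 := by
          unfold natX
          split_ifs with h1 h2 h2
          · subst h2
            simp
          · rw [degreeOf_X, if_neg (fun e => h2 (by rw [e]))]
          · simp
          · simp
        refine (degreeOf_mul_le _ _ _).trans ((add_le_add hX ihm).trans ?_)
        split_ifs <;> omega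

theorem degreeOf_homogInt_le (p : Fin n) (K : ℕ) (z : ℤ) :
    degreeOf p (homogInt n K z) ≤ if (p : ℕ) < K then z.toNat else 0 := by
  unfold homogInt
  split_ifs with h1 h2 h2
  · simp
  · simp
  · simpa [h2] using degreeOf_homogFirst_le p K z.toNat
  · simpa [h2] using degreeOf_homogFirst_le p K z.toNat

theorem degreeOf_det_le {r : ℕ} (p : Fin n) (M : Matrix (Fin r) (Fin r) (MvPolynomial (Fin n) ℤ))
    (B : Fin r → ℕ) (hB : ∀ x y, degreeOf p (M x y) ≤ B y) : degreeOf p M.det ≤ ∑ y, B y := by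
  rw [Matrix.det_apply']
  refine (degreeOf_sum_le _ _ _).trans (Finset.sup_le fun σ _ => ?_)
  have h1 : (((Perm.sign σ : ℤˣ) : ℤ) : MvPolynomial (Fin n) ℤ) = C ((Perm.sign σ : ℤˣ) : ℤ) := by
    simp
  rw [h1]
  refine (degreeOf_C_mul_le _ _ _).trans ?_
  refine (degreeOf_prod_le _ _ _).trans (Finset.sum_le_sum fun y _ => hB _ _)

theorem degreeOf_restrict_eq {r : ℕ} (f : SymmFun) (p q : Fin r) :
    degreeOf p (restrict r f) = degreeOf q (restrict r f) := by
  have h : rename (swap p q) (restrict r f) = restrict r f := f.2.1 r (swap p q)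
  conv_lhs => rw [← degreeOf_rename_of_injective (swap p q).injective, h, swap_apply_left]

/-- The last of the `r` variables occurs, after the column operations of `flaggedDet_columns`, only
in the first column of the Jacobi-Trudi determinant. By symmetry no variable has a larger degree. -/
theorem staircaseBounded_firstVars_schur {r : ℕ} (hr : r ≤ n) {μ : YoungDiagram}
    (hμ : μ ≤ rect r (n - r)) : StaircaseBounded (firstVars hr (schur μ)) := by
  obtain ⟨h1, h2⟩ := le_rect_iff.1 hμ
  intro p
  rcases Nat.lt_or_ge p r with hp | hp
  · have hr0 : 0 < r := by omega
    have e : degreeOf p (firstVars hr (schur μ)) =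
        degreeOf (⟨r - 1, by omega⟩ : Fin n) (firstVars hr (schur μ)) := by
      have hinj : Function.Injective (Fin.castLE hr) := Fin.castLE_injective hr
      have := degreeOf_restrict_eq (schur μ) (⟨p, hp⟩ : Fin r) ⟨r - 1, by omega⟩
      rw [← degreeOf_rename_of_injective hinj, ← degreeOf_rename_of_injective hinj] at this
      exact this
    rw [e, firstVars_schur hr h1, flaggedDet_columns]
    have hle : ∀ x, μ.rowLen x ≤ n - r := fun x => (μ.rowLen_anti 0 x (Nat.zero_le x)).trans h2
    refine (degreeOf_det_le _ _ (fun y => if (y : ℕ) = 0 then n - r else 0)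
      fun x y => (degreeOf_homogInt_le _ _ _).trans ?_).trans ?_
    · have := hle x
      simp only
      split_ifs <;> omega
    · have : ∀ y : Fin r, (if (y : ℕ) = 0 then n - r else 0) =
          if y = ⟨0, hr0⟩ then n - r else 0 := fun y => if_congr (by simp [Fin.ext_iff]) rfl rfl
      simp only [this, Finset.sum_ite_eq', Finset.mem_univ, if_true]
      omega
  · rw [firstVars_schur hr h1]
    refine (degreeOf_det_le _ _ (fun _ => 0)
      fun x y => (degreeOf_homogInt_le _ _ _).trans ?_).trans (by simp)
    rw [if_neg (not_lt.2 hp)]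

/-- An equality of polynomials, not only of classes: both sides are bounded by the staircase and
have the same coefficients. -/
theorem schubert_grassmannianPerm {r : ℕ} (hr : r ≤ n) {μ : YoungDiagram}
    (hμ : μ ≤ rect r (n - r)) : schubert (grassmannianPerm hr μ hμ) = firstVars hr (schur μ) := by
  rw [← sub_eq_zero]
  apply eq_zero_of_staircaseBounded
  · intro p
    refine (degreeOf_sub_le _ _ _).trans (max_le ?_ ?_)
    · exact staircaseBounded_schubert _ p
    · exact staircaseBounded_firstVars_schur hr hμ p
  · intro u
    rw [← schubertCoeffHom_apply, map_sub, schubertCoeffHom_apply, schubertCoeffHom_apply,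
      schubertCoeff_schur hr hμ, schubertCoeff_schubert, sub_self]

theorem rect_le_iff {j i : ℕ} (hj : 0 < j) {μ : YoungDiagram} :
    rect j i ≤ μ ↔ i ≤ μ.rowLen (j - 1) := by
  rw [le_iff_rowLen_le]
  constructor
  · intro h
    have := h (j - 1)
    rwa [rowLen_rect, if_pos (by omega)] at this
  · intro h p
    rw [rowLen_rect]
    split_ifs with hp
    · exact h.trans (μ.rowLen_anti p (j - 1) (by omega))
    · exact Nat.zero_le _

theorem crossCount_le (r s : ℕ) (hr : r ≤ n) (u : Perm (Fin n)) : crossCount r s u ≤ r := by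
  have := card_filter_Ico (n := n) (a := 0) hr
  rw [Nat.sub_zero] at this
  conv_rhs => rw [← this]
  exact Finset.card_le_card fun x hx => by
    simp only [Finset.mem_filter, Finset.mem_univ, true_and] at hx ⊢
    exact ⟨Nat.zero_le _, hx.1⟩

theorem IsGrassmannian.le_crossCount_iff {r s j : ℕ} {u : Perm (Fin n)} (hu : IsGrassmannian r u)
    (hr : r ≤ n) (hj : 0 < j) (hjr : j ≤ r) :
    j ≤ crossCount r s u ↔ s ≤ (u ⟨r - j, by omega⟩ : ℕ) := by
  have hc := crossCount_le r s hr u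
  have h := Finset.ext_iff.1 (hu.filter_eq hr hc) ⟨r - j, by omega⟩
  simp only [Finset.mem_filter, Finset.mem_univ, true_and] at h
  have : r - j < r := by omega
  simp only [this, true_and, and_true] at h
  rw [h]
  omega

/-- The Bruhat condition `v ≤ u` for Grassmannian `u` is containment of a rectangle in its shape. -/
theorem le_crossCount_grassmannianPerm_iff {r s t : ℕ} (hr : r ≤ n) (ht : 1 ≤ t) (htr : t ≤ r)
    {μ : YoungDiagram} (hμ : μ ≤ rect r (n - r)) :
    r - t + 1 ≤ crossCount r s (grassmannianPerm hr μ hμ) ↔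
      rect (r - t + 1) (s - t + 1) ≤ μ ∨ s + 1 ≤ t := by
  rw [(isGrassmannian_grassmannianPerm hr hμ).le_crossCount_iff hr (by omega) (by omega),
    rect_le_iff (by omega)]
  have h := grassmannianPerm_apply hr hμ (q := r - t) (by omega)
  have e1 : r - 1 - (r - t) = r - (r - t + 1) := by omega
  simp only [e1] at h
  rw [h, show r - t + 1 - 1 = r - t by omega]
  omega

theorem IsBigrassmannian.eq_grassmannianPerm {r s t : ℕ} {v : Perm (Fin n)}
    (hv : IsBigrassmannian r s t v) (ht : 1 ≤ t) (htr : t ≤ r) (hts : t ≤ s) (hr : r ≤ n)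
    (hbox : rect (r - t + 1) (s - t + 1) ≤ rect r (n - r)) :
    v = grassmannianPerm hr (rect (r - t + 1) (s - t + 1)) hbox := by
  have hG := isGrassmannian_of_descents hv.1
  refine hG.ext (isGrassmannian_grassmannianPerm hr hbox) fun p hp => Fin.ext ?_
  have hc := hv.crossCount_eq htr hr
  rw [hG.apply_eq (isGrassmannian_of_descents hv.2.1) hr (crossCount_le r s hr v) hp, hc]
  have h := grassmannianPerm_apply hr hbox (q := r - 1 - p) (by omega)
  have e : r - 1 - (r - 1 - (p : ℕ)) = p := by omega
  simp only [e] at h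
  rw [h, rowLen_rect]
  split_ifs <;> omega

/-! ### The ideal spanned by the Schubert classes above a bigrassmannian permutation -/

theorem mul_swap_mem_of_crossCount_lt {r s j : ℕ} {u : Perm (Fin n)} (hu : crossCount r s u < j)
    (p q : Fin n) (hpq : p < q) (h : u q < u p) : crossCount r s (u * swap p q) < j :=
  (crossCount_mul_swap_le r s hpq h).trans_lt hu

theorem crossCount_mul_adjSwap {r s : ℕ} {k : Fin (n - 1)} (hk : (k : ℕ) + 1 ≠ r)
    (u : Perm (Fin n)) : crossCount r s (u * adjSwap k) = crossCount r s u := by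
  obtain ⟨K, h1, h2⟩ := crossCount_mul_swap r s u (leftPos_ne_rightPos k)
  change crossCount r s (u * swap _ _) = _
  rw [h1, h2]
  have e1 : ((leftPos k : Fin n) : ℕ) = k := rfl
  have e2 : ((rightPos k : Fin n) : ℕ) = k + 1 := rfl
  rw [e1, e2]
  split_ifs <;> omega

/-- The span `J_v`, described by the vanishing of coefficients. -/
theorem mk_mem_schubertSpan_iff {v : Perm (Fin n)} {f : MvPolynomial (Fin n) ℤ} :
    Ideal.Quotient.mk (coinvIdeal n) f ∈ schubertSpan v ↔ f ∈ avoiding {u | ¬ BruhatLE v u} := by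
  constructor
  · intro h u hu
    have key : ∀ x ∈ schubertSpan v, ∀ f, Ideal.Quotient.mk (coinvIdeal n) f = x →
        schubertCoeff u f = 0 := by
      intro x hx
      induction hx using Submodule.span_induction with
      | mem x hx =>
        obtain ⟨w, hw, rfl⟩ := hx
        intro f hf
        have h1 := mem_coinvIdeal_iff.1 (Ideal.Quotient.eq.1 hf) u
        rw [← schubertCoeffHom_apply, map_sub, sub_eq_zero] at h1
        rw [← schubertCoeffHom_apply, h1, schubertCoeffHom_apply, schubertCoeff_schubert, if_neg]
        rintro rfl
        exact hu hw
      | zero => exact fun f hf => (mk_eq_zero_iff f).1 hf u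
      | add x y _ _ hx hy =>
        intro f hf
        obtain ⟨g, rfl⟩ := Ideal.Quotient.mk_surjective x
        have h1 := hy (f - g) (by rw [map_sub, hf, add_sub_cancel_left])
        rw [← schubertCoeffHom_apply, map_sub, schubertCoeffHom_apply, schubertCoeffHom_apply,
          hx g rfl, sub_zero] at h1
        exact h1
      | smul a x _ hx =>
        intro f hf
        obtain ⟨g, rfl⟩ := Ideal.Quotient.mk_surjective x
        rw [← map_zsmul] at hf
        have h1 := mem_coinvIdeal_iff.1 (Ideal.Quotient.eq.1 hf) u
        rw [← schubertCoeffHom_apply, map_sub, map_zsmul, schubertCoeffHom_apply,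
          schubertCoeffHom_apply, hx g rfl, smul_zero, sub_zero] at h1
        exact h1
    exact key _ h f rfl
  · intro h
    rw [mk_eq_sum_schubertClass]
    refine Submodule.sum_mem _ fun u _ => ?_
    by_cases hu : BruhatLE v u
    · exact Submodule.smul_mem _ _ (Submodule.subset_span ⟨u, hu, rfl⟩)
    · rw [h u hu, zero_smul]
      exact Submodule.zero_mem _

/-- The polynomials in `J` which are killed by the divided differences `∂_k` for `k < b`. -/
def invariantsBelow (J : AddSubgroup (MvPolynomial (Fin n) ℤ)) (b : ℕ) :
    AddSubgroup (MvPolynomial (Fin n) ℤ) where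
  carrier := {g | g ∈ J ∧ ∀ k, k < b → natDivDiff k g = 0}
  zero_mem' := ⟨zero_mem _, fun k _ => natDivDiff_zero k⟩
  add_mem' {f g} hf hg := ⟨add_mem hf.1 hg.1, fun k hk => by
    rw [natDivDiff_add, hf.2 k hk, hg.2 k hk, add_zero]⟩
  neg_mem' {f} hf := ⟨neg_mem hf.1, fun k hk => by
    have := natDivDiff_add k f (-f)
    rwa [add_neg_cancel, natDivDiff_zero, hf.2 k hk, zero_add, eq_comm] at this⟩

/-- A polynomial which is killed by all `∂_k` except the one at `r` is, modulo symmetric functions,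
a combination of Schur polynomials. -/
theorem mk_mem_span_of_invariant {r : ℕ} (hr : r ≤ n) {g : MvPolynomial (Fin n) ℤ}
    (hg : ∀ k : Fin (n - 1), (k : ℕ) + 1 ≠ r → divDiff k g = 0) (P : YoungDiagram → Prop)
    (hP : ∀ (μ : YoungDiagram) (hμ : μ ≤ rect r (n - r)), ¬ P μ →
      schubertCoeff (grassmannianPerm hr μ hμ) g = 0) :
    Ideal.Quotient.mk (coinvIdeal n) g ∈ Submodule.span ℤ
      (toCoinv hr '' (schur '' {μ | P μ ∧ μ ≤ rect r (n - r)})) := by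
  rw [mk_eq_sum_schubertClass]
  refine Submodule.sum_mem _ fun u _ => ?_
  by_cases hu : IsGrassmannian r u
  · obtain ⟨μ, hμ, rfl⟩ := hu.exists_eq hr
    by_cases hPμ : P μ
    · refine Submodule.smul_mem _ _ (Submodule.subset_span ⟨schur μ, ⟨μ, ⟨hPμ, hμ⟩, rfl⟩, ?_⟩)
      rw [schubertClass, schubert_grassmannianPerm]
      rfl
    · rw [hP μ hμ hPμ, zero_smul]
      exact Submodule.zero_mem _
  · rw [schubertCoeff_eq_zero_of_not_isGrassmannian hg hu, zero_smul]
    exact Submodule.zero_mem _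

/-- `J_v` is generated by the Schur polynomials whose shapes contain the rectangle. -/
theorem mk_mem_span_schur_of_avoiding {r s t : ℕ} (hr : r ≤ n) (ht : 1 ≤ t) (htr : t ≤ r)
    (hts : t ≤ s) {f : MvPolynomial (Fin n) ℤ}
    (hf : f ∈ avoiding {u | crossCount r s u < r - t + 1}) :
    Ideal.Quotient.mk (coinvIdeal n) f ∈ Ideal.span (toCoinv hr ''
      (schur '' {μ | rect (r - t + 1) (s - t + 1) ≤ μ ∧ μ ≤ rect r (n - r)})) := by
  set S : Set (Perm (Fin n)) := {u | crossCount r s u < r - t + 1} with hS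
  set T := Ideal.span (toCoinv hr ''
      (schur '' {μ | rect (r - t + 1) (s - t + 1) ≤ μ ∧ μ ≤ rect r (n - r)})) with hT
  have hdown : ∀ u ∈ S, ∀ p q, p < q → u q < u p → u * swap p q ∈ S :=
    fun u hu p q hpq h => mul_swap_mem_of_crossCount_lt hu p q hpq h
  have hD : ∀ k, k + 1 ≠ r → ∀ f ∈ avoiding S, natDivDiff k f ∈ avoiding S := by
    intro k hk f hf
    unfold natDivDiff
    split_ifs with h
    · refine divDiff_mem_avoiding (fun u hu => ?_) hf
      change crossCount r s _ < _
      rw [crossCount_mul_adjSwap hk]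
      exact hu
    · exact zero_mem _
  have h1 := mem_span_invariants (avoiding S) 0 (r - 1) (by omega)
    (fun x _ _ f hf => natX_mul_mem_avoiding hdown x hf) (fun k _ hk => hD k (by omega)) hf
  suffices h : Ideal.span {g | g ∈ avoiding S ∧ ∀ k, 0 ≤ k → k < r - 1 → natDivDiff k g = 0} ≤
      T.comap (Ideal.Quotient.mk (coinvIdeal n)) from h h1
  rw [Ideal.span_le]
  rintro g ⟨hg1, hg2⟩
  have h2 := mem_span_invariants (invariantsBelow (avoiding S) (r - 1)) r (n - 1) (by omega)
    (f := g) (fun x hx hx' f hf => ⟨natX_mul_mem_avoiding hdown x hf.1, fun k hk => by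
      rw [natDivDiff_natX_mul (by omega) (by omega) (by omega), hf.2 k hk, mul_zero]⟩)
    (fun k hk hk' f hf => ⟨hD k (by omega) f hf.1, fun l hl => by
      rw [natDivDiff_comm (by omega), hf.2 l hl, natDivDiff_zero]⟩)
    ⟨hg1, fun k hk => hg2 k (Nat.zero_le k) hk⟩
  suffices h : Ideal.span {g | g ∈ invariantsBelow (avoiding S) (r - 1) ∧
      ∀ k, r ≤ k → k < n - 1 → natDivDiff k g = 0} ≤
      T.comap (Ideal.Quotient.mk (coinvIdeal n)) from h h2
  rw [Ideal.span_le]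
  rintro g ⟨⟨hg1, hg2⟩, hg3⟩
  have h3 := mk_mem_span_of_invariant hr (g := g) (fun k hk => by
    rw [← natDivDiff_of_lt k.2]
    rcases Nat.lt_or_ge k (r - 1) with h | h
    · exact hg2 k h
    · exact hg3 k (by omega) k.2)
    (fun μ => rect (r - t + 1) (s - t + 1) ≤ μ) (fun μ hμ hn => by
      refine hg1 _ ?_
      change crossCount r s _ < r - t + 1
      rw [← not_le, le_crossCount_grassmannianPerm_iff hr ht htr]
      rintro (h | h)
      · exact hn h
      · omega)
  exact Submodule.span_subset_span ℤ (Coinv n) _ h3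

end FlagIdeal

/-! ### Schur functions span the ring of symmetric functions -/

section Alternants

/-- The Vandermonde determinant in `N` variables. -/
def vandermonde (N : ℕ) : MvPolynomial (Fin N) ℤ :=
  Matrix.det (Matrix.of fun p q : Fin N => (X q : MvPolynomial (Fin N) ℤ) ^ (N - 1 - (p : ℕ)))

/-- The exponent vector of the leading term of the alternant attached to `μ`. -/
def alternantExp (N : ℕ) (μ : YoungDiagram) : Fin N →₀ ℕ :=
  Finsupp.equivFunOnFinite.symm fun p => μ.rowLen p + (N - 1 - (p : ℕ))

theorem alternantExp_apply (N : ℕ) (μ : YoungDiagram) (p : Fin N) :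
    alternantExp N μ p = μ.rowLen p + (N - 1 - (p : ℕ)) := rfl

theorem strictAnti_alternantExp (N : ℕ) (μ : YoungDiagram) : StrictAnti (alternantExp N μ) := by
  intro p q hpq
  have h1 : (p : ℕ) < q := hpq
  have h2 := μ.rowLen_anti p q h1.le
  rw [alternantExp_apply, alternantExp_apply]
  omega

theorem coeff_alternant {N : ℕ} (α : Fin N → ℕ) (β : Fin N →₀ ℕ) :
    coeff β (Matrix.det (Matrix.of fun p q : Fin N => (X q : MvPolynomial (Fin N) ℤ) ^ α p)) =
      Matrix.det (Matrix.of fun p q : Fin N => if (α p : ℤ) = (β q : ℤ) then (1 : ℤ) else 0) := by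
  rw [Matrix.det_apply', Matrix.det_apply', coeff_sum]
  refine Finset.sum_congr rfl fun σ _ => ?_
  have h1 : (((Perm.sign σ : ℤˣ) : ℤ) : MvPolynomial (Fin N) ℤ) = C ((Perm.sign σ : ℤˣ) : ℤ) := by
    simp
  have h2 : ∏ q, Matrix.of (fun p q : Fin N => (X q : MvPolynomial (Fin N) ℤ) ^ α p) (σ q) q =
      monomial (Finsupp.equivFunOnFinite.symm fun q => α (σ q)) 1 := by
    rw [monomial_eq, Finsupp.prod_fintype _ _ (fun _ => pow_zero _)]
    simp
  rw [h1, coeff_C_mul, h2, coeff_monomial]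
  congr 1
  simp only [Matrix.of_apply, Nat.cast_inj]
  by_cases h : ∀ q, α (σ q) = β q
  · rw [if_pos (Finsupp.ext h), Finset.prod_eq_one fun q _ => if_pos (h q)]
  · obtain ⟨q, hq⟩ := not_forall.1 h
    rw [if_neg fun e => hq (DFunLike.congr_fun e q),
      Finset.prod_eq_zero (Finset.mem_univ q) (if_neg hq)]

theorem coeff_alternant_of_strictAnti {N : ℕ} {α : Fin N → ℕ} {β : Fin N →₀ ℕ} (hα : StrictAnti α)
    (hβ : StrictAnti β) :
    coeff β (Matrix.det (Matrix.of fun p q : Fin N => (X q : MvPolynomial (Fin N) ℤ) ^ α p)) =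
      if α = β then 1 else 0 := by
  rw [coeff_alternant]
  have := det_eq_of_strictAnti (a := fun p => (α p : ℤ)) (b := fun p => (β p : ℤ))
    (fun p q h => by simpa using hα h) (fun p q h => by simpa using hβ h)
  rw [this]
  refine if_congr ?_ rfl rfl
  rw [funext_iff, funext_iff]
  simp

theorem rename_vandermonde {N : ℕ} (σ : Perm (Fin N)) :
    rename σ (vandermonde N) = C ((Perm.sign σ : ℤˣ) : ℤ) * vandermonde N := by
  rw [vandermonde, AlgHom.map_det]
  have := Matrix.det_permute' σ
    (Matrix.of fun p q : Fin N => (X q : MvPolynomial (Fin N) ℤ) ^ (N - 1 - (p : ℕ)))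
  have h1 : (((Perm.sign σ : ℤˣ) : ℤ) : MvPolynomial (Fin N) ℤ) = C ((Perm.sign σ : ℤˣ) : ℤ) := by
    simp
  rw [← h1, ← this]
  congr 1
  ext1 p q
  simp

theorem vandermonde_ne_zero (N : ℕ) : vandermonde N ≠ 0 := by
  intro h
  have h1 := coeff_alternant_of_strictAnti (strictAnti_alternantExp N (rect 0 0))
    (strictAnti_alternantExp N (rect 0 0))
  have h2 : (Matrix.of fun p q : Fin N =>
      (X q : MvPolynomial (Fin N) ℤ) ^ alternantExp N (rect 0 0) p) =
      Matrix.of fun p q : Fin N => (X q : MvPolynomial (Fin N) ℤ) ^ (N - 1 - (p : ℕ)) := by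
    ext1 p q
    simp [alternantExp_apply, rowLen_rect]
  rw [h2, if_pos rfl] at h1
  change coeff _ (vandermonde N) = _ at h1
  rw [h, coeff_zero] at h1
  exact zero_ne_one h1

theorem totalDegree_vandermonde_le (N : ℕ) :
    (vandermonde N).totalDegree ≤ ∑ p : Fin N, (N - 1 - (p : ℕ)) := by
  rw [vandermonde, Matrix.det_apply']
  refine totalDegree_finsetSum_le fun σ _ => ?_
  have h1 : (((Perm.sign σ : ℤˣ) : ℤ) : MvPolynomial (Fin N) ℤ) = C ((Perm.sign σ : ℤˣ) : ℤ) := by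
    simp
  rw [h1]
  refine (totalDegree_mul _ _).trans ?_
  rw [totalDegree_C, zero_add]
  refine (totalDegree_finsetProd _ _).trans ?_
  rw [← Equiv.sum_comp σ fun p : Fin N => N - 1 - (p : ℕ)]
  refine Finset.sum_le_sum fun q _ => ?_
  rw [Matrix.of_apply]
  refine (totalDegree_pow _ _).trans ?_
  simp

/-- An alternating polynomial is determined by its coefficients at strictly decreasing exponents. -/
theorem eq_zero_of_coeff_mul_vandermonde {N : ℕ} {g : MvPolynomial (Fin N) ℤ} (hg : g.IsSymmetric)
    (h : ∀ β : Fin N →₀ ℕ, StrictAnti β → coeff β (g * vandermonde N) = 0) : g = 0 := by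
  have hperm : ∀ (σ : Perm (Fin N)) (β : Fin N →₀ ℕ), coeff β (g * vandermonde N) =
      (Perm.sign σ : ℤ) * coeff (β.mapDomain σ) (g * vandermonde N) := by
    intro σ β
    rw [← coeff_rename_mapDomain σ σ.injective, map_mul, hg σ, rename_vandermonde, mul_left_comm,
      coeff_C_mul]
  have h0 : g * vandermonde N = 0 := by
    ext β
    rw [coeff_zero]
    by_cases hβ : Function.Injective β
    · set τ := Tuple.sort fun p => OrderDual.toDual (β p) with hτ
      have hmono := Tuple.monotone_sort fun p => OrderDual.toDual (β p)
      rw [hperm τ⁻¹ β, h, mul_zero]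
      have hanti : Antitone (β.mapDomain (τ⁻¹ : Perm (Fin N))) := by
        intro p q hpq
        have h1 := hmono hpq
        simp only [Function.comp_apply, OrderDual.toDual_le_toDual] at h1
        rw [Finsupp.mapDomain_equiv_apply, Finsupp.mapDomain_equiv_apply]
        exact h1
      refine hanti.strictAnti_of_injective fun p q hpq => ?_
      rw [Finsupp.mapDomain_equiv_apply, Finsupp.mapDomain_equiv_apply] at hpq
      exact (Equiv.injective _) (hβ hpq)
    · simp only [Function.Injective, not_forall] at hβ
      obtain ⟨p, q, hpq, hne⟩ := hβ
      have h1 := hperm (swap p q) β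
      have h2 : β.mapDomain (swap p q) = β := by
        ext x
        rw [Finsupp.mapDomain_equiv_apply, symm_swap]
        rcases eq_or_ne x p with rfl | hxp
        · rw [swap_apply_left, hpq]
        rcases eq_or_ne x q with rfl | hxq
        · rw [swap_apply_right, hpq]
        · rw [swap_apply_of_ne_of_ne hxp hxq]
      rw [h2, Perm.sign_swap hne] at h1
      simp only [Units.val_neg, Units.val_one] at h1
      omega
  exact (mul_eq_zero.1 h0).resolve_right (vandermonde_ne_zero N)

theorem coeff_restrict_schur {N : ℕ} {μ : YoungDiagram} (hμ : μ.colLen 0 ≤ N) {β : Fin N →₀ ℕ}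
    (hβ : StrictAnti β) :
    coeff β (restrict N (schur μ) * vandermonde N) = if alternantExp N μ = β then 1 else 0 := by
  have h := coeff_alternant_of_strictAnti (strictAnti_alternantExp N μ) hβ
  have h1 : restrict N (schur μ) * vandermonde N = _ := restrict_schur_mul_vandermonde μ N hμ
  rw [h1]
  refine h.trans (if_congr ?_ rfl rfl)
  rw [DFunLike.coe_fn_eq]

theorem alternantExp_injOn {N : ℕ} {μ ν : YoungDiagram} (hμ : μ.colLen 0 ≤ N)
    (hν : ν.colLen 0 ≤ N) (h : alternantExp N μ = alternantExp N ν) : μ = ν := by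
  refine diagram_ext fun p => ?_
  rcases Nat.lt_or_ge p N with hp | hp
  · have := DFunLike.congr_fun h ⟨p, hp⟩
    rw [alternantExp_apply, alternantExp_apply] at this
    exact Nat.add_right_cancel this
  · rw [rowLen_eq_zero hμ hp, rowLen_eq_zero hν hp]

theorem exists_alternantExp {N : ℕ} {β : Fin N →₀ ℕ} (hβ : StrictAnti β) :
    ∃ μ : YoungDiagram, μ.colLen 0 ≤ N ∧ alternantExp N μ = β := by
  let f : ℕ → ℕ := fun p => if h : p < N then β ⟨p, h⟩ - (N - 1 - p) else 0
  have hstep : ∀ p (hp : p + 1 < N), β ⟨p + 1, hp⟩ < β ⟨p, by omega⟩ := fun p hp =>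
    hβ (Fin.lt_def.2 (Nat.lt_succ_self p))
  have hge : ∀ d p (hp : p < N), p + d = N - 1 → d ≤ β ⟨p, hp⟩ := by
    intro d
    induction d with
    | zero => exact fun _ _ _ => Nat.zero_le _
    | succ d ih =>
      intro p hp h
      have h1 := ih (p + 1) (by omega) (by omega)
      have h2 := hstep p (by omega)
      omega
  have hf : Antitone f := by
    refine antitone_nat_of_succ_le fun p => ?_
    simp only [f]
    by_cases hp : p + 1 < N
    · rw [dif_pos hp, dif_pos (by omega)]
      have := hstep p hp
      omega
    · rw [dif_neg hp]
      exact Nat.zero_le _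
  refine ⟨diagramOf N f hf, ?_, ?_⟩
  · rw [colLen_le_iff, rowLen_diagramOf, if_neg (lt_irrefl N)]
  · ext p
    rw [alternantExp_apply, rowLen_diagramOf, if_pos p.2]
    simp only [f]
    rw [dif_pos p.2]
    have := hge (N - 1 - p) p p.2 (by omega)
    change (β p - _) + _ = β p
    change _ ≤ β p at this
    omega

theorem le_rect_of_coeff_ne_zero {N d : ℕ} (hN : d ≤ N) {g : MvPolynomial (Fin N) ℤ}
    (hg : g.totalDegree ≤ d) {μ : YoungDiagram} (hμ : μ.colLen 0 ≤ N)
    (h : coeff (alternantExp N μ) (g * vandermonde N) ≠ 0) : μ ≤ rect d d := by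
  have h1 := le_totalDegree (mem_support_iff.2 h)
  have h2 := h1.trans ((totalDegree_mul _ _).trans
    (add_le_add hg (totalDegree_vandermonde_le N)))
  rw [Finsupp.sum_fintype _ _ (fun _ => rfl)] at h2
  simp only [alternantExp_apply, Finset.sum_add_distrib] at h2
  have h3 : ∑ p : Fin N, μ.rowLen p ≤ d := by omega
  rw [le_rect_iff, colLen_le_iff]
  constructor
  · rcases Nat.eq_or_lt_of_le hN with e | hlt
    · rw [e]
      exact rowLen_eq_zero hμ le_rfl
    · by_contra hne
      have h4 : ∀ p ≤ d, 1 ≤ μ.rowLen p := fun p hp =>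
        (Nat.one_le_iff_ne_zero.2 hne).trans (μ.rowLen_anti p d hp)
      have h5 := card_filter_Ico (n := N) (a := 0) (b := d + 1) hlt
      rw [Finset.card_filter] at h5
      have h6 : ∑ p : Fin N, (if 0 ≤ (p : ℕ) ∧ (p : ℕ) < d + 1 then 1 else 0) ≤
          ∑ p : Fin N, μ.rowLen p := by
        refine Finset.sum_le_sum fun p _ => ?_
        split_ifs with hp
        · exact h4 p (by omega)
        · exact Nat.zero_le _
      omega
  · rcases Nat.eq_zero_or_pos N with e | hpos
    · subst e
      rw [rowLen_eq_zero hμ le_rfl]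
      exact Nat.zero_le _
    · refine le_trans ?_ h3
      exact Finset.single_le_sum (f := fun p : Fin N => μ.rowLen p) (fun _ _ => Nat.zero_le _)
        (Finset.mem_univ (⟨0, hpos⟩ : Fin N))

theorem restrict_isSymmetric (N : ℕ) (f : SymmFun) : (restrict N f).IsSymmetric := f.2.1 N

theorem killLast_restrict (N : ℕ) (f : SymmFun) :
    killLast N (restrict (N + 1) f) = restrict N f := f.2.2.1 N

/-- The coefficient of a Schur function in a symmetric function is read off at the leading exponent
of the alternant; that the coefficients do not depend on the number of variables follows from the
linear independence of the Schur polynomials. -/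
theorem exists_eq_sum_schur (f : SymmFun) :
    ∃ (B : Finset YoungDiagram) (c : YoungDiagram → ℤ), f = ∑ μ ∈ B, c μ • schur μ := by
  classical
  obtain ⟨d, hd⟩ := f.2.2.2
  let B := boxDiagrams d d
  have hB : ∀ μ ∈ B, μ.colLen 0 ≤ d := fun μ hμ => (le_rect_iff.1 (mem_boxDiagrams.1 hμ)).1
  let c : ℕ → YoungDiagram → ℤ := fun N μ => coeff (alternantExp N μ) (restrict N f * vandermonde N)
  have hcoeff : ∀ N, d ≤ N → ∀ (c : YoungDiagram → ℤ) (ν : YoungDiagram), ν.colLen 0 ≤ N →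
      coeff (alternantExp N ν) (restrict N (∑ μ ∈ B, c μ • schur μ) * vandermonde N) =
        if ν ∈ B then c ν else 0 := by
    intro N hN c ν hν
    rw [map_sum, Finset.sum_mul, coeff_sum]
    have : ∀ μ ∈ B, coeff (alternantExp N ν) (restrict N (c μ • schur μ) * vandermonde N) =
        if ν = μ then c μ else 0 := by
      intro μ hμ
      rw [map_zsmul, smul_mul_assoc, coeff_smul,
        coeff_restrict_schur ((hB μ hμ).trans hN) (strictAnti_alternantExp N ν)]
      by_cases h : ν = μ
      · subst h
        simp
      · rw [if_neg h, if_neg, smul_zero]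
        exact fun e => h (alternantExp_injOn ((hB μ hμ).trans hN) hν e).symm
    rw [Finset.sum_congr rfl this]
    simp
  have hexp : ∀ N, d ≤ N → restrict N f = restrict N (∑ μ ∈ B, c N μ • schur μ) := by
    intro N hN
    rw [← sub_eq_zero, ← map_sub]
    refine eq_zero_of_coeff_mul_vandermonde (restrict_isSymmetric N _) fun β hβ => ?_
    obtain ⟨ν, hν, rfl⟩ := exists_alternantExp hβ
    rw [map_sub, sub_mul, coeff_sub, hcoeff N hN _ ν hν]
    split_ifs with h
    · exact sub_self _
    · rw [sub_zero]
      by_contra hne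
      exact h (mem_boxDiagrams.2 (le_rect_of_coeff_ne_zero hN (hd N) hν hne))
  have hconst : ∀ N, d ≤ N → ∀ μ ∈ B, c N μ = c d μ := by
    intro N hN
    induction N, hN using Nat.le_induction with
    | base => exact fun _ _ => rfl
    | succ N hN ih =>
      intro μ hμ
      rw [← ih μ hμ]
      have h1 := hcoeff N hN (c (N + 1)) μ ((hB μ hμ).trans hN)
      rw [← killLast_restrict, ← hexp (N + 1) (by omega), killLast_restrict, if_pos hμ] at h1
      exact h1.symm
  refine ⟨B, c d, ?_⟩
  have hlarge : ∀ N, d ≤ N → restrict N f = restrict N (∑ μ ∈ B, c d μ • schur μ) := by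
    intro N hN
    rw [hexp N hN, Finset.sum_congr rfl fun μ hμ => by rw [hconst N hN μ hμ]]
  have hall : ∀ e N, N + e = d → restrict N f = restrict N (∑ μ ∈ B, c d μ • schur μ) := by
    intro e
    induction e with
    | zero => exact fun N hN => hlarge N (by omega)
    | succ e ih =>
      intro N hN
      rw [← killLast_restrict, ih (N + 1) (by omega), killLast_restrict]
  refine Subtype.ext (funext fun N => ?_)
  rcases Nat.lt_or_ge N d with h | h
  · exact hall (d - N) N (by omega)
  · exact hlarge N h

end Alternants

/-! ### The cohomology ring of the Grassmannian -/

section Grassmannian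

/-- The polynomial `∏ᵢ (1 - x_i T)`. -/
def fullProd (N : ℕ) : Polynomial (MvPolynomial (Fin N) ℤ) :=
  ∏ i : Fin N, (1 - Polynomial.C (X i) * Polynomial.X)

theorem natDegree_fullProd_le (N : ℕ) : (fullProd N).natDegree ≤ N := by
  refine (Polynomial.natDegree_prod_le _ _).trans ?_
  refine (Finset.sum_le_sum (g := fun _ => 1) fun i _ => ?_).trans (by simp)
  refine (Polynomial.natDegree_sub_le _ _).trans ?_
  simp

theorem coe_fullProd (N : ℕ) : (fullProd N : PowerSeries (MvPolynomial (Fin N) ℤ)) =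
    ∏ i : Fin N, (1 - PowerSeries.C (X i : MvPolynomial (Fin N) ℤ) * PowerSeries.X) := by
  rw [fullProd, ← Polynomial.coeToPowerSeries.ringHom_apply, map_prod]
  simp

theorem fullProd_coeff_zero (N : ℕ) : (fullProd N).coeff 0 = 1 := by
  rw [fullProd, Polynomial.coeff_zero_prod]
  simp

theorem sum_hz_mul_fullProd (N : ℕ) {α : ℕ} (hα : 0 < α) {L : ℕ} (hL : N < L) :
    ∑ d ∈ Finset.range L, hz N ((α : ℤ) - d) * (fullProd N).coeff d = 0 := by
  have h := congrArg (PowerSeries.coeff α) (hsymm_series N)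
  rw [← coe_fullProd, PowerSeries.coeff_mul, PowerSeries.coeff_one, if_neg hα.ne',
    Finset.Nat.sum_antidiagonal_eq_sum_range_succ_mk, ← Finset.sum_range_reflect] at h
  rw [← h]
  have e1 : ∑ d ∈ Finset.range L, hz N ((α : ℤ) - d) * (fullProd N).coeff d =
      ∑ d ∈ Finset.range (max L (α + 1)), hz N ((α : ℤ) - d) * (fullProd N).coeff d := by
    refine Finset.sum_subset (by simp) fun d _ hd => ?_
    have hd' : L ≤ d := by simpa using hd
    rw [Polynomial.coeff_eq_zero_of_natDegree_lt
      ((natDegree_fullProd_le N).trans_lt (hL.trans_le hd')), mul_zero]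
  have e2 : ∑ d ∈ Finset.range (α + 1), hz N ((α : ℤ) - d) * (fullProd N).coeff d =
      ∑ d ∈ Finset.range (max L (α + 1)), hz N ((α : ℤ) - d) * (fullProd N).coeff d := by
    refine Finset.sum_subset (by simp) fun d _ hd => ?_
    have : (α : ℤ) - d < 0 := by
      simp at hd
      omega
    rw [hz, if_pos this, zero_mul]
  rw [e1, ← e2]
  refine Finset.sum_congr rfl fun d hd => ?_
  have hd' : d ≤ α := by simpa [Nat.lt_succ_iff] using hd
  have h1 : ¬ (α : ℤ) - d < 0 := by omega
  have h2 : ((α : ℤ) - d).toNat = α + 1 - 1 - d := by omega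
  have h3 : α - (α + 1 - 1 - d) = d := by omega
  simp only [hz, if_neg h1, h2, h3, PowerSeries.coeff_mk, Polynomial.coeff_coe]

/-- The relations `∑ (-1)^d e_d h_{α - d} = 0` for `α > 0`, with `e_d = 0` for `d > N`, give a
nonzero vector in the kernel of the Jacobi-Trudi matrix. -/
theorem restrict_schur_eq_zero {N : ℕ} {μ : YoungDiagram} (h : N < μ.colLen 0) :
    restrict N (schur μ) = 0 := by
  rw [schur, RingHom.map_det, ← Matrix.exists_mulVec_eq_zero_iff]
  set L := μ.colLen 0 with hL
  refine ⟨fun q => (fullProd N).coeff (L - 1 - q), ?_, ?_⟩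
  · intro e
    have := congrFun e ⟨L - 1, by omega⟩
    simp only [Nat.sub_self, fullProd_coeff_zero, Pi.zero_apply] at this
    exact one_ne_zero this
  · funext p
    have hp : 0 < μ.rowLen p := Nat.pos_of_ne_zero fun e => by
      have := colLen_le_iff.2 e
      have := p.2
      omega
    have hsum := sum_hz_mul_fullProd N (α := μ.rowLen p + (L - 1 - p)) (by omega) h
    rw [← Fin.sum_univ_eq_sum_range
      (fun d => hz N (((μ.rowLen p + (L - 1 - p) : ℕ) : ℤ) - d) * (fullProd N).coeff d),
      ← Equiv.sum_comp Fin.revPerm] at hsum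
    simp only [Matrix.mulVec, dotProduct, Pi.zero_apply]
    rw [← hsum]
    refine Finset.sum_congr rfl fun q _ => ?_
    have hp := p.2
    have hq := q.2
    simp only [RingHom.mapMatrix_apply, Matrix.map_apply, Matrix.of_apply,
      restrict_completeHomogInt, Fin.revPerm_apply, Fin.val_rev]
    congr 2 <;> omega

variable {n r : ℕ}

/-- A shape outside the box either has too many rows, so that the Schur polynomial itself vanishes,
or is different from the shapes of all Grassmannian permutations in `S_n`. -/
theorem toCoinv_schur_eq_zero (hr : r ≤ n) {μ : YoungDiagram} (hμ : ¬ μ ≤ rect r (n - r)) :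
    toCoinv hr (schur μ) = 0 := by
  rcases Nat.lt_or_ge r (μ.colLen 0) with h | h
  · rw [toCoinv, RingHom.comp_apply, firstVars, RingHom.comp_apply, restrict_schur_eq_zero h]
    simp
  · rw [toCoinv, RingHom.comp_apply, mk_eq_zero_iff]
    intro u
    by_cases hu : IsGrassmannian r u
    · classical
      obtain ⟨lam, hlam, rfl⟩ := hu.exists_eq hr
      rw [schubertCoeff_grassmannianPerm hr hlam h, if_neg]
      rintro rfl
      exact hμ hlam
    · exact schubertCoeff_eq_zero_of_not_isGrassmannian
        (fun k hk => divDiff_firstVars_schur hr h k hk) hu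

theorem schubertCoeff_toCoinv_eq_zero (hr : r ≤ n) {f : SymmFun} (hf : toCoinv hr f = 0)
    (u : Perm (Fin n)) : schubertCoeff u (firstVars hr f) = 0 :=
  (mk_eq_zero_iff _).1 hf u

/-- Modulo the box ideal every symmetric function is a combination of the Schur functions in the
box, with the Schubert coefficients as coefficients. -/
theorem sub_sum_schur_mem_boxIdeal (hr : r ≤ n) (f : SymmFun) :
    ∃ c : YoungDiagram → ℤ, f - ∑ μ ∈ boxDiagrams r (n - r), c μ • schur μ ∈ boxIdeal r (n - r) ∧
      ∀ (μ : YoungDiagram) (h : μ ≤ rect r (n - r)),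
        c μ = schubertCoeff (grassmannianPerm hr μ h) (firstVars hr f) := by
  classical
  obtain ⟨B, c, hf⟩ := exists_eq_sum_schur f
  let c' : YoungDiagram → ℤ := fun μ => if μ ∈ B then c μ else 0
  have hsplit : f - ∑ μ ∈ boxDiagrams r (n - r), c' μ • schur μ =
      ∑ μ ∈ B \ boxDiagrams r (n - r), c' μ • schur μ := by
    have h1 : f = ∑ μ ∈ B ∪ boxDiagrams r (n - r), c' μ • schur μ := by
      rw [hf, ← Finset.sum_subset Finset.subset_union_left
        (fun μ _ hμ => by simp only [c', if_neg hμ, zero_smul])]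
      exact Finset.sum_congr rfl fun μ hμ => by simp only [c', if_pos hμ]
    rw [h1, ← Finset.sum_sdiff (Finset.subset_union_right (s₁ := B)), add_sub_cancel_right,
      Finset.union_sdiff_right]
  have hmem : f - ∑ μ ∈ boxDiagrams r (n - r), c' μ • schur μ ∈ boxIdeal r (n - r) := by
    rw [hsplit]
    refine sum_mem fun μ hμ => zsmul_mem (Ideal.subset_span (Set.mem_image_of_mem schur ?_)) _
    exact fun h => (Finset.mem_sdiff.1 hμ).2 (mem_boxDiagrams.2 h)
  refine ⟨c', hmem, fun μ h => ?_⟩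
  have hle : boxIdeal r (n - r) ≤ RingHom.ker (toCoinv hr) := by
    refine Ideal.span_le.2 ?_
    rintro _ ⟨ν, hν, rfl⟩
    exact toCoinv_schur_eq_zero hr hν
  have h0 := schubertCoeff_toCoinv_eq_zero hr (hle hmem) (grassmannianPerm hr μ h)
  rw [map_sub, ← schubertCoeffHom_apply, map_sub, sub_eq_zero] at h0
  rw [← schubertCoeffHom_apply, h0, map_sum, map_sum]
  rw [Finset.sum_eq_single μ]
  · rw [map_zsmul, map_zsmul, schubertCoeffHom_apply,
      schubertCoeff_grassmannianPerm hr h (le_rect_iff.1 h).1, if_pos rfl]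
    simp
  · intro ν hν hne
    rw [map_zsmul, map_zsmul, schubertCoeffHom_apply,
      schubertCoeff_grassmannianPerm hr h (le_rect_iff.1 (mem_boxDiagrams.1 hν)).1, if_neg hne,
      smul_zero]
  · exact fun hμ => absurd (mem_boxDiagrams.2 h) hμ

theorem ker_toCoinv (hr : r ≤ n) : RingHom.ker (toCoinv hr) = boxIdeal r (n - r) := by
  apply le_antisymm
  · intro f hf
    obtain ⟨c, h1, h2⟩ := sub_sum_schur_mem_boxIdeal hr f
    rwa [Finset.sum_eq_zero, sub_zero] at h1
    intro μ hμ
    rw [h2 μ (mem_boxDiagrams.1 hμ), schubertCoeff_toCoinv_eq_zero hr hf, zero_smul]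
  · refine Ideal.span_le.2 ?_
    rintro _ ⟨ν, hν, rfl⟩
    exact toCoinv_schur_eq_zero hr hν

theorem mk_boxIdeal_eq_iff (hr : r ≤ n) {f g : SymmFun} :
    Ideal.Quotient.mk (boxIdeal r (n - r)) f = Ideal.Quotient.mk (boxIdeal r (n - r)) g ↔
      toCoinv hr f = toCoinv hr g := by
  rw [Ideal.Quotient.eq, ← ker_toCoinv hr, RingHom.mem_ker, map_sub, sub_eq_zero]

end Grassmannian

section Hankel

variable {R : Type*} [CommRing R]

/-! ### Determinants in the coefficients of a polynomial -/

/-- The coefficient of `H` at an integer index, zero at negative indices. -/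
def coeffInt (H : Polynomial R) (z : ℤ) : R := if z < 0 then 0 else H.coeff z.toNat

theorem coeffInt_of_neg (H : Polynomial R) {z : ℤ} (hz : z < 0) : coeffInt H z = 0 := if_pos hz

/-- The determinant with entries `h_{k_p + σ_q}`, where `h_d` are the coefficients of `H`. For
`k_p = μ_p - p` and `σ_q = q` this is the Jacobi-Trudi determinant of `μ`. -/
def hankel (H : Polynomial R) {L : ℕ} (k σ : Fin L → ℤ) : R :=
  Matrix.det (Matrix.of fun p q => coeffInt H (k p + σ q))

theorem hankel_comp_perm (H : Polynomial R) {L : ℕ} (k σ : Fin L → ℤ) (τ : Perm (Fin L)) :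
    hankel H k (σ ∘ τ) = (Perm.sign τ : ℤ) * hankel H k σ := by
  rw [hankel, hankel, ← Matrix.det_permute']
  rfl

theorem hankel_comm (H : Polynomial R) {L : ℕ} (k σ : Fin L → ℤ) :
    hankel H k σ = hankel H σ k := by
  rw [hankel, ← Matrix.det_transpose]
  unfold hankel
  congr 1
  ext1 p q
  rw [Matrix.transpose_apply, Matrix.of_apply, Matrix.of_apply, add_comm]

theorem mem_of_sign_mul_mem {I : Ideal R} {L : ℕ} (τ : Perm (Fin L)) {x : R}
    (h : ((Perm.sign τ : ℤ) : R) * x ∈ I) : x ∈ I := by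
  have h1 := I.mul_mem_left ((Perm.sign τ : ℤ) : R) h
  rwa [← mul_assoc, ← Int.cast_mul, ← Units.val_mul, Int.units_mul_self, Units.val_one,
    Int.cast_one, one_mul] at h1

theorem hankel_comp_perm_mem_iff (H : Polynomial R) {L : ℕ} (k σ : Fin L → ℤ) (τ : Perm (Fin L))
    {I : Ideal R} : hankel H k (σ ∘ τ) ∈ I ↔ hankel H k σ ∈ I := by
  rw [hankel_comp_perm]
  exact ⟨mem_of_sign_mul_mem τ, I.mul_mem_left _⟩

theorem hankel_eq_zero_of_eq (H : Polynomial R) {L : ℕ} {k σ : Fin L → ℤ} {p p' : Fin L}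
    (hp : p ≠ p') (h : k p = k p') : hankel H k σ = 0 :=
  Matrix.det_zero_of_row_eq hp (by funext q; simp [h])

theorem hankel_eq_zero_of_lt {H : Polynomial R} {m : ℕ} (hm : H.natDegree ≤ m) {L : ℕ}
    {k : Fin L → ℤ} {p : Fin L} (h : (m : ℤ) < k p) : hankel H k (fun q => (q : ℕ)) = 0 := by
  refine Matrix.det_eq_zero_of_row_eq_zero p fun q => ?_
  simp only [Matrix.of_apply]
  rw [coeffInt, if_neg (by omega)]
  exact Polynomial.coeff_eq_zero_of_natDegree_lt (by omega)

theorem hankel_succ (H : Polynomial R) {L : ℕ} (k σ : Fin (L + 1) → ℤ) (p : Fin (L + 1)) :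
    hankel H k σ = ∑ q : Fin (L + 1), (-1) ^ ((p : ℕ) + q) * coeffInt H (k p + σ q) *
      hankel H (k ∘ p.succAbove) (σ ∘ q.succAbove) := by
  rw [hankel, Matrix.det_succ_row _ p]
  rfl

/-- The vanishing of the Schur functions with too many rows: the relations `∑ e_d h_{α - d} = 0` for
`α > 0` express the last column by the others. -/
theorem hankel_eq_zero_of_natDegree_lt {H E : Polynomial R} (hHE : H * E = 1) (hE0 : E.coeff 0 = 1)
    {L : ℕ} (hE : E.natDegree < L) {k : Fin L → ℤ} (hk : ∀ p, 0 < k p + L - 1) :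
    hankel H k (fun q => (q : ℕ)) = 0 := by
  have hsum : ∀ α : ℕ, 0 < α →
      ∑ d ∈ Finset.range L, coeffInt H ((α : ℤ) - d) * E.coeff d = 0 := by
    intro α hα
    have h := congrArg (fun P => Polynomial.coeff P α) hHE
    rw [Polynomial.coeff_mul, Polynomial.coeff_one, if_neg hα.ne',
      Finset.Nat.sum_antidiagonal_eq_sum_range_succ_mk, ← Finset.sum_range_reflect] at h
    rw [← h]
    have e1 : ∑ d ∈ Finset.range L, coeffInt H ((α : ℤ) - d) * E.coeff d =
        ∑ d ∈ Finset.range (max L (α + 1)), coeffInt H ((α : ℤ) - d) * E.coeff d := by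
      refine Finset.sum_subset (by simp) fun d _ hd => ?_
      have hd' : L ≤ d := by simpa using hd
      rw [Polynomial.coeff_eq_zero_of_natDegree_lt (hE.trans_le hd'), mul_zero]
    have e2 : ∑ d ∈ Finset.range (α + 1), coeffInt H ((α : ℤ) - d) * E.coeff d =
        ∑ d ∈ Finset.range (max L (α + 1)), coeffInt H ((α : ℤ) - d) * E.coeff d := by
      refine Finset.sum_subset (by simp) fun d _ hd => ?_
      have : (α : ℤ) - d < 0 := by
        simp at hd
        omega
      rw [coeffInt_of_neg _ this, zero_mul]
    rw [e1, ← e2]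
    refine Finset.sum_congr rfl fun d hd => ?_
    have hd' : d ≤ α := by simpa [Nat.lt_succ_iff] using hd
    have h1 : ¬ (α : ℤ) - d < 0 := by omega
    have h2 : ((α : ℤ) - d).toNat = α + 1 - 1 - d := by omega
    have h3 : α - (α + 1 - 1 - d) = d := by omega
    simp only [coeffInt, if_neg h1, h2, h3]
  set A : Matrix (Fin L) (Fin L) R := Matrix.of fun p q => coeffInt H (k p + ((q : ℕ) : ℤ)) with hA
  let w : Fin L → R := fun q => E.coeff (L - 1 - q)
  have hw : A.mulVec w = 0 := by
    funext p
    obtain ⟨α, hα⟩ : ∃ α : ℕ, k p + L - 1 = α := ⟨(k p + L - 1).toNat, by have := hk p; omega⟩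
    have h1 := hsum α (by have := hk p; omega)
    rw [← Fin.sum_univ_eq_sum_range (fun d => coeffInt H ((α : ℤ) - d) * E.coeff d),
      ← Equiv.sum_comp Fin.revPerm] at h1
    simp only [Matrix.mulVec, dotProduct, Pi.zero_apply]
    rw [← h1]
    refine Finset.sum_congr rfl fun q _ => ?_
    have hq := q.2
    simp only [hA, w, Matrix.of_apply, Fin.revPerm_apply, Fin.val_rev]
    congr 2 <;> omega
  have h2 : A.adjugate.mulVec (A.mulVec w) = 0 := by rw [hw, Matrix.mulVec_zero]
  rw [Matrix.mulVec_mulVec, Matrix.adjugate_mul, Matrix.smul_mulVec, Matrix.one_mulVec] at h2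
  have h3 := congrFun h2 ⟨L - 1, by omega⟩
  have h4 : A.det = 0 := by simpa [w, hE0] using h3
  exact h4

/-! ### Determinants with a gap between the columns -/

theorem det_add_X_mul {L : ℕ} (v w : Fin L → Fin L → R) :
    Matrix.det (Matrix.of fun p q => Polynomial.C (w p q) + Polynomial.X * Polynomial.C (v p q)) =
      ∑ s : Finset (Fin L), Polynomial.X ^ s.card *
        Polynomial.C (Matrix.det (Matrix.of (s.piecewise v w))) := by
  let v' : Fin L → Fin L → Polynomial R := fun p q => Polynomial.C (v p q)
  let w' : Fin L → Fin L → Polynomial R := fun p q => Polynomial.C (w p q)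
  have h := (Matrix.detRowAlternating (n := Fin L)
    (R := Polynomial R)).toMultilinearMap.map_add_univ
    (fun p => (Polynomial.X : Polynomial R) • v' p) w'
  have h1 : (Matrix.of fun p q => Polynomial.C (w p q) + Polynomial.X * Polynomial.C (v p q)) =
      (fun p => (Polynomial.X : Polynomial R) • v' p) + w' := by
    ext1 p q
    simp [v', w', add_comm]
  rw [h1]
  refine h.trans (Finset.sum_congr rfl fun s _ => ?_)
  have h2 : s.piecewise (fun p => (Polynomial.X : Polynomial R) • v' p) w' =
      s.piecewise (fun p => (Polynomial.X : Polynomial R) • s.piecewise v' w' p)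
        (s.piecewise v' w') := by
    funext p
    by_cases hp : p ∈ s <;> simp [hp]
  rw [h2]
  have h3 := (Matrix.detRowAlternating (n := Fin L)
    (R := Polynomial R)).toMultilinearMap.map_piecewise_smul (fun _ => Polynomial.X)
    (s.piecewise v' w') s
  refine h3.trans ?_
  rw [Finset.prod_const, smul_eq_mul]
  congr 1
  have h4 : Polynomial.C (Matrix.det (Matrix.of (s.piecewise v w))) =
      Matrix.det (Polynomial.C.mapMatrix (Matrix.of (s.piecewise v w))) := RingHom.map_det _ _
  rw [h4]
  change Matrix.det (Matrix.of (s.piecewise v' w')) = _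
  congr 1
  ext1 p q
  by_cases hp : p ∈ s <;> simp [hp, v', w']

/-- Pieri's rule in determinantal form: a gap between the columns of the determinant is traded for
vertical strips added to the rows. Both sides are coefficients of one determinant with entries
`h_{k_p + q} + T h_{k_p + q + 1}`. -/
theorem hankel_succAbove (H : Polynomial R) {L : ℕ} (k : Fin L → ℤ) (q : Fin (L + 1)) :
    hankel H k (fun x => ((q.succAbove x : ℕ) : ℤ)) =
      ∑ s : Finset (Fin L) with s.card = L - q,
        hankel H (fun p => k p + if p ∈ s then 1 else 0) (fun x => (x : ℕ)) := by
  classical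
  let w : Fin L → Fin L → R := fun p x => coeffInt H (k p + (x : ℕ))
  let v : Fin L → Fin L → R := fun p x => coeffInt H (k p + (x : ℕ) + 1)
  have hrow := det_add_X_mul v w
  have hcol := det_add_X_mul (fun x p => v p x) (fun x p => w p x)
  have htr : Matrix.det (Matrix.of fun p q =>
      Polynomial.C (w p q) + Polynomial.X * Polynomial.C (v p q)) =
      Matrix.det (Matrix.of fun q p =>
      Polynomial.C (w p q) + Polynomial.X * Polynomial.C (v p q)) := by
    rw [← Matrix.det_transpose]
    rfl
  rw [htr, hcol] at hrow
  have hc := congrArg (fun P => Polynomial.coeff P (L - q)) hrow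
  simp only [Polynomial.finsetSum_coeff, Polynomial.coeff_X_pow_mul', Polynomial.coeff_C] at hc
  have hsel : ∀ F : Finset (Fin L) → R, (∑ s : Finset (Fin L),
      if s.card ≤ L - (q : ℕ) then (if L - (q : ℕ) - s.card = 0 then F s else 0) else 0) =
      ∑ s : Finset (Fin L) with s.card = L - q, F s := by
    intro F
    rw [Finset.sum_filter]
    refine Finset.sum_congr rfl fun s _ => ?_
    split_ifs <;> first | rfl | omega
  rw [hsel, hsel] at hc
  have hR : ∀ s : Finset (Fin L), Matrix.det (Matrix.of (s.piecewise v w)) =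
      hankel H (fun p => k p + if p ∈ s then 1 else 0) (fun x => (x : ℕ)) := by
    intro s
    unfold hankel
    congr 1
    ext1 p x
    by_cases hp : p ∈ s
    · simp only [Finset.piecewise, hp, if_true, v, Matrix.of_apply]
      congr 1
      ring
    · simp only [Finset.piecewise, hp, if_false, w, Matrix.of_apply, add_zero]
  simp only [hR] at hc
  rw [← hc]
  let T : Finset (Fin L) := Finset.univ.filter fun x => q ≤ x.castSucc
  have hT : T.card = L - q := by
    have := card_filter_Ico (n := L) (a := q) le_rfl
    rw [← this]
    congr 1
    ext x
    simp [T, Fin.le_def]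
  rw [Finset.sum_eq_single T]
  · rw [hankel_comm]
    unfold hankel
    congr 1
    ext1 x p
    by_cases hx : q ≤ x.castSucc
    · have h1 : x ∈ T := by simp [T, hx]
      simp only [Finset.piecewise, h1, if_true, v, Matrix.of_apply,
        Fin.succAbove_of_le_castSucc _ _ hx, Fin.val_succ]
      congr 1
      push_cast
      ring
    · have h1 : x ∉ T := by simpa [T] using hx
      simp only [Finset.piecewise, h1, if_false, w, Matrix.of_apply,
        Fin.succAbove_of_castSucc_lt _ _ (not_le.1 hx), Fin.val_castSucc]
      congr 1
      ring
  · intro s hs hne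
    have hcard : s.card = L - q := by simpa using hs
    -- Two columns agree unless the shifted columns form a final segment.
    have hex : ∃ x ∈ s, ∃ hx : (x : ℕ) + 1 < L, (⟨x + 1, hx⟩ : Fin L) ∉ s := by
      by_contra hcon
      push Not at hcon
      obtain ⟨y, hy, hyT⟩ : ∃ y ∈ s, y ∉ T := by
        by_contra h
        push Not at h
        exact hne (Finset.eq_of_subset_of_card_le h (by rw [hT, hcard]))
      have hyq : (y : ℕ) < q := by simpa [T, Fin.lt_def] using hyT
      have hup : ∀ d, ∀ h : (y : ℕ) + d < L, (⟨y + d, h⟩ : Fin L) ∈ s := by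
        intro d
        induction d with
        | zero => exact fun _ => hy
        | succ d ih => exact fun h => hcon _ (ih (by omega)) h
      have hsub : (Finset.univ.filter fun x : Fin L => (y : ℕ) ≤ x ∧ (x : ℕ) < L) ⊆ s := by
        intro x hx
        have h1 : (y : ℕ) ≤ x := by simpa using hx
        have := hup (x - y) (by omega)
        have e : (⟨y + (x - y), by omega⟩ : Fin L) = x := Fin.ext (by simp; omega)
        rwa [e] at this
      have h1 := Finset.card_le_card hsub
      rw [card_filter_Ico le_rfl, hcard] at h1
      have := q.2
      have := y.2
      omega
    obtain ⟨x, hx, hx1, hx2⟩ := hex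
    refine Matrix.det_zero_of_row_eq (i := x) (j := ⟨x + 1, hx1⟩)
      (by simp [Fin.ext_iff]) ?_
    funext p
    simp only [Matrix.of_apply, Finset.piecewise, hx, hx2, if_true, if_false, v, w]
    congr 1
    push_cast
    ring
  · intro h
    exact absurd (by simp [hT]) h

/-! ### The ideal of the Schur functions containing a rectangle -/

/-- The ideal generated by the determinants with `j` rows which all have index at least `c`. For
`c = i - j + 1` these are, up to sign, the Schur functions of the partitions with at most `j` rows
which contain the rectangle `i^j`. -/
def rowsIdeal (H : Polynomial R) (j : ℕ) (c : ℤ) : Ideal R :=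
  Ideal.span {x | ∃ k : Fin j → ℤ, (∀ p, c ≤ k p) ∧ x = hankel H k fun q => (q : ℕ)}

/-- A determinant of any size with at least `j` rows of index at least `c` lies in the ideal: expand
along a superfluous row, and close the gap in the columns by Pieri's rule. -/
theorem hankel_mem_rowsIdeal (H : Polynomial R) {j : ℕ} {c : ℤ} {L : ℕ} (k : Fin L → ℤ)
    (h : j ≤ (Finset.univ.filter fun p => c ≤ k p).card) :
    hankel H k (fun q => (q : ℕ)) ∈ rowsIdeal H j c := by
  induction L with
  | zero =>
    have hj : j = 0 := by simpa using h
    subst hj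
    exact Ideal.subset_span ⟨k, fun p => p.elim0, rfl⟩
  | succ L ih =>
    have hle : (Finset.univ.filter fun p => c ≤ k p).card ≤ L + 1 := by
      simpa using Finset.card_filter_le (Finset.univ : Finset (Fin (L + 1))) fun p => c ≤ k p
    rcases Nat.eq_or_lt_of_le (h.trans hle) with e | hlt
    · subst e
      have hall : (Finset.univ.filter fun p => c ≤ k p) = Finset.univ :=
        Finset.eq_univ_of_card _ (by rw [Fintype.card_fin]; exact le_antisymm hle h)
      refine Ideal.subset_span ⟨k, fun p => ?_, rfl⟩
      have := Finset.mem_univ p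
      rw [← hall] at this
      simpa using this
    · -- A row whose removal leaves enough rows of large index.
      obtain ⟨p₀, hp₀⟩ : ∃ p₀ : Fin (L + 1),
          j ≤ (Finset.univ.filter fun p => c ≤ k (p₀.succAbove p)).card := by
        by_cases hbad : ∃ p₀, ¬ c ≤ k p₀
        · obtain ⟨p₀, hp₀⟩ := hbad
          refine ⟨p₀, h.trans_eq ?_⟩
          rw [Finset.card_filter, Finset.card_filter, Fin.sum_univ_succAbove _ p₀, if_neg hp₀,
            zero_add]
        · push Not at hbad
          refine ⟨0, ?_⟩
          rw [Finset.filter_true_of_mem fun p _ => hbad _]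
          simp
          omega
      rw [hankel_succ H k _ p₀]
      refine sum_mem fun q _ => Ideal.mul_mem_left _ _ ?_
      have hgap := hankel_succAbove H (k ∘ p₀.succAbove) q
      change hankel H (k ∘ p₀.succAbove) (fun x => ((q.succAbove x : ℕ) : ℤ)) ∈ _
      rw [hgap]
      refine sum_mem fun s _ => ih _ (hp₀.trans (Finset.card_le_card fun p hp => ?_))
      simp only [Finset.mem_filter, Finset.mem_univ, true_and, Function.comp_apply] at hp ⊢
      split_ifs <;> omega

/-- Transposing a determinant with `j` consecutive rows turns its columns into rows. -/
theorem hankel_block_mem_iff (H : Polynomial R) {j : ℕ} (i : ℤ) (σ : Fin j → ℤ) {I : Ideal R} :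
    hankel H (fun p => i - (p : ℕ)) σ ∈ I ↔
      hankel H (fun p => i - j + 1 + σ p) (fun q => (q : ℕ)) ∈ I := by
  rw [hankel_comm, ← hankel_comp_perm_mem_iff H σ _ Fin.revPerm]
  refine Eq.to_iff ?_
  congr 1
  unfold hankel
  congr 1
  ext1 p q
  simp only [Matrix.of_apply, Function.comp_apply, Fin.revPerm_apply, Fin.val_rev]
  congr 1
  have := q.2
  omega

/-- A determinant containing the rows `i, i - 1, …, i - j + 1`, with arbitrary columns, lies in the
ideal: expand along the other rows. -/
theorem hankel_mem_rowsIdeal_of_block (H : Polynomial R) {j : ℕ} (i : ℤ) (k : ℕ → ℤ)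
    (hk : ∀ p < j, k p = i - p) {L : ℕ} (hL : j ≤ L) (σ : Fin L → ℤ) (hσ : ∀ q, 0 ≤ σ q) :
    hankel H (fun p : Fin L => k p) σ ∈ rowsIdeal H j (i - j + 1) := by
  induction L, hL using Nat.le_induction with
  | base =>
    have e : (fun p : Fin j => k p) = fun p : Fin j => i - ((p : ℕ) : ℤ) :=
      funext fun p => hk p p.2
    rw [e, hankel_block_mem_iff]
    exact Ideal.subset_span ⟨_, fun p => by have := hσ p; omega, rfl⟩
  | succ L hL ih =>
    rw [hankel_succ H _ _ (Fin.last L)]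
    refine sum_mem fun q _ => Ideal.mul_mem_left _ _ ?_
    have e : (fun p : Fin (L + 1) => k p) ∘ (Fin.last L).succAbove = fun p : Fin L => k p := by
      funext p
      simp
    rw [e]
    exact ih _ fun x => hσ _

/-- The ideal generated by the coefficients of positive index. -/
def posIdeal (H : Polynomial R) : Ideal R := Ideal.span (Set.range fun d => H.coeff (d + 1))

theorem coeffInt_mem_posIdeal (H : Polynomial R) {z : ℤ} (hz : z ≠ 0) :
    coeffInt H z ∈ posIdeal H := by
  unfold coeffInt
  split_ifs
  · exact zero_mem _
  · refine Ideal.subset_span ⟨z.toNat - 1, ?_⟩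
    simp only
    congr 1
    omega

/-- Enlarging a determinant by the row `-σ_L` and the column `σ_L` does not change it modulo
`posIdeal H * rowsIdeal H j c`: the new diagonal entry is `h_0 = 1`. -/
theorem hankel_succ_sub_mem {H : Polynomial R} (hH0 : H.coeff 0 = 1) {j : ℕ} (i : ℤ) (k σ : ℕ → ℤ)
    (hk : ∀ p < j, k p = i - p) {L : ℕ} (hL : j ≤ L) (hσ : ∀ q, 0 ≤ σ q) (hkL : k L = -σ L)
    (hne : ∀ q < L, σ q ≠ σ L) :
    hankel H (fun p : Fin (L + 1) => k p) (fun q => σ q) -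
      hankel H (fun p : Fin L => k p) (fun q => σ q) ∈
      posIdeal H * rowsIdeal H j (i - j + 1) := by
  have e : (fun p : Fin (L + 1) => k p) ∘ (Fin.last L).succAbove = fun p : Fin L => k p := by
    funext p
    simp
  have e' : (fun p : Fin (L + 1) => σ p) ∘ (Fin.last L).succAbove = fun p : Fin L => σ p := by
    funext p
    simp
  rw [hankel_succ H _ _ (Fin.last L), Fin.sum_univ_castSucc]
  have hlast : (-1 : R) ^ (((Fin.last L : Fin (L + 1)) : ℕ) + (Fin.last L : Fin (L + 1))) *
      coeffInt H (k (Fin.last L : Fin (L + 1)) + σ (Fin.last L : Fin (L + 1))) = 1 := by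
    rw [Fin.val_last, hkL, neg_add_cancel, Even.neg_one_pow ⟨L, rfl⟩, one_mul]
    simpa [coeffInt] using hH0
  rw [hlast, one_mul, e, e', add_sub_cancel_right]
  refine sum_mem fun q _ => ?_
  refine Ideal.mul_mem_mul (Ideal.mul_mem_left _ _ (coeffInt_mem_posIdeal H ?_))
    (hankel_mem_rowsIdeal_of_block H i k hk hL _ fun x => hσ _)
  have := hne q q.2
  simp only [Fin.val_last, Fin.val_castSucc]
  omega

/-- The iterated form of `hankel_succ_sub_mem`. -/
theorem hankel_sub_mem {H : Polynomial R} (hH0 : H.coeff 0 = 1) {j : ℕ} (i : ℤ) (k σ : ℕ → ℤ)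
    (hk : ∀ p < j, k p = i - p) {L : ℕ} (hL : j ≤ L) (hσ : ∀ q, 0 ≤ σ q)
    (hkσ : ∀ p, j ≤ p → p < L → k p = -σ p) (hne : ∀ p q, p < q → q < L → σ p ≠ σ q) :
    hankel H (fun p : Fin L => k p) (fun q => σ q) -
      hankel H (fun p : Fin j => k p) (fun q => σ q) ∈
      posIdeal H * rowsIdeal H j (i - j + 1) := by
  induction L, hL using Nat.le_induction with
  | base => rw [sub_self]; exact zero_mem _
  | succ L hL ih =>
    have h1 := hankel_succ_sub_mem hH0 i k σ hk hL hσ (hkσ L hL (Nat.lt_succ_self L))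
      fun q hq => hne q L hq (Nat.lt_succ_self L)
    have h2 := ih (fun p hp hp' => hkσ p hp (by omega)) fun p q hpq hq => hne p q hpq (by omega)
    have := add_mem h1 h2
    rwa [sub_add_sub_cancel] at this

/-- Listing the elements of `S` and then, in increasing order, those of its complement in
`{0, …, L - 1}`. -/
theorem exists_complement {j L : ℕ} (S : Fin j → ℕ) (hS : Function.Injective S)
    (hSL : ∀ p, S p < L) : j ≤ L ∧ ∃ (σ : ℕ → ℕ) (τ : Perm (Fin L)),
      (∀ p (hp : p < j), σ p = S ⟨p, hp⟩) ∧ (∀ p : Fin L, σ p = τ p) ∧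
      ∀ p q, j ≤ p → p < q → q < L → σ p < σ q := by
  classical
  have hcS : (Finset.univ.image S).card = j := by
    rw [Finset.card_image_of_injective _ hS, Finset.card_univ, Fintype.card_fin]
  have hsub : Finset.univ.image S ⊆ Finset.range L := by
    intro x hx
    obtain ⟨p, -, rfl⟩ := Finset.mem_image.1 hx
    exact Finset.mem_range.2 (hSL p)
  have hjL : j ≤ L := by
    have := Finset.card_le_card hsub
    rwa [hcS, Finset.card_range] at this
  have hcC : (Finset.range L \ Finset.univ.image S).card = L - j := by
    rw [Finset.card_sdiff_of_subset hsub, hcS, Finset.card_range]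
  let e := (Finset.range L \ Finset.univ.image S).orderEmbOfFin hcC
  have he : ∀ x, e x < L ∧ ∀ p, S p ≠ e x := by
    intro x
    have := Finset.orderEmbOfFin_mem _ hcC x
    rw [Finset.mem_sdiff, Finset.mem_range] at this
    exact ⟨this.1, fun p hp => this.2 (Finset.mem_image.2 ⟨p, Finset.mem_univ p, hp⟩)⟩
  let σ : ℕ → ℕ := fun p => if hp : p < j then S ⟨p, hp⟩ else
    if hp' : p - j < L - j then e ⟨p - j, hp'⟩ else 0
  have hσ1 : ∀ p (hp : p < j), σ p = S ⟨p, hp⟩ := fun p hp => dif_pos hp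
  have hσ2 : ∀ p (_ : j ≤ p) (hp' : p < L), σ p = e ⟨p - j, by omega⟩ := fun p hp hp' => by
    simp only [σ]
    rw [dif_neg (by omega), dif_pos (by omega)]
  have hmono : ∀ p q, j ≤ p → p < q → q < L → σ p < σ q := by
    intro p q hp hpq hq
    rw [hσ2 p hp (by omega), hσ2 q (by omega) hq]
    exact e.strictMono (Fin.lt_def.2 (by simp only; omega))
  have hlt : ∀ p, p < L → σ p < L := by
    intro p hp
    rcases Nat.lt_or_ge p j with h | h
    · rw [hσ1 p h]
      exact hSL _
    · rw [hσ2 p h hp]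
      exact (he _).1
  have hinj : ∀ p q, p < q → q < L → σ p ≠ σ q := by
    intro p q hpq hq
    rcases Nat.lt_or_ge p j with h | h
    · rcases Nat.lt_or_ge q j with h' | h'
      · rw [hσ1 p h, hσ1 q h']
        intro e
        have := congrArg Fin.val (hS e)
        simp only at this
        omega
      · rw [hσ1 p h, hσ2 q h' hq]
        exact (he _).2 _
    · exact (hmono p q h hpq hq).ne
  let f : Fin L → Fin L := fun p => ⟨σ p, hlt p p.2⟩
  have hf : Function.Injective f := by
    intro p q hpq
    have h1 : σ p = σ q := congrArg Fin.val hpq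
    by_contra hne
    rcases lt_or_gt_of_ne hne with h | h
    · exact hinj p q h q.2 h1
    · exact hinj q p h p.2 h1.symm
  exact ⟨hjL, σ, Equiv.ofBijective f (Finite.injective_iff_bijective.1 hf), hσ1, fun p => rfl,
    hmono⟩

/-- Replacing a set `S` of columns by its complement in `{0, …, L - 1}`: modulo
`posIdeal H * rowsIdeal H j c` the determinant with rows `i, …, i - j + 1` and columns `S` is, up to
sign, the one with the additional rows `-x` for `x` in the complement and consecutive columns. -/
theorem hankel_mem_of_complement {H : Polynomial R} (hH0 : H.coeff 0 = 1) {j L : ℕ} (i : ℤ)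
    (S : Fin j → ℕ) (σ : ℕ → ℕ) (τ : Perm (Fin L)) (hjL : j ≤ L)
    (hσS : ∀ p (hp : p < j), σ p = S ⟨p, hp⟩) (hτ : ∀ p : Fin L, σ p = τ p)
    {I : Ideal R} (hI : posIdeal H * rowsIdeal H j (i - j + 1) ≤ I)
    (h : hankel H (fun p : Fin L => if (p : ℕ) < j then i - (p : ℕ) else -(σ p : ℤ))
      (fun q => (q : ℕ)) ∈ I) :
    hankel H (fun p => i - j + 1 + S p) (fun q => (q : ℕ)) ∈ I := by
  have hne : ∀ p q, p < q → q < L → (σ p : ℤ) ≠ σ q := by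
    intro p q hpq hq e
    have h1 := hτ ⟨p, by omega⟩
    have h2 := hτ ⟨q, hq⟩
    simp only at h1 h2
    have h3 := τ.injective (Fin.ext (by omega : ((τ ⟨p, hpq.trans hq⟩ : Fin L) : ℕ) = τ ⟨q, hq⟩))
    rw [Fin.mk.injEq] at h3
    omega
  have key := hankel_sub_mem hH0 i (fun p => if p < j then i - (p : ℤ) else -(σ p : ℤ))
    (fun q => (σ q : ℤ)) (fun p hp => if_pos hp) hjL (fun q => by simp)
    (fun p hp _ => if_neg (by omega)) hne
  have h1 : hankel H (fun p : Fin L => if (p : ℕ) < j then i - (p : ℕ) else -(σ p : ℤ))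
      (fun q => (σ q : ℤ)) ∈ I := by
    have e : (fun q : Fin L => (σ q : ℤ)) = (fun q : Fin L => ((q : ℕ) : ℤ)) ∘ τ := by
      funext q
      simp [hτ]
    rw [e, hankel_comp_perm_mem_iff]
    exact h
  have h2 := sub_mem h1 (hI key)
  rw [sub_sub_cancel] at h2
  rw [← hankel_block_mem_iff]
  have e1 : (fun p : Fin j => if (p : ℕ) < j then i - ((p : ℕ) : ℤ) else -(σ p : ℤ)) =
      fun p : Fin j => i - ((p : ℕ) : ℤ) := funext fun p => if_pos p.2
  have e2 : (fun q : Fin j => (σ q : ℤ)) = fun q : Fin j => (S q : ℤ) :=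
    funext fun q => by rw [hσS q q.2]
  rw [e1, e2] at h2
  exact h2

end Hankel

section Generators

variable {R : Type*} [CommRing R]

/-! ### Nilpotence of the ideal of positive degree -/

/-- The higher coefficients of an invertible polynomial are nilpotent. -/
theorem isNilpotent_posIdeal {H E : Polynomial R} (hHE : H * E = 1) : IsNilpotent (posIdeal H) := by
  have hfg : (posIdeal H).FG := by
    classical
    refine ⟨(Finset.range H.natDegree).image fun d => H.coeff (d + 1), le_antisymm ?_ ?_⟩
    · refine Ideal.span_mono ?_
      intro x hx
      obtain ⟨d, -, rfl⟩ := Finset.mem_image.1 (Finset.mem_coe.1 hx)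
      exact ⟨d, rfl⟩
    · refine Ideal.span_le.2 ?_
      rintro _ ⟨d, rfl⟩
      rcases Nat.lt_or_ge d H.natDegree with h | h
      · exact Ideal.subset_span (Finset.mem_coe.2
          (Finset.mem_image.2 ⟨d, Finset.mem_range.2 h, rfl⟩))
      · simp only
        rw [Polynomial.coeff_eq_zero_of_natDegree_lt (by omega)]
        exact zero_mem _
  rw [Ideal.FG.isNilpotent_iff_le_nilradical hfg]
  have hu := (Polynomial.isUnit_iff_coeff_isUnit_isNilpotent.1 (IsUnit.of_mul_eq_one E hHE)).2
  refine Ideal.span_le.2 ?_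
  rintro _ ⟨d, rfl⟩
  exact mem_nilradical.2 (hu (d + 1) (Nat.succ_ne_zero d))

/-- Nakayama's lemma for a nilpotent ideal. -/
theorem le_of_le_nilpotent_mul_sup {P M G : Ideal R} (hP : IsNilpotent P) (h : M ≤ P * M ⊔ G) :
    M ≤ G := by
  obtain ⟨N, hN⟩ := hP
  have key : ∀ N : ℕ, M ≤ P ^ N * M ⊔ G := by
    intro N
    induction N with
    | zero => simp
    | succ N ih =>
      refine ih.trans (sup_le ?_ le_sup_right)
      refine (Ideal.mul_mono_right h).trans ?_
      rw [Ideal.mul_sup, ← mul_assoc, ← pow_succ]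
      exact sup_le_sup_left Ideal.mul_le_right _
  have := key N
  rwa [hN, Ideal.zero_eq_bot, Ideal.bot_mul, bot_sup_eq] at this

/-! ### The two generating intervals -/

/-- Up to `posIdeal H * rowsIdeal H j c`, only the column sets `S` contained in
`{0, …, j + a - 1}` contribute: a row of index beyond the degree of `H` vanishes, and for columns
beyond the degree of `E` the complementary determinant vanishes. -/
theorem rowsIdeal_le_of_columns_lt {H E : Polynomial R} (hHE : H * E = 1) (hH0 : H.coeff 0 = 1)
    (hE0 : E.coeff 0 = 1) {m r i j a : ℕ} (hH : H.natDegree ≤ m) (hE : E.natDegree ≤ r)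
    (hi : 1 ≤ i) (him : i ≤ m) (hjr : j ≤ r) (ha : a = min (m - i) (r - j)) {I : Ideal R}
    (hI : posIdeal H * rowsIdeal H j ((i : ℤ) - j + 1) ≤ I)
    (hS : ∀ S : Fin j → ℕ, Function.Injective S → (∀ p, S p < j + a) →
      hankel H (fun p => (i : ℤ) - j + 1 + S p) (fun q => (q : ℕ)) ∈ I) :
    rowsIdeal H j ((i : ℤ) - j + 1) ≤ I := by
  refine Ideal.span_le.2 ?_
  rintro _ ⟨k, hk, rfl⟩
  by_cases hinj : Function.Injective k
  swap
  · simp only [Function.Injective, not_forall] at hinj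
    obtain ⟨p, q, hpq, hne⟩ := hinj
    rw [hankel_eq_zero_of_eq H hne hpq]
    exact zero_mem _
  obtain ⟨S, hkS⟩ : ∃ S : Fin j → ℕ, k = fun p => (i : ℤ) - j + 1 + S p :=
    ⟨fun p => (k p - ((i : ℤ) - j + 1)).toNat, funext fun p => by have := hk p; simp only; omega⟩
  have hSinj : Function.Injective S := by
    intro p q hpq
    refine hinj ?_
    rw [hkS]
    simp only [hpq]
  by_cases hlarge : ∃ p, (m : ℤ) < k p
  · obtain ⟨p, hp⟩ := hlarge
    rw [hankel_eq_zero_of_lt hH hp]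
    exact zero_mem _
  push Not at hlarge
  subst hkS
  by_cases hr : ∃ p, r ≤ S p
  · obtain ⟨p₁, hp₁⟩ := hr
    obtain ⟨p₀, -, hp₀⟩ := Finset.exists_max_image Finset.univ S ⟨p₁, Finset.mem_univ _⟩
    have hrS : r ≤ S p₀ := hp₁.trans (hp₀ p₁ (Finset.mem_univ _))
    obtain ⟨hjL, σ, τ, hσS, hτ, -⟩ := exists_complement (L := S p₀ + 1) S hSinj
      fun p => Nat.lt_succ_of_le (hp₀ p (Finset.mem_univ _))
    refine hankel_mem_of_complement hH0 i S σ τ hjL hσS hτ hI ?_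
    rw [hankel_eq_zero_of_natDegree_lt hHE hE0 (by omega)]
    · exact zero_mem _
    · intro p
      split_ifs with hp
      · push_cast
        omega
      · -- The largest column belongs to `S`.
        have h1 : σ p ≠ S p₀ := by
          intro e
          have h2 := hσS p₀ p₀.2
          have h3 := hτ p
          have h4 := hτ ⟨p₀, by omega⟩
          simp only [Fin.eta] at h2 h4
          have h5 := τ.injective (Fin.ext (by omega : (τ p : ℕ) = τ ⟨p₀, p₀.2.trans_le hjL⟩))
          have := congrArg Fin.val h5
          simp only at this
          have := p₀.2
          omega
        have h2 := hτ p
        have := (τ p).2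
        push_cast
        omega
  · push Not at hr
    refine hS S hSinj fun p => ?_
    have := hr p
    have := hlarge p
    simp only at this
    omega

/-- The determinants of the partitions `μ` with `i^j ⊆ μ ⊆ i^j ∪ b^{j+a}`, where `b = min i j`. -/
theorem rowsIdeal_le_span_long {H E : Polynomial R} (hHE : H * E = 1) (hH0 : H.coeff 0 = 1)
    (hE0 : E.coeff 0 = 1) {m r i j a b : ℕ} (hH : H.natDegree ≤ m) (hE : E.natDegree ≤ r)
    (hi : 1 ≤ i) (him : i ≤ m) (hjr : j ≤ r) (ha : a = min (m - i) (r - j))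
    (hb : b = min i j) :
    rowsIdeal H j ((i : ℤ) - j + 1) ≤ Ideal.span {x | ∃ μ : YoungDiagram,
      rect j i ≤ μ ∧ μ ≤ rect j i ⊔ rect (j + a) b ∧
        x = hankel H (fun p : Fin (j + a) => (μ.rowLen p : ℤ) - (p : ℕ)) fun q => (q : ℕ)} := by
  set G := Ideal.span {x | ∃ μ : YoungDiagram, rect j i ≤ μ ∧ μ ≤ rect j i ⊔ rect (j + a) b ∧
        x = hankel H (fun p : Fin (j + a) => (μ.rowLen p : ℤ) - (p : ℕ)) fun q => (q : ℕ)}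
  refine le_of_le_nilpotent_mul_sup (isNilpotent_posIdeal hHE) ?_
  refine rowsIdeal_le_of_columns_lt hHE hH0 hE0 hH hE hi him hjr ha le_sup_left
    fun S hSinj hSlt => ?_
  obtain ⟨hjL, σ, τ, hσS, hτ, hmono⟩ := exists_complement S hSinj hSlt
  refine hankel_mem_of_complement hH0 i S σ τ hjL hσS hτ le_sup_left ?_
  by_cases hrow : ∃ p, j ≤ p ∧ p < j + a ∧ σ p + i < j
  · -- The row `-σ p` is one of the rows `i, …, i - j + 1`.
    obtain ⟨p, hp, hpL, hlt⟩ := hrow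
    rw [hankel_eq_zero_of_eq H (p := ⟨p, hpL⟩) (p' := ⟨σ p + i, by omega⟩)]
    · exact zero_mem _
    · simp only [ne_eq, Fin.mk.injEq]
      omega
    · simp only
      rw [if_neg (by omega), if_pos hlt]
      push_cast
      ring
  push Not at hrow
  have hle : ∀ d p, j ≤ p → p + d + 1 = j + a → σ p ≤ p := by
    intro d
    induction d with
    | zero =>
      intro p hp h
      have := hτ ⟨p, by omega⟩
      have := (τ ⟨p, by omega⟩).2
      simp only at *
      omega
    | succ d ih =>
      intro p hp h
      have h1 := ih (p + 1) (by omega) (by omega)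
      have h2 := hmono p (p + 1) hp (by omega) (by omega)
      omega
  let f : ℕ → ℕ := fun p => if p < j then i else if p < j + a then p - σ p else 0
  have hf : Antitone f := by
    refine antitone_nat_of_succ_le fun p => ?_
    simp only [f]
    by_cases h1 : p + 1 < j
    · rw [if_pos h1, if_pos (by omega)]
    rw [if_neg h1]
    by_cases h2 : p + 1 < j + a
    swap
    · rw [if_neg h2]
      exact Nat.zero_le _
    rw [if_pos h2]
    by_cases h3 : p < j
    · rw [if_pos h3]
      have := hrow (p + 1) (by omega) h2
      omega
    · rw [if_neg h3, if_pos (by omega)]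
      have := hmono p (p + 1) (by omega) (by omega) h2
      omega
  refine Ideal.mem_sup_right (Ideal.subset_span ⟨diagramOf (j + a) f hf, ?_, ?_, ?_⟩)
  · rw [le_iff_rowLen_le]
    intro p
    rw [rowLen_rect, rowLen_diagramOf]
    by_cases h : p < j
    · rw [if_pos h, if_pos (by omega)]
      simp only [f]
      rw [if_pos h]
    · rw [if_neg h]
      exact Nat.zero_le _
  · rw [le_iff_rowLen_le]
    intro p
    rw [rowLen_sup, rowLen_rect, rowLen_rect, rowLen_diagramOf]
    by_cases h2 : p < j + a
    swap
    · rw [if_neg h2]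
      exact Nat.zero_le _
    rw [if_pos h2, if_pos h2]
    by_cases h : p < j
    · rw [if_pos h]
      simp only [f]
      rw [if_pos h]
      exact le_max_left _ _
    · rw [if_neg h]
      have h3 : f p ≤ f j := hf (by omega)
      have h4 : f j = j - σ j := by
        simp only [f]
        rw [if_neg (lt_irrefl j), if_pos (by omega)]
      have := hrow j le_rfl (by omega)
      omega
  · congr 1
    funext p
    rw [rowLen_diagramOf, if_pos p.2]
    simp only [f]
    by_cases h : (p : ℕ) < j
    · rw [if_pos h, if_pos h]
    · have h2 := p.2
      have := hle (j + a - 1 - p) p (by omega) (by omega)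
      rw [if_neg h, if_neg h, if_pos h2]
      omega

/-- The determinants of the partitions `μ` with `i^j ⊆ μ ⊆ i^j ∪ (i+a)^b`, where `b = min i j`. -/
theorem rowsIdeal_le_span_wide {H E : Polynomial R} (hHE : H * E = 1) (hH0 : H.coeff 0 = 1)
    (hE0 : E.coeff 0 = 1) {m r i j a b : ℕ} (hH : H.natDegree ≤ m) (hE : E.natDegree ≤ r)
    (hi : 1 ≤ i) (him : i ≤ m) (hjr : j ≤ r) (ha : a = min (m - i) (r - j))
    (hb : b = min i j) :
    rowsIdeal H j ((i : ℤ) - j + 1) ≤ Ideal.span {x | ∃ μ : YoungDiagram,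
      rect j i ≤ μ ∧ μ ≤ rect j i ⊔ rect b (i + a) ∧
        x = hankel H (fun p : Fin j => (μ.rowLen p : ℤ) - (p : ℕ)) fun q => (q : ℕ)} := by
  set G := Ideal.span {x | ∃ μ : YoungDiagram, rect j i ≤ μ ∧ μ ≤ rect j i ⊔ rect b (i + a) ∧
        x = hankel H (fun p : Fin j => (μ.rowLen p : ℤ) - (p : ℕ)) fun q => (q : ℕ)}
  refine le_of_le_nilpotent_mul_sup (isNilpotent_posIdeal hHE) ?_
  refine rowsIdeal_le_of_columns_lt hHE hH0 hE0 hH hE hi him hjr ha le_sup_left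
    fun S hSinj hSlt => ?_
  by_cases hrow : ∃ x, x + i < j ∧ ∀ p, S p ≠ x
  · -- The complement of `S` contributes a row which is already present.
    obtain ⟨x, hx, hxS⟩ := hrow
    obtain ⟨hjL, σ, τ, hσS, hτ, -⟩ := exists_complement S hSinj hSlt
    refine hankel_mem_of_complement hH0 i S σ τ hjL hσS hτ le_sup_left ?_
    obtain ⟨p, hp⟩ := τ.surjective ⟨x, by omega⟩
    have hσp : σ p = x := by rw [hτ, hp]
    have hpj : j ≤ p := by
      by_contra hc
      exact hxS ⟨p, not_le.1 hc⟩ (by rw [← hσS p (not_le.1 hc), hσp])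
    rw [hankel_eq_zero_of_eq H (p := p) (p' := ⟨x + i, by omega⟩)]
    · exact zero_mem _
    · intro e
      have := congrArg Fin.val e
      simp only at this
      omega
    · simp only
      rw [if_neg (by omega), if_pos hx, hσp]
      push_cast
      ring
  push Not at hrow
  set ρ := Tuple.sort fun p => OrderDual.toDual (S p) with hρ
  have hanti : StrictAnti (S ∘ ρ) := by
    have hmono := Tuple.monotone_sort fun p => OrderDual.toDual (S p)
    have h1 : Antitone (S ∘ ρ) := fun p q hpq => hmono hpq
    exact h1.strictAnti_of_injective (hSinj.comp ρ.injective)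
  have hperm : hankel H (fun p => (i : ℤ) - j + 1 + (S ∘ ρ) p) (fun q => (q : ℕ)) ∈
        posIdeal H * rowsIdeal H j ((i : ℤ) - j + 1) ⊔ G →
      hankel H (fun p => (i : ℤ) - j + 1 + S p) (fun q => (q : ℕ)) ∈
        posIdeal H * rowsIdeal H j ((i : ℤ) - j + 1) ⊔ G := by
    intro h
    rw [hankel_comm] at h ⊢
    exact (hankel_comp_perm_mem_iff H _ (fun p => (i : ℤ) - j + 1 + S p) ρ).1 h
  refine hperm ?_
  have hlt : ∀ p, (S ∘ ρ) p < j + a := fun p => hSlt _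
  have hmem : ∀ x, x + i < j → ∃ p, (S ∘ ρ) p = x := by
    intro x hx
    obtain ⟨p, hp⟩ := hrow x hx
    exact ⟨ρ.symm p, by simpa using hp⟩
  generalize S ∘ ρ = T at hanti hlt hmem ⊢
  have hstep : ∀ p (hp : p + 1 < j), T ⟨p + 1, hp⟩ < T ⟨p, by omega⟩ := fun p hp =>
    hanti (Fin.lt_def.2 (Nat.lt_succ_self p))
  have hge : ∀ d p (hp : p < j), p + d + 1 = j → d ≤ T ⟨p, hp⟩ := by
    intro d
    induction d with
    | zero => exact fun _ _ _ => Nat.zero_le _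
    | succ d ih =>
      intro p hp h
      have h1 := ih (p + 1) (by omega) (by omega)
      have h2 := hstep p (by omega)
      omega
  have hle : ∀ p (hp : p < j), T ⟨p, hp⟩ + p < j + a := by
    intro p
    induction p with
    | zero => exact fun hp => hlt _
    | succ p ih =>
      intro hp
      have h1 := ih (by omega)
      have h2 := hstep p hp
      omega
  have heq : ∀ d p (hp : p < j), p + d + 1 = j → i ≤ p → T ⟨p, hp⟩ ≤ d := by
    intro d
    induction d with
    | zero =>
      intro p hp h hip
      obtain ⟨q, hq⟩ := hmem 0 (by omega)
      rw [← hq]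
      exact hanti.antitone (Fin.le_def.2 (by have := q.2; simp only; omega))
    | succ d ih =>
      intro p hp h hip
      obtain ⟨q, hq⟩ := hmem (d + 1) (by omega)
      have h1 := ih (p + 1) (by omega) (by omega) (by omega)
      have hqp : (q : ℕ) ≤ p := by
        by_contra hc
        have h2 : T q ≤ T ⟨p + 1, by omega⟩ := hanti.antitone (Fin.le_def.2 (by simp only; omega))
        omega
      rw [← hq]
      exact hanti.antitone (Fin.le_def.2 hqp)
  let f : ℕ → ℕ := fun p => if h : p < j then T ⟨p, h⟩ + p + 1 + i - j else 0
  have hf : Antitone f := by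
    refine antitone_nat_of_succ_le fun p => ?_
    simp only [f]
    by_cases hp : p + 1 < j
    · rw [dif_pos hp, dif_pos (by omega)]
      have := hstep p hp
      omega
    · rw [dif_neg hp]
      exact Nat.zero_le _
  refine Ideal.mem_sup_right (Ideal.subset_span ⟨diagramOf j f hf, ?_, ?_, ?_⟩)
  · rw [le_iff_rowLen_le]
    intro p
    rw [rowLen_rect, rowLen_diagramOf]
    split_ifs with h
    · simp only [f]
      rw [dif_pos h]
      have := hge (j - 1 - p) p h (by omega)
      omega
    · exact le_rfl
  · rw [le_iff_rowLen_le]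
    intro p
    rw [rowLen_sup, rowLen_rect, rowLen_rect, rowLen_diagramOf]
    by_cases h : p < j
    swap
    · rw [if_neg h]
      exact Nat.zero_le _
    rw [if_pos h, if_pos h]
    simp only [f]
    rw [dif_pos h]
    have h1 := hle p h
    split_ifs with h2
    · omega
    · have := heq (j - 1 - p) p h (by omega) (by omega)
      omega
  · congr 1
    funext p
    rw [rowLen_diagramOf, if_pos p.2]
    simp only [f]
    rw [dif_pos p.2]
    have h1 := hge (j - 1 - p) p p.2 (by have := p.2; omega)
    have := p.2
    change _ ≤ T p at h1
    change _ = ((T p + p + 1 + i - j : ℕ) : ℤ) - p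
    omega

end Generators

section Presentation

/-! ### The presentation of the cohomology ring of the Grassmannian -/

theorem schur_eq_det {μ : YoungDiagram} {L : ℕ} (h : μ.colLen 0 ≤ L) :
    schur μ = Matrix.det (Matrix.of fun p q : Fin L =>
      completeHomogInt ((μ.rowLen p : ℤ) - (p : ℤ) + (q : ℤ))) := by
  refine Subtype.ext (funext fun N => ?_)
  have h1 := det_jacobiTrudi_stable N μ.rowLen (μ.colLen 0) L
    (fun p hp => rowLen_eq_zero le_rfl hp) h
  have h2 : ∀ K, restrict N (Matrix.det (Matrix.of fun p q : Fin K =>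
      completeHomogInt ((μ.rowLen p : ℤ) - (p : ℤ) + (q : ℤ)))) =
      Matrix.det (Matrix.of fun p q : Fin K => hz N ((μ.rowLen p : ℤ) - (p : ℤ) + (q : ℤ))) := by
    intro K
    rw [RingHom.map_det]
    congr 1
    ext1 p q
    simp [restrict_completeHomogInt]
  rw [← h2, ← h2] at h1
  exact h1

theorem completeHomog_eq_schur (c : ℕ) : completeHomog c = schur (rect 1 c) := by
  rw [schur_eq_det (L := 1) (by rw [colLen_le_iff, rowLen_rect]; simp), Matrix.det_fin_one]
  simp [rowLen_rect, completeHomogInt]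

theorem completeHomog_mem_boxIdeal {r m c : ℕ} (h : m < c) : completeHomog c ∈ boxIdeal r m := by
  rw [completeHomog_eq_schur]
  refine Ideal.subset_span (Set.mem_image_of_mem schur fun hle => ?_)
  have := le_iff_rowLen_le.1 hle 0
  rw [rowLen_rect, rowLen_rect, if_pos Nat.one_pos] at this
  split_ifs at this <;> omega

/-- The generating series of the `h_m`. -/
def homogSeries : PowerSeries SymmFun := PowerSeries.mk completeHomog

theorem completeHomog_zero : completeHomog 0 = 1 :=
  Subtype.ext (funext fun N => hsymm_zero (Fin N) ℤ)

/-- The inverse of the generating series of the `h_m`: its coefficients are, up to sign, the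
elementary symmetric functions. -/
def elemSeries : PowerSeries SymmFun := PowerSeries.invOfUnit homogSeries 1

theorem homogSeries_mul_elemSeries : homogSeries * elemSeries = 1 := by
  apply PowerSeries.mul_invOfUnit
  rw [← PowerSeries.coeff_zero_eq_constantCoeff_apply, homogSeries, PowerSeries.coeff_mk,
    completeHomog_zero, Units.val_one]

theorem restrict_coeff_elemSeries {N d : ℕ} (hd : N < d) :
    restrict N (PowerSeries.coeff d elemSeries) = 0 := by
  have h1 := congrArg (PowerSeries.map (restrict N)) homogSeries_mul_elemSeries
  have h2 : PowerSeries.map (restrict N) homogSeries =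
      PowerSeries.mk fun m => hsymm (Fin N) ℤ m := by
    ext m : 1
    rw [PowerSeries.coeff_map, homogSeries, PowerSeries.coeff_mk, PowerSeries.coeff_mk]
    rfl
  have h3 := hsymm_series N
  rw [map_mul, map_one, h2] at h1
  rw [← coe_fullProd] at h3
  have h4 : PowerSeries.map (restrict N) elemSeries = (fullProd N : PowerSeries _) := by
    rw [← mul_one (PowerSeries.map (restrict N) elemSeries), ← h3, ← mul_assoc,
      mul_comm (PowerSeries.map (restrict N) elemSeries), h1, one_mul]
  rw [← PowerSeries.coeff_map, h4, Polynomial.coeff_coe]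
  exact Polynomial.coeff_eq_zero_of_natDegree_lt ((natDegree_fullProd_le N).trans_lt hd)

theorem coeff_elemSeries_mem_boxIdeal {n r d : ℕ} (hr : r ≤ n) (hd : r < d) :
    PowerSeries.coeff d elemSeries ∈ boxIdeal r (n - r) := by
  rw [← ker_toCoinv hr, RingHom.mem_ker, toCoinv, RingHom.comp_apply, firstVars,
    RingHom.comp_apply, restrict_coeff_elemSeries hd, map_zero, map_zero]

/-- The truncation of a power series over `Λ`, with coefficients in `Λ / I_{r,m}`. -/
def truncMod (r m d : ℕ) (f : PowerSeries SymmFun) : Polynomial (SymmFun ⧸ boxIdeal r m) :=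
  ∑ k ∈ Finset.range (d + 1),
    Polynomial.monomial k (Ideal.Quotient.mk (boxIdeal r m) (PowerSeries.coeff k f))

theorem natDegree_truncMod_le (r m d : ℕ) (f : PowerSeries SymmFun) :
    (truncMod r m d f).natDegree ≤ d := by
  refine Polynomial.natDegree_sum_le_of_forall_le _ _ fun k hk => ?_
  exact (Polynomial.natDegree_monomial_le _).trans (Nat.lt_succ_iff.1 (Finset.mem_range.1 hk))

theorem coeff_truncMod {r m d : ℕ} {f : PowerSeries SymmFun}
    (h : ∀ k, d < k → PowerSeries.coeff k f ∈ boxIdeal r m) (k : ℕ) :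
    (truncMod r m d f).coeff k = Ideal.Quotient.mk (boxIdeal r m) (PowerSeries.coeff k f) := by
  rw [truncMod, Polynomial.finsetSum_coeff]
  simp only [Polynomial.coeff_monomial, Finset.sum_ite_eq', Finset.mem_range]
  split_ifs with hk
  · rfl
  · exact (Ideal.Quotient.eq_zero_iff_mem.2 (h k (by omega))).symm

theorem coe_truncMod {r m d : ℕ} {f : PowerSeries SymmFun}
    (h : ∀ k, d < k → PowerSeries.coeff k f ∈ boxIdeal r m) :
    (truncMod r m d f : PowerSeries (SymmFun ⧸ boxIdeal r m)) =
      PowerSeries.map (Ideal.Quotient.mk (boxIdeal r m)) f := by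
  ext k
  rw [Polynomial.coeff_coe, coeff_truncMod h, PowerSeries.coeff_map]

theorem coeff_homogSeries_mem {r m : ℕ} (k : ℕ) (hk : m < k) :
    PowerSeries.coeff k homogSeries ∈ boxIdeal r m := by
  rw [homogSeries, PowerSeries.coeff_mk]
  exact completeHomog_mem_boxIdeal hk

theorem truncMod_mul_truncMod {n r : ℕ} (hr : r ≤ n) :
    truncMod r (n - r) (n - r) homogSeries * truncMod r (n - r) r elemSeries = 1 := by
  apply Polynomial.coe_injective
  rw [Polynomial.coe_mul, coe_truncMod coeff_homogSeries_mem,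
    coe_truncMod fun k hk => coeff_elemSeries_mem_boxIdeal hr hk, ← map_mul,
    homogSeries_mul_elemSeries, map_one, Polynomial.coe_one]

theorem truncMod_homogSeries_coeff_zero (r m : ℕ) : (truncMod r m m homogSeries).coeff 0 = 1 := by
  rw [coeff_truncMod coeff_homogSeries_mem, homogSeries, PowerSeries.coeff_mk, completeHomog_zero,
    map_one]

theorem truncMod_elemSeries_coeff_zero {n r : ℕ} (hr : r ≤ n) :
    (truncMod r (n - r) r elemSeries).coeff 0 = 1 := by
  have h := congrArg (fun P => Polynomial.coeff P 0) (truncMod_mul_truncMod hr)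
  simpa [Polynomial.mul_coeff_zero, truncMod_homogSeries_coeff_zero] using h

theorem mk_schur_eq_hankel {r m : ℕ} {μ : YoungDiagram} {L : ℕ} (h : μ.colLen 0 ≤ L) :
    Ideal.Quotient.mk (boxIdeal r m) (schur μ) =
      hankel (truncMod r m m homogSeries) (fun p : Fin L => (μ.rowLen p : ℤ) - (p : ℕ))
        fun q => (q : ℕ) := by
  rw [schur_eq_det h, RingHom.map_det]
  unfold hankel
  congr 1
  ext1 p q
  simp only [RingHom.mapMatrix_apply, Matrix.map_apply, Matrix.of_apply]
  unfold completeHomogInt coeffInt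
  split_ifs
  · simp
  · rw [coeff_truncMod coeff_homogSeries_mem, homogSeries, PowerSeries.coeff_mk]

variable {n r i j a b : ℕ}

theorem mk_schur_mem_rowsIdeal {m : ℕ} {μ : YoungDiagram} (hμ : rect j i ≤ μ) :
    Ideal.Quotient.mk (boxIdeal r m) (schur μ) ∈
      rowsIdeal (truncMod r m m homogSeries) j ((i : ℤ) - j + 1) := by
  rw [mk_schur_eq_hankel (le_max_left (μ.colLen 0) j)]
  apply hankel_mem_rowsIdeal
  have h := card_filter_Ico (n := max (μ.colLen 0) j) (a := 0) (le_max_right (μ.colLen 0) j)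
  rw [Nat.sub_zero] at h
  refine h.symm.le.trans (Finset.card_le_card fun p hp => ?_)
  simp only [Finset.mem_filter, Finset.mem_univ, true_and] at hp ⊢
  have := le_iff_rowLen_le.1 hμ p
  rw [rowLen_rect, if_pos hp.2] at this
  omega

theorem mk_schur_mem_span_long (hr : r ≤ n) (hi : 1 ≤ i) (him : i ≤ n - r) (hjr : j ≤ r)
    (ha : a = min (n - r - i) (r - j)) (hb : b = min i j) {μ : YoungDiagram} (hμ : rect j i ≤ μ) :
    Ideal.Quotient.mk (boxIdeal r (n - r)) (schur μ) ∈
      Ideal.span (Ideal.Quotient.mk (boxIdeal r (n - r)) ''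
        schurInterval (rect j i) (rect j i ⊔ rect (j + a) b)) := by
  have h := rowsIdeal_le_span_long (truncMod_mul_truncMod hr) (truncMod_homogSeries_coeff_zero _ _)
    (truncMod_elemSeries_coeff_zero hr) (natDegree_truncMod_le _ _ _ _)
    (natDegree_truncMod_le _ _ _ _) hi him hjr ha hb (mk_schur_mem_rowsIdeal hμ)
  refine Ideal.span_mono ?_ h
  rintro _ ⟨ν, h1, h2, rfl⟩
  refine ⟨schur ν, ⟨ν, ⟨h1, h2⟩, rfl⟩, mk_schur_eq_hankel ?_⟩
  rw [colLen_le_iff]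
  have := le_iff_rowLen_le.1 h2 (j + a)
  rw [rowLen_sup, rowLen_rect, rowLen_rect, if_neg (by omega), if_neg (by omega)] at this
  simpa using this

theorem mk_schur_mem_span_wide (hr : r ≤ n) (hi : 1 ≤ i) (him : i ≤ n - r) (hjr : j ≤ r)
    (ha : a = min (n - r - i) (r - j)) (hb : b = min i j) {μ : YoungDiagram} (hμ : rect j i ≤ μ) :
    Ideal.Quotient.mk (boxIdeal r (n - r)) (schur μ) ∈
      Ideal.span (Ideal.Quotient.mk (boxIdeal r (n - r)) ''
        schurInterval (rect j i) (rect j i ⊔ rect b (i + a))) := by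
  have h := rowsIdeal_le_span_wide (truncMod_mul_truncMod hr) (truncMod_homogSeries_coeff_zero _ _)
    (truncMod_elemSeries_coeff_zero hr) (natDegree_truncMod_le _ _ _ _)
    (natDegree_truncMod_le _ _ _ _) hi him hjr ha hb (mk_schur_mem_rowsIdeal hμ)
  refine Ideal.span_mono ?_ h
  rintro _ ⟨ν, h1, h2, rfl⟩
  refine ⟨schur ν, ⟨ν, ⟨h1, h2⟩, rfl⟩, mk_schur_eq_hankel ?_⟩
  rw [colLen_le_iff]
  have := le_iff_rowLen_le.1 h2 j
  rw [rowLen_sup, rowLen_rect, rowLen_rect, if_neg (by omega), if_neg (by omega)] at this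
  simpa using this

end Presentation

/-! ### Generation of the Schubert ideals -/

section Generation

variable {n r s t : ℕ} {v : Perm (Fin n)}

/-- The embedding of the cohomology ring of the Grassmannian into that of the flag variety. -/
def grassmannianToCoinv (hr : r ≤ n) : SymmFun ⧸ boxIdeal r (n - r) →+* Coinv n :=
  Ideal.Quotient.lift _ (toCoinv hr) fun x hx => by rwa [← ker_toCoinv hr] at hx

theorem mul_mem_schubertSpan (hv : IsBigrassmannian r s t v) (ht : 1 ≤ t) (htr : t ≤ r)
    (hts : t ≤ s) (hr : r ≤ n) (hs : s ≤ n) (y : Coinv n) {x : Coinv n}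
    (hx : x ∈ schubertSpan v) : y * x ∈ schubertSpan v := by
  obtain ⟨f, rfl⟩ := Ideal.Quotient.mk_surjective x
  obtain ⟨g, rfl⟩ := Ideal.Quotient.mk_surjective y
  rw [← map_mul]
  rw [mk_mem_schubertSpan_iff] at hx ⊢
  refine mul_mem_avoiding (fun u hu p q hpq h => ?_) g hx
  simp only [Set.mem_ofPred_eq, hv.bruhatLE_iff ht htr hts hr hs, not_le] at hu ⊢
  exact mul_swap_mem_of_crossCount_lt hu p q hpq h

theorem toCoinv_schur_mem_schubertSpan (hv : IsBigrassmannian r s t v) (ht : 1 ≤ t) (htr : t ≤ r)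
    (hts : t ≤ s) (hr : r ≤ n) (hs : s ≤ n) {μ : YoungDiagram}
    (hμ : rect (r - t + 1) (s - t + 1) ≤ μ) : toCoinv hr (schur μ) ∈ schubertSpan v := by
  by_cases hbox : μ ≤ rect r (n - r)
  · rw [toCoinv, RingHom.comp_apply, mk_mem_schubertSpan_iff]
    intro u hu
    rw [schubertCoeff_schur hr hbox, if_neg]
    rintro rfl
    refine hu ?_
    rw [hv.bruhatLE_iff ht htr hts hr hs, le_crossCount_grassmannianPerm_iff hr ht htr]
    exact Or.inl hμ
  · rw [toCoinv_schur_eq_zero hr hbox]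
    exact zero_mem _

/-- A set of Schur functions above the rectangle that generates all of them in `Λ / I_{r,n-r}`
generates the intersection with `J_v`: an element of the intersection is a combination of the Schur
functions in the box, and its coefficients vanish at the shapes which do not contain the rectangle.
-/
theorem generatesInGrassmannian (hv : IsBigrassmannian r s t v) (ht : 1 ≤ t) (htr : t ≤ r)
    (hts : t ≤ s) (hr : r ≤ n) (hs : s ≤ n) {β : YoungDiagram}
    (hG : ∀ μ, rect (r - t + 1) (s - t + 1) ≤ μ →
      Ideal.Quotient.mk (boxIdeal r (n - r)) (schur μ) ∈
        Ideal.span (Ideal.Quotient.mk (boxIdeal r (n - r)) ''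
          schurInterval (rect (r - t + 1) (s - t + 1)) β)) :
    GeneratesInGrassmannian hr v (schurInterval (rect (r - t + 1) (s - t + 1)) β) := by
  intro f
  constructor
  · intro hf
    have h1 : ∀ x ∈ Ideal.span (Ideal.Quotient.mk (boxIdeal r (n - r)) ''
        schurInterval (rect (r - t + 1) (s - t + 1)) β),
        grassmannianToCoinv hr x ∈ schubertSpan v := by
      intro x hx
      induction hx using Submodule.span_induction with
      | mem x hx =>
        obtain ⟨_, ⟨μ, hμ, rfl⟩, rfl⟩ := hx
        exact toCoinv_schur_mem_schubertSpan hv ht htr hts hr hs hμ.1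
      | zero => rw [map_zero]; exact zero_mem _
      | add x y _ _ hx hy => rw [RingHom.map_add]; exact add_mem hx hy
      | smul c x _ hx =>
        rw [smul_eq_mul, RingHom.map_mul]
        exact mul_mem_schubertSpan hv ht htr hts hr hs _ hx
    exact h1 _ hf
  · intro hf
    obtain ⟨c, h1, h2⟩ := sub_sum_schur_mem_boxIdeal hr f
    rw [← Ideal.Quotient.eq] at h1
    rw [h1, map_sum]
    refine sum_mem fun μ hμ => ?_
    rw [map_zsmul]
    by_cases hle : rect (r - t + 1) (s - t + 1) ≤ μ
    · exact zsmul_mem (hG μ hle) _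
    · have h3 := mk_mem_schubertSpan_iff.1 hf
        (grassmannianPerm hr μ (mem_boxDiagrams.1 hμ)) (by
          simp only [Set.mem_ofPred_eq]
          rw [hv.bruhatLE_iff ht htr hts hr hs, le_crossCount_grassmannianPerm_iff hr ht htr]
          rintro (h | h)
          · exact hle h
          · omega)
      rw [h2 μ (mem_boxDiagrams.1 hμ), h3, zero_smul]
      exact zero_mem _

/-- A set of Schur functions above the rectangle that generates all of them in `Λ / I_{r,n-r}`
generates `J_v`. -/
theorem generatesInFlag (hv : IsBigrassmannian r s t v) (ht : 1 ≤ t) (htr : t ≤ r)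
    (hts : t ≤ s) (hr : r ≤ n) (hs : s ≤ n) {β : YoungDiagram}
    (hG : ∀ μ, rect (r - t + 1) (s - t + 1) ≤ μ →
      Ideal.Quotient.mk (boxIdeal r (n - r)) (schur μ) ∈
        Ideal.span (Ideal.Quotient.mk (boxIdeal r (n - r)) ''
          schurInterval (rect (r - t + 1) (s - t + 1)) β)) :
    GeneratesInFlag hr v (schurInterval (rect (r - t + 1) (s - t + 1)) β) := by
  apply le_antisymm
  · intro x hx
    change x ∈ Ideal.span _ at hx
    induction hx using Submodule.span_induction with
    | mem x hx =>
      obtain ⟨_, ⟨μ, hμ, rfl⟩, rfl⟩ := hx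
      exact toCoinv_schur_mem_schubertSpan hv ht htr hts hr hs hμ.1
    | zero => exact zero_mem _
    | add x y _ _ hx hy => exact add_mem hx hy
    | smul c x _ hx => exact mul_mem_schubertSpan hv ht htr hts hr hs _ hx
  · intro x hx
    obtain ⟨f, rfl⟩ := Ideal.Quotient.mk_surjective x
    rw [mk_mem_schubertSpan_iff] at hx
    change _ ∈ Ideal.span _
    have h1 := mk_mem_span_schur_of_avoiding hr ht htr hts (f := f) fun u hu => hx u (by
      simp only [Set.mem_ofPred_eq] at hu ⊢
      rw [hv.bruhatLE_iff ht htr hts hr hs]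
      exact not_le.2 hu)
    refine Ideal.span_le.2 ?_ h1
    rintro _ ⟨_, ⟨μ, ⟨hμ, -⟩, rfl⟩, rfl⟩
    have h2 := Ideal.mem_map_of_mem (grassmannianToCoinv hr) (hG μ hμ)
    rw [Ideal.map_span, Set.image_image] at h2
    exact h2

end Generation

/-! ### Counting partitions -/

section Counting

/-- The number of partitions in a rectangle: a partition `μ` with at most `b` parts of size at most
`a` corresponds to the subset `{μ_p + b - 1 - p}` of `{0, …, a + b - 1}`. -/
theorem ncard_Iic_rect (b a : ℕ) : (Set.Iic (rect b a)).ncard = (a + b).choose b := by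
  classical
  let F : YoungDiagram → Finset ℕ := fun μ => Finset.univ.image (alternantExp b μ)
  have hcol : ∀ μ ∈ Set.Iic (rect b a), μ.colLen 0 ≤ b := fun μ hμ => (le_rect_iff.1 hμ).1
  have hinj : Set.InjOn F (Set.Iic (rect b a)) := by
    intro μ hμ ν hν h
    refine alternantExp_injOn (hcol μ hμ) (hcol ν hν) (DFunLike.coe_injective ?_)
    have h1 : Set.range (alternantExp b μ) = Set.range (alternantExp b ν) := by
      have := congrArg (fun s : Finset ℕ => (s : Set ℕ)) h
      simpa [F] using this
    have hrev : ∀ κ, StrictMono fun p => alternantExp b κ (Fin.rev p) := fun κ p q hpq =>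
      strictAnti_alternantExp b κ (Fin.rev_lt_rev.2 hpq)
    have hrange : ∀ κ, Set.range (fun p => alternantExp b κ (Fin.rev p)) =
        Set.range (alternantExp b κ) := fun κ =>
      Function.Surjective.range_comp Fin.rev_surjective (alternantExp b κ)
    have h2 := (StrictMono.range_inj (hrev μ) (hrev ν)).1 (by rw [hrange, hrange, h1])
    funext p
    have := congrFun h2 (Fin.rev p)
    simpa using this
  have himage : F '' Set.Iic (rect b a) = ↑(Finset.powersetCard b (Finset.range (a + b))) := by
    ext S
    rw [Finset.mem_coe, Finset.mem_powersetCard]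
    constructor
    · rintro ⟨μ, hμ, rfl⟩
      constructor
      · intro x hx
        obtain ⟨p, -, rfl⟩ := Finset.mem_image.1 hx
        rw [Finset.mem_range, alternantExp_apply]
        have h1 := (le_rect_iff.1 hμ).2
        have h2 := μ.rowLen_anti 0 p (Nat.zero_le _)
        have := p.2
        omega
      · rw [Finset.card_image_of_injective _ (strictAnti_alternantExp b μ).injective,
          Finset.card_univ, Fintype.card_fin]
    · rintro ⟨hS, hcard⟩
      let β : Fin b →₀ ℕ := Finsupp.equivFunOnFinite.symm fun p =>
        S.orderEmbOfFin hcard (Fin.rev p)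
      have hβapp : ∀ p, β p = S.orderEmbOfFin hcard (Fin.rev p) := fun _ => rfl
      have hβ : StrictAnti β := by
        intro p q hpq
        rw [hβapp, hβapp]
        exact (S.orderEmbOfFin hcard).strictMono (Fin.rev_lt_rev.2 hpq)
      obtain ⟨μ, hμ, hμβ⟩ := exists_alternantExp hβ
      refine ⟨μ, ?_, ?_⟩
      · refine le_rect_iff.2 ⟨hμ, ?_⟩
        rcases Nat.eq_zero_or_pos b with h0 | hpos
        · rw [rowLen_eq_zero hμ (by omega)]
          exact Nat.zero_le _
        · have h1 := DFunLike.congr_fun hμβ ⟨0, hpos⟩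
          rw [alternantExp_apply, hβapp] at h1
          have h2 := Finset.mem_range.1
            (hS (S.orderEmbOfFin_mem hcard (Fin.rev (⟨0, hpos⟩ : Fin b))))
          simp only at h1
          omega
      · simp only [F, hμβ]
        apply Finset.coe_injective
        rw [Finset.coe_image, Finset.coe_univ, Set.image_univ]
        have : Set.range β = Set.range (S.orderEmbOfFin hcard) :=
          Function.Surjective.range_comp Fin.rev_surjective (S.orderEmbOfFin hcard)
        rw [this, Finset.range_orderEmbOfFin]
  rw [← hinj.ncard_image, himage, Set.ncard_coe_finset, Finset.card_powersetCard,
    Finset.card_range]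

/-- The diagrams between `i^j` and `i^j ∪ (i+a)^b` are `i^j` with a partition in a `b × a` rectangle
attached to the right of the first `b` rows. -/
theorem ncard_Icc_wide {i j a b : ℕ} (hbj : b ≤ j) :
    (Set.Icc (rect j i) (rect j i ⊔ rect b (i + a))).ncard = (a + b).choose a := by
  rw [Nat.choose_symm_add, ← ncard_Iic_rect b a]
  let g : YoungDiagram → YoungDiagram := fun lam => diagramOf j (fun p => i + lam.rowLen p)
    fun p q hpq => Nat.add_le_add_left (lam.rowLen_anti p q hpq) i
  have hg : ∀ lam p, (g lam).rowLen p = if p < j then i + lam.rowLen p else 0 :=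
    fun lam p => rowLen_diagramOf j _ _ p
  have hle : ∀ lam ∈ Set.Iic (rect b a), ∀ p, lam.rowLen p ≤ if p < b then a else 0 := by
    intro lam hlam p
    have := le_iff_rowLen_le.1 hlam p
    rwa [rowLen_rect] at this
  have hinj : Set.InjOn g (Set.Iic (rect b a)) := by
    intro lam hlam μ hμ h
    refine diagram_ext fun p => ?_
    have h1 := congrArg (fun ν => YoungDiagram.rowLen ν p) h
    simp only [hg] at h1
    have h2 := hle lam hlam p
    have h3 := hle μ hμ p
    split_ifs at h1 h2 h3 <;> omega
  rw [← hinj.ncard_image]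
  congr 1
  ext μ
  rw [Set.mem_Icc, le_iff_rowLen_le, le_iff_rowLen_le]
  simp only [rowLen_sup, rowLen_rect]
  constructor
  · rintro ⟨h1, h2⟩
    have hf : Antitone fun p => μ.rowLen p - i := fun p q hpq =>
      Nat.sub_le_sub_right (μ.rowLen_anti p q hpq) i
    refine ⟨diagramOf b _ hf, ?_, diagram_ext fun p => ?_⟩
    · rw [Set.mem_Iic, le_iff_rowLen_le]
      intro p
      rw [rowLen_diagramOf, rowLen_rect]
      have := h2 p
      split_ifs at this ⊢ <;> omega
    · rw [hg, rowLen_diagramOf]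
      have h3 := h1 p
      have h4 := h2 p
      split_ifs at h3 h4 ⊢ <;> omega
  · rintro ⟨lam, hlam, rfl⟩
    refine ⟨fun p => ?_, fun p => ?_⟩ <;>
    · rw [hg]
      have := hle lam hlam p
      split_ifs at this ⊢ <;> omega

/-- The diagrams between `i^j` and `i^j ∪ b^(j+a)` are `i^j` with a partition in an `a × b`
rectangle attached below. -/
theorem ncard_Icc_long {i j a b : ℕ} (hbi : b ≤ i) :
    (Set.Icc (rect j i) (rect j i ⊔ rect (j + a) b)).ncard = (a + b).choose a := by
  rw [add_comm a b, ← ncard_Iic_rect a b]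
  let g : YoungDiagram → YoungDiagram := fun lam =>
    diagramOf (j + a) (fun p => if p < j then i else min i (lam.rowLen (p - j))) fun p q hpq => by
      have := lam.rowLen_anti (p - j) (q - j) (by omega)
      simp only
      split_ifs <;> omega
  have hg : ∀ lam p, (g lam).rowLen p =
      if p < j + a then (if p < j then i else min i (lam.rowLen (p - j))) else 0 :=
    fun lam p => rowLen_diagramOf (j + a) _ _ p
  have hle : ∀ lam ∈ Set.Iic (rect a b), ∀ p, lam.rowLen p ≤ if p < a then b else 0 := by
    intro lam hlam p
    have := le_iff_rowLen_le.1 hlam p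
    rwa [rowLen_rect] at this
  have hinj : Set.InjOn g (Set.Iic (rect a b)) := by
    intro lam hlam μ hμ h
    refine diagram_ext fun p => ?_
    have h1 := congrArg (fun ν => YoungDiagram.rowLen ν (j + p)) h
    simp only [hg, Nat.add_sub_cancel_left] at h1
    have h2 := hle lam hlam p
    have h3 := hle μ hμ p
    split_ifs at h1 h2 h3 <;> omega
  rw [← hinj.ncard_image]
  congr 1
  ext μ
  rw [Set.mem_Icc, le_iff_rowLen_le, le_iff_rowLen_le]
  simp only [rowLen_sup, rowLen_rect]
  constructor
  · rintro ⟨h1, h2⟩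
    have hf : Antitone fun p => μ.rowLen (j + p) := fun p q hpq =>
      μ.rowLen_anti _ _ (Nat.add_le_add_left hpq j)
    refine ⟨diagramOf a _ hf, ?_, diagram_ext fun p => ?_⟩
    · rw [Set.mem_Iic, le_iff_rowLen_le]
      intro p
      rw [rowLen_diagramOf, rowLen_rect]
      have := h2 (j + p)
      split_ifs at this ⊢ <;> omega
    · rw [hg, rowLen_diagramOf]
      have h3 := h1 p
      have h4 := h2 p
      by_cases hp : p < j
      · rw [if_pos hp] at h3 h4 ⊢
        split_ifs at h4 ⊢ <;> omega
      · have e : j + (p - j) = p := by omega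
        rw [if_neg hp, e]
        rw [if_neg hp] at h4
        split_ifs at h4 ⊢ <;> omega
  · rintro ⟨lam, hlam, rfl⟩
    refine ⟨fun p => ?_, fun p => ?_⟩ <;>
    · rw [hg]
      have := hle lam hlam (p - j)
      split_ifs at this ⊢ <;> omega

theorem mk_schur_injOn {n r : ℕ} (hr : r ≤ n) :
    Set.InjOn (fun μ => Ideal.Quotient.mk (boxIdeal r (n - r)) (schur μ))
      (Set.Iic (rect r (n - r))) := by
  classical
  intro μ hμ ν hν h
  have h1 := (mk_boxIdeal_eq_iff hr).1 h
  have h2 := mem_coinvIdeal_iff.1 (Ideal.Quotient.eq.1 h1) (grassmannianPerm hr μ hμ)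
  rw [← schubertCoeffHom_apply, map_sub, schubertCoeffHom_apply, schubertCoeffHom_apply,
    schubertCoeff_grassmannianPerm hr hμ (le_rect_iff.1 hμ).1, if_pos rfl,
    schubertCoeff_grassmannianPerm hr hμ (le_rect_iff.1 hν).1] at h2
  by_contra hne
  rw [if_neg (Ne.symm hne)] at h2
  exact one_ne_zero (sub_eq_zero.1 h2)

theorem ncard_mk_schurInterval {n r : ℕ} (hr : r ≤ n) {α β : YoungDiagram}
    (hβ : β ≤ rect r (n - r)) :
    (Ideal.Quotient.mk (boxIdeal r (n - r)) '' schurInterval α β).ncard = (Set.Icc α β).ncard := by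
  rw [schurInterval, Set.image_image]
  exact ((mk_schur_injOn hr).mono fun μ hμ => hμ.2.trans hβ).ncard_image

theorem rect_le_rect {m c m' c' : ℕ} (hm : m ≤ m') (hc : c ≤ c') : rect m c ≤ rect m' c' := by
  rw [le_iff_rowLen_le]
  intro p
  rw [rowLen_rect, rowLen_rect]
  split_ifs <;> omega

end Counting

end SchubertGens

end

open SchubertGens

theorem theorem4 (n r s t : ℕ) (ht : 1 ≤ t) (htr : t ≤ r) (hts : t ≤ s) (hrn : r ≤ n)
    (hsn : s ≤ n) (hrs : r + s < n + t)
    (v : Equiv.Perm (Fin n)) (hv : IsBigrassmannian r s t v)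
    (i j a b : ℕ) (hi : i = s - t + 1) (hj : j = r - t + 1)
    (ha : a = min (n - r - i) (r - j)) (hb : b = min i j) :
    -- `𝔖_v` is the Schur polynomial `s_{i^j}(x₁, …, x_r)`
    schubert v = firstVars hrn (schur (rect j i)) ∧
    -- `Λ / I_{r,n-r}` embeds into the coinvariant algebra
    RingHom.ker (toCoinv hrn) = boxIdeal r (n - r) ∧
    -- the interval from `i^j` to `((i+a)^b, i^{j-b}) = i^j ∪ (i+a)^b`
    (GeneratesInGrassmannian hrn v (schurInterval (rect j i) (rect j i ⊔ rect b (i + a))) ∧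
      GeneratesInFlag hrn v (schurInterval (rect j i) (rect j i ⊔ rect b (i + a))) ∧
      (Ideal.Quotient.mk (boxIdeal r (n - r)) ''
        schurInterval (rect j i) (rect j i ⊔ rect b (i + a))).ncard = (a + b).choose a) ∧
    -- the interval from `i^j` to `(i^j, b^a) = i^j ∪ b^(j+a)`
    (GeneratesInGrassmannian hrn v (schurInterval (rect j i) (rect j i ⊔ rect (j + a) b)) ∧
      GeneratesInFlag hrn v (schurInterval (rect j i) (rect j i ⊔ rect (j + a) b)) ∧
      (Ideal.Quotient.mk (boxIdeal r (n - r)) ''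
        schurInterval (rect j i) (rect j i ⊔ rect (j + a) b)).ncard = (a + b).choose a) := by
  have him : i ≤ n - r := by omega
  have hjr : j ≤ r := by omega
  have hwide := fun μ (hμ : rect j i ≤ μ) =>
    mk_schur_mem_span_wide hrn (by omega) him hjr ha hb hμ
  have hlong := fun μ (hμ : rect j i ≤ μ) =>
    mk_schur_mem_span_long hrn (by omega) him hjr ha hb hμ
  refine ⟨?_, ker_toCoinv hrn, ⟨?_, ?_, ?_⟩, ⟨?_, ?_, ?_⟩⟩
  · subst hi hj
    rw [hv.eq_grassmannianPerm ht htr hts hrn (rect_le_rect hjr him)]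
    exact schubert_grassmannianPerm hrn _
  · subst hi hj
    exact generatesInGrassmannian hv ht htr hts hrn hsn hwide
  · subst hi hj
    exact generatesInFlag hv ht htr hts hrn hsn hwide
  · rw [ncard_mk_schurInterval hrn (sup_le (rect_le_rect hjr him)
      (rect_le_rect (by omega) (by omega)))]
    exact ncard_Icc_wide (by omega)
  · subst hi hj
    exact generatesInGrassmannian hv ht htr hts hrn hsn hlong
  · subst hi hj
    exact generatesInFlag hv ht htr hts hrn hsn hlong
  · rw [ncard_mk_schurInterval hrn (sup_le (rect_le_rect hjr him)
      (rect_le_rect (by omega) (by omega)))]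
    exact ncard_Icc_long (by omega)
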